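/- Let $k$ be a positive even integer and $m$ a positive integer; write $\tau=u+iv\in\mathbb H$, $z=x+iy\in\mathbb C$. **Harmonic Maass--Jacobi forms.** A function $F:\mathbb H\times\mathbb C\to\mathbb C$ that is real-analytic on $\mathbb H\times\mathbb C$ and holomorphic in $z$ is a harmonic Maass--Jacobi form of weight $k$ and index $m$ on $\mathrm{SL}_2(\mathbb Z)$ (written $F\in\hat J_{k,m}$) if 1. $(c\tau+d)^{-k}e^{-2\pi i m cz^2/(c\tau+d)}F\left(\frac{a\tau+b}{c\tau+d},\frac{z}{c\tau+d}\right)=F(\tau,z)$ for all $\begin{pmatrix}a&b\\c&d\end{pmatrix}\in\mathrm{SL}_2(\mathbb Z)$; 2. $e^{2\pi i m(\lambda^2\tau+2\lambda z)}F(\tau,z+\lambda\tau+\mu)=F(\tau,z)$ for all $\lambda,\mu\in\mathbb Z$; 3. $\mathcal C_{k,m}F=0$ for the Casimir operator $$\begin{aligned}\mathcal C_{k,m}=&-2(\tau-\bar\tau)^2\partial_{\tau\bar\tau}-(2k-1)(\tau-\bar\tau)\partial_{\bar\tau}+\tfrac{(\tau-\bar\tau)^2}{4\pi i m}\partial_{\bar\tau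 zz}+\tfrac{k(\tau-\bar\tau)}{4\pi i m}\partial_{z\bar z}+\tfrac{(\tau-\bar\tau)(z-\bar z)}{4\pi i m}\partial_{zz\bar z}-2(\tau-\bar\tau)(z-\bar z)\partial_{\tau\bar z}\\&+(1-k)(z-\bar z)\partial_{\bar z}+\tfrac{(\tau-\bar\tau)^2}{4\pi i m}\partial_{\tau\bar z\bar z}+\left(\tfrac{(z-\bar z)^2}{2}+\tfrac{k(\tau-\bar\tau)}{4\pi i m}\right)\partial_{\bar z\bar z}+\tfrac{(\tau-\bar\tau)(z-\bar z)}{4\pi i m}\partial_{z\bar z\bar z};\end{aligned}$$ 4. there are numbers $c(D,r)$ ($D\in\mathbb Z_{\le 0}$, $r\in\mathbb Z/2m\mathbb Z$), nonzero for only finitely many $D$, such that for some $h>0$, with $P(\tau,z)=\sum_{l,r\in\mathbb Z,\,4ml-r^2\le 0}c(4ml-r^2,r)e^{2\pi i l\tau}e^{2\pi i r z}$, one has $F(\tau,z)-P(\tau,z)=O(e^{-hv}e^{2\pi m y^2/v})$ as $v\to\infty$, uniformly in $u$ and $z$. **Coefficients.** Let $c^+_F(l,r)$ ($l,r\in\mathbb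 Z$, $4ml-r^2\ge -D_0$; put $c_F^+(l,r)=0$ if $4ml-r^2<-D_0$) and $c^-_F(l,r)$ ($4ml-r^2<0$) be complex numbers that depend only on $4ml-r^2$ and on $r$ modulo $2m$, and suppose that for some $C>0$ $$c_F^\pm(l,r)=O\left(e^{C\sqrt{|4ml-r^2|}}\right)\quad\text{as } |4ml-r^2|\to\infty .$$ With $\Gamma(a,w)=\int_w^\infty e^{-t}t^{a-1}dt$, put $$F(\tau,z)=\sum_{l,r\in\mathbb Z}c_F^+(l,r)e^{2\pi i l\tau}e^{2\pi i r z}+\sum_{\substack{l,r\in\mathbb Z\\4ml-r^2<0}}c_F^-(l,r)\,\Gamma\left(\tfrac32-k,-\tfrac{(4ml-r^2)\pi v}{m}\right)e^{2\pi i l\tau}e^{2\pi i r z}.$$ **$L$-series.** For $\varphi:\mathbb R_+\to\mathbb C$ let $\varphi_s(x)=\varphi(x)x^{s-1}$ ($s\in\mathbb C$), $(\mathcal L\varphi)(s)=\int_0^\infty e^{-st}\varphi(t)\,dt$ and $(\varphi|_{5/2-k}S)(x)=x^{k-5/2}\varphi(1/x)$; for an integer $n<0$ let $$I_n(\psi)=\left(-\tfrac{\pi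 n}{m}\right)^{3/2-k}\int_0^\infty\frac{(\mathcal L\psi)\left(-\pi n(2t+1)/(2m)\right)}{(1+t)^{k-1/2}}\,dt .$$ For compactly supported piecewise smooth $\varphi$ on $\mathbb R_+$ define $L_F(\varphi),L_{\alpha_kF}(\varphi)\in\mathbb C^{2m}$ by their components ($1\le j\le 2m$; $n\in\mathbb Z$) $$L_F(\varphi)_j=\sum_{n\equiv -j^2\,(4m)}c_F^+\left(\tfrac{n+j^2}{4m},j\right)(\mathcal L\varphi)\left(\tfrac{\pi n}{2m}\right)+\sum_{\substack{n<0\\ n\equiv -j^2\,(4m)}}c_F^-\left(\tfrac{n+j^2}{4m},j\right)I_n(\varphi_{5/2-k}),$$ $$L_{\alpha_kF}(\varphi)_j=\tfrac{2k-1}{4}L_F(\varphi)_j-2\pi\sum_{n\equiv -j^2\,(4m)}c_F^+\left(\tfrac{n+j^2}{4m},j\right)\tfrac{n}{4m}(\mathcal L\varphi_2)\left(\tfrac{\pi n}{2m}\right)-2\pi\sum_{\substack{n<0\\ n\equiv -j^2\,(4m)}}c_F^-\left(\tfrac{n+j^2}{4m},j\right)\tfrac{n}{4m}I_n(\varphi_{7/2-k}).$$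 Let $\rho_m(S)$ be the $2m\times 2m$ matrix with $\rho_m(S)\mathbf e_l=\frac1{\sqrt{2im}}\sum_{l'=1}^{2m}e^{-2\pi i ll'/(2m)}\mathbf e_{l'}$ and $\overline{\rho_m}(S)$ its complex conjugate (roots and powers are principal). **Test functions.** A function on $\mathbb R_+$ is piecewise smooth if near every point it agrees on either side with a function smooth across that point and its value at the point is one of the two one-sided limits. Let $S_c(\mathbb R_+)$ be a set of compactly supported piecewise smooth functions $\mathbb R_+\to\mathbb C$ such that $\varphi_s\in S_c(\mathbb R_+)$ whenever $\varphi\in S_c(\mathbb R_+)$, $s\in\mathbb C$, and such that for every $y>0$ some $\varphi\in S_c(\mathbb R_+)$ has $\varphi(y)\ne0$ (for example, the set of all compactly supported piecewise smooth functions). **Theorem.** Suppose that for every $\varphi\in S_c(\mathbb R_+)$ $$L_F(\varphi)=i^{k-\frac12}\,\overline{\rho_m}(S)\,L_F(\varphi|_{5/2-k}S)\qquad\text{and}\qquad L_{\alpha_kF}(\varphi)=-i^{k-\frac12}\,\overline{\rho_m}(S)\,L_{\alpha_kF}(\varphi|_{5/2-k}S).$$ Then $F$ is a harmonic Maass--Jacobi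 form of weight $k$ and index $m$, i.e. $F\in\hat J_{k,m}$. -/

import Mathlib

open Complex

noncomputable section

namespace JacobiConverse

/-! ### Harmonic Maass-Jacobi forms

Functions on `ℍ × ℂ` are written as functions on `ℂ × ℂ`, and only their restriction to
`{(τ, z) | 0 < Im τ}` is ever used. -/

/-- The domain `ℍ × ℂ`. -/
def domain : Set (ℂ × ℂ) := {p | 0 < p.1.im}

/-- The Wirtinger derivative `∂/∂τ = (∂/∂u - i ∂/∂v) / 2`, where `τ = u + iv`. -/
def dTau (F : ℂ × ℂ → ℂ) (p : ℂ × ℂ) : ℂ :=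
  (fderiv ℝ F p (1, 0) - I * fderiv ℝ F p (I, 0)) / 2

/-- The Wirtinger derivative `∂/∂τ̄ = (∂/∂u + i ∂/∂v) / 2`. -/
def dTauBar (F : ℂ × ℂ → ℂ) (p : ℂ × ℂ) : ℂ :=
  (fderiv ℝ F p (1, 0) + I * fderiv ℝ F p (I, 0)) / 2

/-- The Wirtinger derivative `∂/∂z = (∂/∂x - i ∂/∂y) / 2`, where `z = x + iy`. -/
def dZ (F : ℂ × ℂ → ℂ) (p : ℂ × ℂ) : ℂ :=
  (fderiv ℝ F p (0, 1) - I * fderiv ℝ F p (0, I)) / 2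

/-- The Wirtinger derivative `∂/∂z̄ = (∂/∂x + i ∂/∂y) / 2`. -/
def dZBar (F : ℂ × ℂ → ℂ) (p : ℂ × ℂ) : ℂ :=
  (fderiv ℝ F p (0, 1) + I * fderiv ℝ F p (0, I)) / 2

/-- The Casimir operator `C_{k,m}`. -/
def casimir (k m : ℕ) (F : ℂ × ℂ → ℂ) (p : ℂ × ℂ) : ℂ :=
  let T : ℂ := p.1 - (starRingEnd ℂ) p.1
  let Z : ℂ := p.2 - (starRingEnd ℂ) p.2
  let w : ℂ := 4 * Real.pi * I * m
  (-2 : ℂ) * T ^ 2 * dTau (dTauBar F) p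
    - (2 * k - 1) * T * dTauBar F p
    + T ^ 2 / w * dTauBar (dZ (dZ F)) p
    + k * T / w * dZ (dZBar F) p
    + T * Z / w * dZ (dZ (dZBar F)) p
    - 2 * T * Z * dTau (dZBar F) p
    + (1 - k) * Z * dZBar F p
    + T ^ 2 / w * dTau (dZBar (dZBar F)) p
    + (Z ^ 2 / 2 + k * T / w) * dZBar (dZBar F) p
    + T * Z / w * dZ (dZBar (dZBar F)) p

/-- The action `F|_{k,m} γ` of `γ ∈ SL₂(ℤ)`. -/
def slash (k m : ℕ) (F : ℂ × ℂ → ℂ) (γ : Matrix.SpecialLinearGroup (Fin 2) ℤ)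
    (p : ℂ × ℂ) : ℂ :=
  let j : ℂ := (γ 1 0 : ℂ) * p.1 + (γ 1 1 : ℂ)
  j ^ (-(k : ℤ)) * exp (-(2 * Real.pi * I * m * ((γ 1 0 : ℂ) * p.2 ^ 2 / j))) *
    F (((γ 0 0 : ℂ) * p.1 + (γ 0 1 : ℂ)) / j, p.2 / j)

/-- The action `F|_m (λ, μ)` of `(λ, μ) ∈ ℤ²`. -/
def heisenberg (m : ℕ) (F : ℂ × ℂ → ℂ) (a b : ℤ) (p : ℂ × ℂ) : ℂ :=
  exp (2 * Real.pi * I * m * ((a : ℂ) ^ 2 * p.1 + 2 * a * p.2)) * F (p.1, p.2 + a * p.1 + b)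

/-- The discriminant `4ml - r²`. -/
def disc (m : ℕ) (l r : ℤ) : ℤ := 4 * m * l - r ^ 2

/-- The monomial `e^{2πilτ} e^{2πirz}`. -/
def monomial (l r : ℤ) (p : ℂ × ℂ) : ℂ :=
  exp (2 * Real.pi * I * l * p.1) * exp (2 * Real.pi * I * r * p.2)

/-- The series `∑ c(4ml - r², r mod 2m) e^{2πilτ} e^{2πirz}` over all `(l, r)` with
`4ml - r² ≤ 0`. -/
def principalPart (m : ℕ) (c : ℤ → ZMod (2 * m) → ℂ) (p : ℂ × ℂ) : ℂ :=
  ∑' a : ℤ × ℤ, if disc m a.1 a.2 ≤ 0 then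
    c (disc m a.1 a.2) (a.2 : ZMod (2 * m)) * monomial a.1 a.2 p else 0

/-- `F` is a harmonic Maass-Jacobi form of weight `k` and index `m` on `SL₂(ℤ)`. -/
structure IsHarmonicMaassJacobiForm (k m : ℕ) (F : ℂ × ℂ → ℂ) : Prop where
  realAnalytic : AnalyticOnNhd ℝ F domain
  holomorphic : ∀ τ : ℂ, 0 < τ.im → Differentiable ℂ fun z => F (τ, z)
  slash_eq : ∀ γ : Matrix.SpecialLinearGroup (Fin 2) ℤ, ∀ p ∈ domain, slash k m F γ p = F p
  heisenberg_eq : ∀ a b : ℤ, ∀ p ∈ domain, heisenberg m F a b p = F p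
  casimir_eq : ∀ p ∈ domain, casimir k m F p = 0
  growth : ∃ c : ℤ → ZMod (2 * m) → ℂ, {D : ℤ | D ≤ 0 ∧ ∃ r, c D r ≠ 0}.Finite ∧
    ∃ h : ℝ, 0 < h ∧ ∃ A V : ℝ, ∀ p ∈ domain, V ≤ p.1.im →
      ‖F p - principalPart m c p‖ ≤
        A * (Real.exp (-h * p.1.im) * Real.exp (2 * Real.pi * m * p.2.im ^ 2 / p.1.im))

/-! ### The Fourier series -/

/-- The incomplete gamma function `Γ(a, w) = ∫_w^∞ e^{-t} t^{a-1} dt` for `w > 0`. -/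
def incGamma (a w : ℝ) : ℝ := ∫ t in Set.Ioi w, Real.exp (-t) * t ^ (a - 1)

/-- The Fourier series with coefficients `c⁺(l, r)` in the holomorphic part and `c⁻(l, r)`,
`4ml - r² < 0`, in the non-holomorphic part. -/
def fourierSeries (k m : ℕ) (cp cm : ℤ → ℤ → ℂ) (p : ℂ × ℂ) : ℂ :=
  (∑' a : ℤ × ℤ, cp a.1 a.2 * monomial a.1 a.2 p) +
    ∑' a : ℤ × ℤ, if disc m a.1 a.2 < 0 then
      cm a.1 a.2 *
        (incGamma (3 / 2 - k) (-(disc m a.1 a.2 : ℝ) * Real.pi * p.1.im / m) : ℂ) *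
        monomial a.1 a.2 p else 0

/-! ### Test functions -/

/-- Piecewise smooth functions on `ℝ₊`: on either side of every point the function agrees near
that point with a smooth function, and its value there is one of the two one-sided limits. -/
def PiecewiseSmooth (φ : ℝ → ℂ) : Prop :=
  ∀ y : ℝ, 0 < y → ∃ ε : ℝ, 0 < ε ∧ ∃ g h : ℝ → ℂ,
    ContDiff ℝ (⊤ : ℕ∞) g ∧ ContDiff ℝ (⊤ : ℕ∞) h ∧
    (∀ x ∈ Set.Ioo (y - ε) y, φ x = g x) ∧ (∀ x ∈ Set.Ioo y (y + ε), φ x = h x) ∧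
    (φ y = g y ∨ φ y = h y)

/-- Complex-valued, compactly supported, piecewise smooth functions on `ℝ₊` (extended by `0`). -/
def IsTestFunction (φ : ℝ → ℂ) : Prop :=
  PiecewiseSmooth φ ∧ ∃ a b : ℝ, 0 < a ∧ ∀ x, x ∉ Set.Icc a b → φ x = 0

/-- `φ_s(x) = φ(x) x^{s-1}`. -/
def twist (φ : ℝ → ℂ) (s : ℂ) (x : ℝ) : ℂ := φ x * (x : ℂ) ^ (s - 1)

/-- `(φ|_{2-κ} S)(x) = x^{κ-2} φ(1/x)`, here for the weight `κ = k - 1/2`. -/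
def slashS (k : ℕ) (φ : ℝ → ℂ) (x : ℝ) : ℂ := (x : ℂ) ^ ((k : ℂ) - 5 / 2) * φ (1 / x)

/-- The Laplace transform. -/
def laplace (φ : ℝ → ℂ) (s : ℂ) : ℂ := ∫ t in Set.Ioi (0 : ℝ), exp (-(s * t)) * φ t

/-! ### The `L`-series

Components are indexed by `j = 1, …, 2m`. The numbers `n` with `n + j² ≡ 0 (mod 4m)` are
`n = 4ml - j²` with `l = (n + j²) / (4m) ∈ ℤ`, and the sums run over `l`. -/

/-- The label `1, …, 2m` of an element of `Fin (2 * m)`. -/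
def label {m : ℕ} (j : Fin (2 * m)) : ℤ := (j : ℤ) + 1

/-- The integral `(-πn/m)^{3/2-k} ∫_0^∞ (ℒψ)(-πn(2t+1)/(2m)) (1+t)^{-(k-1/2)} dt`, for `n < 0`. -/
def nonholTerm (k m : ℕ) (n : ℤ) (ψ : ℝ → ℂ) : ℂ :=
  ((-(Real.pi * n / m) : ℝ) : ℂ) ^ ((3 / 2 : ℂ) - k) *
    ∫ t in Set.Ioi (0 : ℝ),
      laplace ψ ((-(Real.pi * n * (2 * t + 1) / (2 * m)) : ℝ) : ℂ) /
        ((1 + t : ℝ) : ℂ) ^ ((k : ℂ) - 1 / 2)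

/-- The vector-valued `L`-series `L_F(φ)`. -/
def LSer (k m : ℕ) (cp cm : ℤ → ℤ → ℂ) (φ : ℝ → ℂ) (j : Fin (2 * m)) : ℂ :=
  (∑' l : ℤ, cp l (label j) *
      laplace φ ((Real.pi * disc m l (label j) / (2 * m) : ℝ) : ℂ)) +
    ∑' l : ℤ, if disc m l (label j) < 0 then
      cm l (label j) * nonholTerm k m (disc m l (label j)) (twist φ (5 / 2 - k)) else 0

/-- The vector-valued `L`-series `L_{α_k F}(φ)`. -/
def LSerAlpha (k m : ℕ) (cp cm : ℤ → ℤ → ℂ) (φ : ℝ → ℂ) (j : Fin (2 * m)) : ℂ :=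
  (2 * k - 1) / 4 * LSer k m cp cm φ j
    - 2 * Real.pi * (∑' l : ℤ, cp l (label j) * ((disc m l (label j) : ℂ) / (4 * m)) *
        laplace (twist φ 2) ((Real.pi * disc m l (label j) / (2 * m) : ℝ) : ℂ))
    - 2 * Real.pi * ∑' l : ℤ, if disc m l (label j) < 0 then
        cm l (label j) * ((disc m l (label j) : ℂ) / (4 * m)) *
          nonholTerm k m (disc m l (label j)) (twist φ (7 / 2 - k)) else 0

/-- The matrix of `ρ_m(S) : e_l ↦ (2im)^{-1/2} ∑_{l'} e^{-2πi l l' / (2m)} e_{l'}` for the Weil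
representation `ρ_m`. -/
def weilS (m : ℕ) : Matrix (Fin (2 * m)) (Fin (2 * m)) ℂ :=
  Matrix.of fun l' l =>
    1 / (2 * I * m : ℂ) ^ (1 / 2 : ℂ) *
      exp (-(2 * Real.pi * I * (label l * label l' : ℂ) / (2 * m)))

/-- The complex conjugate `ρ̄_m(S)`. -/
def weilSBar (m : ℕ) : Matrix (Fin (2 * m)) (Fin (2 * m)) ℂ :=
  (weilS m).map (starRingEnd ℂ)

end JacobiConverse

end

/-! In the theta decomposition `F = ∑ h_s θ_s` each component `h_s` is the expansion of a harmonic
Maass form of weight `k - 1/2`. The `j`-th components of `L_F(φ)` and `L_{α_k F}(φ)` are the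
integrals of `h_j(it)` and of `(2k - 1)/4 h_j(it) + i t ∂h_j/∂u(it)` against `φ(t)`. Orthogonality
to all twists `φ_s` is the vanishing of all moments, so the two families of identities say that `h`
and its image under `S` have the same Cauchy data on the imaginary axis. The `τ̄`-derivative of
either is `v ^ (1/2 - k)` times an antiholomorphic function, so these data determine it, and `h`
transforms under `S` dually to the theta functions. This makes `F` invariant under `S`; invariance
under `T` and under `ℤ²` is visible in the Fourier expansion. Finally `θ_s` solves the heat
equation, which reduces `C_{k,m} F = 0` to the same property of the `∂h_s/∂τ̄`. -/

noncomputable section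

namespace JacobiConverse

open MeasureTheory Topology Filter
open UpperHalfPlane (upperHalfPlaneSet isOpen_upperHalfPlaneSet)

/-! ### Superpositions of exponentials of linear forms -/

section ExpSuperposition

variable {𝕜 E X : Type*} [RCLike 𝕜] [NormedAlgebra 𝕜 ℂ] [NormedAddCommGroup E] [NormedSpace 𝕜 E]
  [MeasurableSpace X] {μ : Measure X} {c : X → ℂ} {L : X → E →L[𝕜] ℂ} {x : E} {R : ℝ}

/-- The Taylor series at the origin of `y ↦ exp (ℓ y)`, for a linear form `ℓ`. -/
def expFormSeries (ℓ : E →L[𝕜] ℂ) : FormalMultilinearSeries 𝕜 E ℂ := fun n =>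
  (n.factorial : ℂ)⁻¹ •
    (ContinuousMultilinearMap.mkPiAlgebraFin 𝕜 n ℂ).compContinuousLinearMap fun _ => ℓ

theorem expFormSeries_apply (ℓ : E →L[𝕜] ℂ) (n : ℕ) (y : E) :
    expFormSeries ℓ n (fun _ => y) = ℓ y ^ n / n.factorial := by
  simp [expFormSeries, div_eq_inv_mul]

theorem hasSum_expFormSeries (ℓ : E →L[𝕜] ℂ) (y : E) :
    HasSum (fun n => expFormSeries ℓ n fun _ => y) (exp (ℓ y)) := by
  simp_rw [expFormSeries_apply, Complex.exp_eq_exp_ℂ]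
  exact NormedSpace.expSeries_div_hasSum_exp _

theorem norm_expFormSeries_le (ℓ : E →L[𝕜] ℂ) (n : ℕ) :
    ‖expFormSeries ℓ n‖ ≤ ‖ℓ‖ ^ n / n.factorial := by
  have h := (ContinuousMultilinearMap.mkPiAlgebraFin 𝕜 n ℂ).norm_compContinuousLinearMap_le
    fun _ => ℓ
  rw [expFormSeries, norm_smul, norm_inv, Complex.norm_natCast, div_eq_inv_mul]
  gcongr
  simpa using h

theorem continuous_expFormSeries (n : ℕ) :
    Continuous fun ℓ : E →L[𝕜] ℂ => expFormSeries ℓ n := by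
  have hcomp : Continuous fun ℓ : E →L[𝕜] ℂ =>
      ContinuousMultilinearMap.compContinuousLinearMapContinuousMultilinear 𝕜
        (fun _ : Fin n => E) (fun _ : Fin n => ℂ) ℂ fun _ => ℓ :=
    (ContinuousMultilinearMap.cont _).comp (continuous_pi fun _ => continuous_id)
  have happly : Continuous fun ℓ : E →L[𝕜] ℂ =>
      (ContinuousMultilinearMap.mkPiAlgebraFin 𝕜 n ℂ).compContinuousLinearMap fun _ => ℓ :=
    (ContinuousLinearMap.apply 𝕜 _
      (ContinuousMultilinearMap.mkPiAlgebraFin 𝕜 n ℂ)).continuous.comp hcomp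
  exact happly.const_smul ((n.factorial : ℂ)⁻¹)

theorem norm_smul_expFormSeries_mul_pow_le (w : ℂ) (ℓ : E →L[𝕜] ℂ) (x : E) (hR : 0 ≤ R) (n : ℕ) :
    ‖(w * exp (ℓ x)) • expFormSeries ℓ n‖ * R ^ n ≤
      ‖w‖ * Real.exp ((ℓ x).re + R * ‖ℓ‖) := by
  rw [norm_smul, norm_mul, Complex.norm_exp]
  calc ‖w‖ * Real.exp (ℓ x).re * ‖expFormSeries ℓ n‖ * R ^ n
      ≤ ‖w‖ * Real.exp (ℓ x).re * (‖ℓ‖ ^ n / n.factorial) * R ^ n := by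
        gcongr
        exact norm_expFormSeries_le ℓ n
    _ = ‖w‖ * Real.exp (ℓ x).re * ((R * ‖ℓ‖) ^ n / n.factorial) := by ring
    _ ≤ ‖w‖ * Real.exp (ℓ x).re * Real.exp (R * ‖ℓ‖) := by
        gcongr
        exact Real.pow_div_factorial_le_exp _ (by positivity) n
    _ = ‖w‖ * Real.exp ((ℓ x).re + R * ‖ℓ‖) := by rw [Real.exp_add, mul_assoc]

theorem norm_smul_expFormSeries_apply_le (w : ℂ) (ℓ : E →L[𝕜] ℂ) (x y : E) (hR : 0 < R) (n : ℕ) :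
    ‖((w * exp (ℓ x)) • expFormSeries ℓ n) fun _ => y‖ ≤
      (‖y‖ / R) ^ n * (‖w‖ * Real.exp ((ℓ x).re + R * ‖ℓ‖)) := by
  calc ‖((w * exp (ℓ x)) • expFormSeries ℓ n) fun _ => y‖
      ≤ ‖(w * exp (ℓ x)) • expFormSeries ℓ n‖ * ‖y‖ ^ n := by
        simpa using ((w * exp (ℓ x)) • expFormSeries ℓ n).le_opNorm fun _ => y
    _ = (‖y‖ / R) ^ n * (‖(w * exp (ℓ x)) • expFormSeries ℓ n‖ * R ^ n) := by
        rw [div_pow]; field_simp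
    _ ≤ _ := mul_le_mul_of_nonneg_left (norm_smul_expFormSeries_mul_pow_le w ℓ x hR.le n)
        (by positivity)

theorem norm_mul_exp_le (w : ℂ) (ℓ : E →L[𝕜] ℂ) {x y : E} (hy : ‖y - x‖ ≤ R) :
    ‖w * exp (ℓ y)‖ ≤ ‖w‖ * Real.exp ((ℓ x).re + R * ‖ℓ‖) := by
  have hre : (ℓ y).re - (ℓ x).re ≤ R * ‖ℓ‖ :=
    calc (ℓ y).re - (ℓ x).re = (ℓ (y - x)).re := by rw [map_sub, sub_re]
      _ ≤ ‖ℓ‖ * ‖y - x‖ := (re_le_norm _).trans (ℓ.le_opNorm _)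
      _ ≤ R * ‖ℓ‖ := by rw [mul_comm]; gcongr
  rw [norm_mul, Complex.norm_exp]
  gcongr
  linarith

theorem integrable_smul_expFormSeries (hR : 0 < R) (hc : AEStronglyMeasurable c μ)
    (hL : AEStronglyMeasurable L μ)
    (hint : Integrable (fun a => ‖c a‖ * Real.exp ((L a x).re + R * ‖L a‖)) μ) (n : ℕ) :
    Integrable (fun a => (c a * exp (L a x)) • expFormSeries (L a) n) μ := by
  have hexp : AEStronglyMeasurable (fun a => exp (L a x)) μ :=
    Complex.continuous_exp.comp_aestronglyMeasurable (hL.apply_continuousLinearMap x)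
  refine (hint.div_const (R ^ n)).mono'
    ((hc.mul hexp).smul ((continuous_expFormSeries n).comp_aestronglyMeasurable hL))
    (Eventually.of_forall fun a => ?_)
  rw [le_div_iff₀ (by positivity)]
  exact norm_smul_expFormSeries_mul_pow_le (c a) (L a) x hR.le n

theorem integrable_mul_exp (hc : AEStronglyMeasurable c μ) (hL : AEStronglyMeasurable L μ)
    (hint : Integrable (fun a => ‖c a‖ * Real.exp ((L a x).re + R * ‖L a‖)) μ) {y : E}
    (hy : ‖y - x‖ ≤ R) : Integrable (fun a => c a * exp (L a y)) μ := by
  have hexp : AEStronglyMeasurable (fun a => exp (L a y)) μ :=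
    Complex.continuous_exp.comp_aestronglyMeasurable (hL.apply_continuousLinearMap y)
  exact hint.mono' (hc.mul hexp) (Eventually.of_forall fun a => norm_mul_exp_le _ _ hy)

theorem hasSum_integral_smul_expFormSeries (hR : 0 < R) (hc : AEStronglyMeasurable c μ)
    (hL : AEStronglyMeasurable L μ)
    (hint : Integrable (fun a => ‖c a‖ * Real.exp ((L a x).re + R * ‖L a‖)) μ)
    {y : E} (hy : ‖y‖ < R) :
    HasSum (fun n => ∫ a, ((c a * exp (L a x)) • expFormSeries (L a) n) (fun _ => y) ∂μ)
      (∫ a, c a * exp (L a (x + y)) ∂μ) := by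
  have hterm (n : ℕ) :
      Integrable (fun a => ((c a * exp (L a x)) • expFormSeries (L a) n) fun _ => y) μ :=
    (ContinuousMultilinearMap.apply 𝕜 (fun _ : Fin n => E) ℂ fun _ => y).integrable_comp
      (integrable_smul_expFormSeries hR hc hL hint n)
  have hsum : Summable fun n =>
      ∫ a, ‖((c a * exp (L a x)) • expFormSeries (L a) n) fun _ => y‖ ∂μ := by
    have hgeom : Summable fun n => (‖y‖ / R) ^ n :=
      summable_geometric_of_lt_one (by positivity) (by rwa [div_lt_one hR])
    refine Summable.of_nonneg_of_le (fun n => integral_nonneg fun a => norm_nonneg _) (fun n => ?_)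
      (hgeom.mul_right (∫ a, ‖c a‖ * Real.exp ((L a x).re + R * ‖L a‖) ∂μ))
    rw [← integral_const_mul]
    exact integral_mono (hterm n).norm (hint.const_mul _) fun a =>
      norm_smul_expFormSeries_apply_le (c a) (L a) x y hR n
  have htsum (a : X) : ∑' n, ((c a * exp (L a x)) • expFormSeries (L a) n) (fun _ => y) =
      c a * exp (L a (x + y)) := by
    rw [map_add, Complex.exp_add, ← mul_assoc]
    exact ((hasSum_expFormSeries (L a) y).const_smul (c a * exp (L a x))).tsum_eq
  simpa only [htsum] using hasSum_integral_of_summable_integral_norm hterm hsum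

variable [SMulCommClass 𝕜 ℝ ℂ]

theorem hasFPowerSeriesOnBall_integral_exp (hR : 0 < R) (hc : AEStronglyMeasurable c μ)
    (hL : AEStronglyMeasurable L μ)
    (hint : Integrable (fun a => ‖c a‖ * Real.exp ((L a x).re + R * ‖L a‖)) μ) :
    HasFPowerSeriesOnBall (fun y => ∫ a, c a * exp (L a y) ∂μ)
      (fun n => ∫ a, (c a * exp (L a x)) • expFormSeries (L a) n ∂μ) x (ENNReal.ofReal R) where
  r_le := by
    refine FormalMultilinearSeries.le_radius_of_bound _
      (∫ a, ‖c a‖ * Real.exp ((L a x).re + R * ‖L a‖) ∂μ) fun n => ?_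
    have hn := integrable_smul_expFormSeries hR hc hL hint n
    rw [Real.coe_toNNReal _ hR.le]
    calc ‖∫ a, (c a * exp (L a x)) • expFormSeries (L a) n ∂μ‖ * R ^ n
        ≤ (∫ a, ‖(c a * exp (L a x)) • expFormSeries (L a) n‖ ∂μ) * R ^ n := by
          gcongr
          exact norm_integral_le_integral_norm _
      _ = ∫ a, ‖(c a * exp (L a x)) • expFormSeries (L a) n‖ * R ^ n ∂μ :=
          (integral_mul_const _ _).symm
      _ ≤ _ := integral_mono (hn.norm.mul_const _) hint fun a =>
          norm_smul_expFormSeries_mul_pow_le (c a) (L a) x hR.le n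
  r_pos := ENNReal.ofReal_pos.2 hR
  hasSum := fun {y} hy => by
    have hyR : ‖y‖ < R := by
      rwa [mem_eball_zero_iff, ← ofReal_norm, ENNReal.ofReal_lt_ofReal_iff hR] at hy
    have happ (n : ℕ) : (∫ a, (c a * exp (L a x)) • expFormSeries (L a) n ∂μ) (fun _ => y) =
        ∫ a, ((c a * exp (L a x)) • expFormSeries (L a) n) (fun _ => y) ∂μ :=
      ContinuousMultilinearMap.integral_apply (integrable_smul_expFormSeries hR hc hL hint n) _
    simp only [happ]
    exact hasSum_integral_smul_expFormSeries hR hc hL hint hyR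

end ExpSuperposition

section ExpSeries

variable {𝕜 E ι : Type*} [RCLike 𝕜] [NormedAlgebra 𝕜 ℂ] [NormedAddCommGroup E] [NormedSpace 𝕜 E]
  {c : ι → ℂ} {L : ι → E →L[𝕜] ℂ} {x y : E} {R : ℝ}

theorem summable_norm_mul_exp
    (hint : Summable fun a => ‖c a‖ * Real.exp ((L a x).re + R * ‖L a‖)) (hy : ‖y - x‖ ≤ R) :
    Summable fun a => ‖c a * exp (L a y)‖ :=
  hint.of_nonneg_of_le (fun _ => norm_nonneg _) fun _ => norm_mul_exp_le _ _ hy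

variable [SMulCommClass 𝕜 ℝ ℂ] [Countable ι]

theorem hasFPowerSeriesOnBall_tsum_exp (hR : 0 < R)
    (hint : Summable fun a => ‖c a‖ * Real.exp ((L a x).re + R * ‖L a‖)) :
    HasFPowerSeriesOnBall (fun y => ∑' a, c a * exp (L a y))
      (fun n => ∑' a, (c a * exp (L a x)) • expFormSeries (L a) n) x (ENNReal.ofReal R) := by
  let _ : MeasurableSpace ι := ⊤
  have : MeasurableSingletonClass ι := ⟨fun _ => trivial⟩
  have hcount : Integrable (fun a => ‖c a‖ * Real.exp ((L a x).re + R * ‖L a‖)) Measure.count :=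
    integrable_count_iff.2 hint.norm
  have hc : AEStronglyMeasurable c Measure.count := by fun_prop
  have hL : AEStronglyMeasurable L Measure.count :=
    StronglyMeasurable.of_discrete.aestronglyMeasurable
  have h := hasFPowerSeriesOnBall_integral_exp hR hc hL hcount
  have hseries : (fun n => ∫ a, (c a * exp (L a x)) • expFormSeries (L a) n ∂Measure.count) =
      fun n => ∑' a, (c a * exp (L a x)) • expFormSeries (L a) n := by
    funext n
    simp [integral_countable (integrable_smul_expFormSeries hR hc hL hcount n)]
  rw [hseries] at h
  refine h.congr fun y hy => ?_
  have hy' : ‖y - x‖ ≤ R := by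
    rw [Metric.mem_eball, edist_eq_enorm_sub, ← ofReal_norm, ENNReal.ofReal_lt_ofReal_iff hR] at hy
    exact hy.le
  have hi : Integrable (fun a => c a * exp (L a y)) Measure.count :=
    integrable_count_iff.2 (summable_norm_mul_exp hint hy')
  simp [integral_countable hi]

theorem analyticAt_tsum_exp (hR : 0 < R)
    (hint : Summable fun a => ‖c a‖ * Real.exp ((L a x).re + R * ‖L a‖)) :
    AnalyticAt 𝕜 (fun y => ∑' a, c a * exp (L a y)) x :=
  (hasFPowerSeriesOnBall_tsum_exp hR hint).analyticAt

theorem hasFDerivAt_tsum_exp (hR : 0 < R)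
    (hint : Summable fun a => ‖c a‖ * Real.exp ((L a x).re + R * ‖L a‖)) :
    HasFDerivAt (𝕜 := 𝕜) (fun y => ∑' a, c a * exp (L a y))
      (∑' a, (c a * exp (L a x)) • L a) x := by
  refine (hasFPowerSeriesOnBall_tsum_exp hR hint).hasFPowerSeriesAt.hasFDerivAt.congr_fderiv ?_
  rw [← LinearIsometryEquiv.coe_toContinuousLinearEquiv, ContinuousLinearEquiv.map_tsum]
  refine tsum_congr fun a => ?_
  ext y
  simp [expFormSeries]

end ExpSeries

/-! ### Wirtinger derivatives in one variable -/

/-- The real-linear map `w ↦ a w + b w̄`. -/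
def wirtingerCLM (a b : ℂ) : ℂ →L[ℝ] ℂ :=
  a • (ContinuousLinearMap.id ℝ ℂ) + b • (conjCLE : ℂ →L[ℝ] ℂ)

@[simp] theorem wirtingerCLM_apply (a b w : ℂ) :
    wirtingerCLM a b w = a * w + b * (starRingEnd ℂ) w := by
  simp [wirtingerCLM]

theorem norm_wirtingerCLM_le (a b : ℂ) : ‖wirtingerCLM a b‖ ≤ ‖a‖ + ‖b‖ := by
  refine ContinuousLinearMap.opNorm_le_bound _ (by positivity) fun w => ?_
  rw [wirtingerCLM_apply, add_mul]
  refine (norm_add_le _ _).trans ?_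
  simp

/-- `f` is real differentiable at `τ` with `∂f/∂τ = a` and `∂f/∂τ̄ = b`. -/
def HasWirtinger (f : ℂ → ℂ) (a b τ : ℂ) : Prop := HasFDerivAt f (wirtingerCLM a b) τ

namespace HasWirtinger

variable {f g : ℂ → ℂ} {a b a' b' τ : ℂ}

theorem congr_coeff (h : HasWirtinger f a b τ) (ha : a = a') (hb : b = b') :
    HasWirtinger f a' b' τ := by subst ha hb; exact h

theorem hasFDerivAt (h : HasWirtinger f a b τ) : HasFDerivAt f (wirtingerCLM a b) τ := h

theorem of_hasDerivAt (h : HasDerivAt f a τ) : HasWirtinger f a 0 τ := by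
  refine (h.hasFDerivAt.restrictScalars ℝ).congr_fderiv ?_
  ext
  simp [mul_comm]

theorem hasDerivAt (h : HasWirtinger f a 0 τ) : HasDerivAt f a τ := by
  rw [hasDerivAt_iff_hasFDerivAt]
  refine hasFDerivAt_of_restrictScalars ℝ h ?_
  ext
  simp [mul_comm]

theorem add (hf : HasWirtinger f a b τ) (hg : HasWirtinger g a' b' τ) :
    HasWirtinger (fun x => f x + g x) (a + a') (b + b') τ := by
  refine (HasFDerivAt.add hf hg).congr_fderiv (ContinuousLinearMap.ext fun w => ?_)
  simp only [add_apply, wirtingerCLM_apply]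
  ring

theorem sub (hf : HasWirtinger f a b τ) (hg : HasWirtinger g a' b' τ) :
    HasWirtinger (fun x => f x - g x) (a - a') (b - b') τ := by
  refine (HasFDerivAt.sub hf hg).congr_fderiv (ContinuousLinearMap.ext fun w => ?_)
  simp only [sub_apply, wirtingerCLM_apply]
  ring

theorem mul (hf : HasWirtinger f a b τ) (hg : HasWirtinger g a' b' τ) :
    HasWirtinger (fun x => f x * g x) (a * g τ + f τ * a') (b * g τ + f τ * b') τ := by
  refine (HasFDerivAt.mul hf hg).congr_fderiv (ContinuousLinearMap.ext fun w => ?_)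
  simp only [add_apply, smul_apply, smul_eq_mul,
    wirtingerCLM_apply]
  ring

theorem const_mul (c : ℂ) (hf : HasWirtinger f a b τ) :
    HasWirtinger (fun x => c * f x) (c * a) (c * b) τ := by
  refine (HasFDerivAt.const_mul hf c).congr_fderiv (ContinuousLinearMap.ext fun w => ?_)
  simp only [smul_apply, smul_eq_mul, wirtingerCLM_apply]
  ring

theorem sum {ι : Type*} {s : Finset ι} {f : ι → ℂ → ℂ} {a b : ι → ℂ}
    (h : ∀ i ∈ s, HasWirtinger (f i) (a i) (b i) τ) :
    HasWirtinger (fun x => ∑ i ∈ s, f i x) (∑ i ∈ s, a i) (∑ i ∈ s, b i) τ := by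
  refine (HasFDerivAt.fun_sum h).congr_fderiv ?_
  ext
  simp [Finset.sum_add_distrib, Finset.sum_mul]

theorem conj (h : HasWirtinger f a b τ) :
    HasWirtinger (fun x => (starRingEnd ℂ) (f x)) ((starRingEnd ℂ) b) ((starRingEnd ℂ) a) τ := by
  refine ((conjCLE : ℂ →L[ℝ] ℂ).hasFDerivAt.comp τ h.hasFDerivAt).congr_fderiv
    (ContinuousLinearMap.ext fun w => ?_)
  simp only [ContinuousLinearMap.comp_apply, ContinuousLinearEquiv.coe_coe, conjCLE_apply,
    wirtingerCLM_apply, map_add, map_mul, conj_conj]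
  ring

theorem comp_hasDerivAt {φ : ℂ → ℂ} {φ' : ℂ} (h : HasWirtinger f a b (φ τ))
    (hφ : HasDerivAt φ φ' τ) :
    HasWirtinger (fun x => f (φ x)) (a * φ') (b * (starRingEnd ℂ) φ') τ := by
  refine (HasFDerivAt.comp τ h (hφ.hasFDerivAt.restrictScalars ℝ)).congr_fderiv
    (ContinuousLinearMap.ext fun w => ?_)
  simp only [ContinuousLinearMap.comp_apply, ContinuousLinearMap.coe_restrictScalars',
    ContinuousLinearMap.toSpanSingleton_apply, smul_eq_mul, wirtingerCLM_apply, map_mul]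
  ring

theorem comp_im {g : ℝ → ℂ} {g' : ℂ} (h : HasDerivAt g g' τ.im) :
    HasWirtinger (fun x => g x.im) (g' / (2 * I)) (-(g' / (2 * I))) τ := by
  refine (h.hasFDerivAt.comp τ (imCLM.hasFDerivAt (x := τ))).congr_fderiv
    (ContinuousLinearMap.ext fun w => ?_)
  simp only [ContinuousLinearMap.coe_comp, Function.comp_apply, imCLM_apply,
    ContinuousLinearMap.toSpanSingleton_apply, real_smul, wirtingerCLM_apply,
    im_eq_sub_conj w]
  ring

theorem hasDerivAt_axis {t : ℝ} (h : HasWirtinger f a b (t * I)) :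
    HasDerivAt (fun s : ℝ => f (s * I)) (I * (a - b)) t := by
  have haxis : HasDerivAt (fun s : ℝ => (s : ℂ) * I) I t := by
    simpa using (ofRealCLM.hasDerivAt (x := t)).mul_const I
  refine (HasFDerivAt.comp_hasDerivAt_of_eq t h.hasFDerivAt haxis rfl).congr_deriv ?_
  rw [wirtingerCLM_apply, conj_I]
  ring

theorem tsum {ι : Type*} {f : ι → ℂ → ℂ} {a b : ι → ℂ → ℂ} {u : ι → ℝ} {s : Set ℂ}
    (hu : Summable u) (hs : IsOpen s) (hs' : IsPreconnected s)
    (h : ∀ i, ∀ x ∈ s, HasWirtinger (f i) (a i x) (b i x) x)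
    (ha : ∀ i, ∀ x ∈ s, ‖a i x‖ ≤ u i) (hb : ∀ i, ∀ x ∈ s, ‖b i x‖ ≤ u i)
    (hτ : τ ∈ s) (hf : Summable fun i => f i τ) :
    HasWirtinger (fun x => ∑' i, f i x) (∑' i, a i τ) (∑' i, b i τ) τ := by
  have hbound (i : ι) (x : ℂ) (hx : x ∈ s) : ‖wirtingerCLM (a i x) (b i x)‖ ≤ u i + u i :=
    (norm_wirtingerCLM_le _ _).trans (add_le_add (ha i x hx) (hb i x hx))
  refine (hasFDerivAt_tsum_of_isPreconnected (hu.add hu) hs hs'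
    (fun i x hx => (h i x hx).hasFDerivAt) hbound hτ hf hτ).congr_fderiv ?_
  have hsum : Summable fun i => wirtingerCLM (a i τ) (b i τ) :=
    Summable.of_norm_bounded (hu.add hu) fun i => hbound i τ hτ
  have hsa : Summable fun i => a i τ := Summable.of_norm_bounded hu fun i => ha i τ hτ
  have hsb : Summable fun i => b i τ := Summable.of_norm_bounded hu fun i => hb i τ hτ
  refine ContinuousLinearMap.ext fun w => ?_
  have happ := (ContinuousLinearMap.apply ℝ ℂ w).map_tsum hsum
  rw [ContinuousLinearMap.apply_apply] at happ
  rw [happ, wirtingerCLM_apply, ← tsum_mul_right, ← tsum_mul_right,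
    ← (hsa.mul_right _).tsum_add (hsb.mul_right _)]
  simp only [ContinuousLinearMap.apply_apply, wirtingerCLM_apply]

end HasWirtinger

/-! ### Uniqueness from Cauchy data on the imaginary axis -/

theorem convex_upperHalfPlaneSet : Convex ℝ upperHalfPlaneSet := convex_halfSpace_im_gt 0

theorem ofReal_mul_I_mem_upperHalfPlaneSet {t : ℝ} (ht : 0 < t) :
    (t : ℂ) * I ∈ upperHalfPlaneSet := by
  simpa [upperHalfPlaneSet] using ht

theorem eq_zero_of_eq_zero_on_axis {f : ℂ → ℂ} (hf : DifferentiableOn ℂ f upperHalfPlaneSet)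
    (haxis : ∀ t : ℝ, 0 < t → f (t * I) = 0) {τ : ℂ} (hτ : τ ∈ upperHalfPlaneSet) : f τ = 0 := by
  have han := hf.analyticOnNhd isOpen_upperHalfPlaneSet
  have hI := ofReal_mul_I_mem_upperHalfPlaneSet one_pos
  refine han.eqOn_zero_of_preconnected_of_frequently_eq_zero
    convex_upperHalfPlaneSet.isPreconnected hI ?_ hτ
  have ht : Tendsto (fun t : ℝ => (t : ℂ) * I) (𝓝[≠] 1) (𝓝[≠] (((1 : ℝ) : ℂ) * I)) := by
    refine tendsto_nhdsWithin_of_tendsto_nhds_of_eventually_within _ ?_ ?_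
    · exact ((continuous_ofReal.mul continuous_const).tendsto 1).mono_left nhdsWithin_le_nhds
    · filter_upwards [self_mem_nhdsWithin] with t ht
      simpa using ht
  refine ht.frequently (Eventually.frequently ?_)
  filter_upwards [nhdsWithin_le_nhds (Ioi_mem_nhds zero_lt_one)] with t ht using haxis t ht

theorem eq_zero_of_cauchy_data {f a b g : ℂ → ℂ} {q : ℝ}
    (hf : ∀ τ ∈ upperHalfPlaneSet, HasWirtinger f (a τ) (b τ) τ)
    (hb : ∀ τ ∈ upperHalfPlaneSet, b τ = (τ.im ^ q : ℝ) * (starRingEnd ℂ) (g τ))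
    (hg : DifferentiableOn ℂ g upperHalfPlaneSet)
    (haxis : ∀ t : ℝ, 0 < t → f (t * I) = 0)
    (hnormal : ∀ t : ℝ, 0 < t → a (t * I) + b (t * I) = 0) {τ : ℂ} (hτ : τ ∈ upperHalfPlaneSet) :
    f τ = 0 := by
  have hg0 : ∀ τ ∈ upperHalfPlaneSet, g τ = 0 := fun τ hτ => by
    refine eq_zero_of_eq_zero_on_axis hg (fun t ht => ?_) hτ
    have hm := ofReal_mul_I_mem_upperHalfPlaneSet ht
    -- Along the axis `f` has derivative `I * (a - b)`, so both `a - b` and `a + b` vanish there.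
    have hconst : HasDerivAt (fun s : ℝ => f (s * I)) 0 t := by
      refine (hasDerivAt_const t (0 : ℂ)).congr_of_eventuallyEq ?_
      filter_upwards [Ioi_mem_nhds ht] with s hs using haxis s hs
    have hsub : a (t * I) - b (t * I) = 0 := by
      simpa using (hf _ hm).hasDerivAt_axis.unique hconst
    have hbt : b (t * I) = 0 := by linear_combination (hnormal t ht - hsub) / 2
    rw [hb _ hm] at hbt
    simpa [Real.rpow_eq_zero_iff_of_nonneg ht.le, ht.ne', ← ofReal_cpow ht.le] using hbt
  refine eq_zero_of_eq_zero_on_axis (fun x hx => ?_) haxis hτ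
  have hfx := hf x hx
  rw [hb x hx, hg0 x hx, map_zero, mul_zero] at hfx
  exact hfx.hasDerivAt.differentiableAt.differentiableWithinAt

/-! ### The incomplete gamma function -/

theorem integrableOn_exp_neg_mul_rpow {a w : ℝ} (ha : a ≤ 1) (hw : 0 < w) :
    IntegrableOn (fun t : ℝ => Real.exp (-t) * t ^ (a - 1)) (Set.Ioi w) := by
  refine ((integrableOn_exp_neg_Ioi w).mul_const (w ^ (a - 1))).mono' ?_ ?_
  · exact Measurable.aestronglyMeasurable (by fun_prop)
  · filter_upwards [ae_restrict_mem measurableSet_Ioi] with t ht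
    have ht0 : 0 < t := hw.trans ht
    rw [Real.norm_eq_abs, abs_of_nonneg (by positivity)]
    gcongr ?_ * ?_
    exact Real.rpow_le_rpow_of_nonpos hw (le_of_lt ht) (by linarith)

theorem incGamma_nonneg {a w : ℝ} (hw : 0 < w) : 0 ≤ incGamma a w :=
  setIntegral_nonneg measurableSet_Ioi fun t ht => by
    have : 0 < t := hw.trans ht
    positivity

theorem incGamma_le {a w : ℝ} (ha : a ≤ 1) (hw : 0 < w) :
    incGamma a w ≤ w ^ (a - 1) * Real.exp (-w) := by
  calc incGamma a w ≤ ∫ t in Set.Ioi w, Real.exp (-t) * w ^ (a - 1) := by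
        refine setIntegral_mono_on (integrableOn_exp_neg_mul_rpow ha hw)
          ((integrableOn_exp_neg_Ioi w).mul_const _) measurableSet_Ioi fun t ht => ?_
        gcongr ?_ * ?_
        exact Real.rpow_le_rpow_of_nonpos hw (le_of_lt ht) (by linarith)
    _ = _ := by rw [integral_mul_const, integral_exp_neg_Ioi, mul_comm]

theorem hasDerivAt_incGamma {a w : ℝ} (ha : a ≤ 1) (hw : 0 < w) :
    HasDerivAt (incGamma a) (-(Real.exp (-w) * w ^ (a - 1))) w := by
  have hc : 0 < w / 2 := by positivity
  have hii : IntegrableOn (fun t : ℝ => Real.exp (-t) * t ^ (a - 1)) (Set.Ioi (w / 2)) :=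
    integrableOn_exp_neg_mul_rpow ha hc
  have hcont : ContinuousAt (fun t : ℝ => Real.exp (-t) * t ^ (a - 1)) w :=
    (by fun_prop : ContinuousAt (fun t : ℝ => Real.exp (-t)) w).mul
      (Real.continuousAt_rpow_const _ _ (Or.inl hw.ne'))
  have hsub : HasDerivAt (fun y => incGamma a (w / 2) -
      ∫ t in (w / 2)..y, Real.exp (-t) * t ^ (a - 1)) (-(Real.exp (-w) * w ^ (a - 1))) w := by
    refine HasDerivAt.const_sub _ (intervalIntegral.integral_hasDerivAt_right ?_ ?_ hcont)
    · rw [intervalIntegrable_iff_integrableOn_Ioc_of_le (by linarith)]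
      exact hii.mono_set Set.Ioc_subset_Ioi_self
    · exact Measurable.stronglyMeasurable (by fun_prop) |>.stronglyMeasurableAtFilter
  refine hsub.congr_of_eventuallyEq ?_
  filter_upwards [Ioi_mem_nhds (show w / 2 < w by linarith)] with y hy
  rw [← intervalIntegral.integral_Ioi_sub_Ioi hii (le_of_lt hy)]
  simp [incGamma]

theorem incGamma_eq_rpow_mul_integral {a w : ℝ} (hw : 0 < w) :
    incGamma a w =
      w ^ a * ∫ s in Set.Ioi (0 : ℝ), Real.exp (-w * (1 + s)) * (1 + s) ^ (a - 1) := by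
  have htranslate : incGamma a w =
      ∫ x in Set.Ioi (0 : ℝ), Real.exp (-(w + x)) * (w + x) ^ (a - 1) := by
    have := (measurePreserving_add_left volume w).setIntegral_preimage_emb
      (measurableEmbedding_addLeft w) (fun t : ℝ => Real.exp (-t) * t ^ (a - 1)) (Set.Ioi w)
    simpa [incGamma] using this.symm
  have hscale := integral_comp_mul_left_Ioi
    (fun x : ℝ => Real.exp (-(w + x)) * (w + x) ^ (a - 1)) 0 hw
  rw [mul_zero, ← htranslate, smul_eq_mul, eq_inv_mul_iff_mul_eq₀ hw.ne'] at hscale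
  rw [← hscale, ← integral_const_mul, ← integral_const_mul]
  refine setIntegral_congr_fun measurableSet_Ioi fun s hs => ?_
  have hs0 : 0 < 1 + s := by linarith [Set.mem_Ioi.1 hs]
  have hpow : w ^ a = w * w ^ (a - 1) := by
    rw [Real.rpow_sub_one hw.ne', mul_div_cancel₀ _ hw.ne']
  have hadd : w + w * s = w * (1 + s) := by ring
  simp only [hadd, hpow, neg_mul]
  rw [Real.mul_rpow hw.le hs0.le]
  ring

/-! ### Subexponential coefficients -/

/-- Coefficients of subexponential growth, encoded by the convergence of all the series
`∑ ‖b(D)‖ e^{-δ|D|}`, `δ > 0`. -/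
def Subexp (b : ℤ → ℂ) : Prop :=
  ∀ δ : ℝ, 0 < δ → Summable fun D : ℤ => ‖b D‖ * Real.exp (-δ * |(D : ℝ)|)

theorem summable_exp_neg_abs_int {δ : ℝ} (hδ : 0 < δ) :
    Summable fun D : ℤ => Real.exp (-δ * |(D : ℝ)|) := by
  have hn : Summable fun n : ℕ => Real.exp (-δ * n) := by
    have := Real.summable_exp_nat_mul_iff.2 (show -δ < 0 by linarith)
    simpa [mul_comm] using this
  refine Summable.of_nat_of_neg ?_ ?_ <;> simpa using hn

theorem Subexp.of_bound {b : ℤ → ℂ} {A C : ℝ}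
    (h : ∀ D, ‖b D‖ ≤ A * Real.exp (C * √|(D : ℝ)|)) : Subexp b := by
  intro δ hδ
  refine Summable.of_nonneg_of_le (fun D => by positivity) (fun D => ?_)
    ((summable_exp_neg_abs_int (half_pos hδ)).mul_left (|A| * Real.exp (C ^ 2 / (2 * δ))))
  have hAMGM : C * √|(D : ℝ)| ≤ C ^ 2 / (2 * δ) + δ / 2 * |(D : ℝ)| := by
    have hsq := Real.sq_sqrt (abs_nonneg (D : ℝ))
    set x := √|(D : ℝ)|
    have hdiff : C ^ 2 / (2 * δ) + δ / 2 * x ^ 2 - C * x = (C - δ * x) ^ 2 / (2 * δ) := by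
      field_simp; ring
    have hnonneg : 0 ≤ (C - δ * x) ^ 2 / (2 * δ) := by positivity
    rw [← hsq]
    linarith
  calc ‖b D‖ * Real.exp (-δ * |(D : ℝ)|)
      ≤ |A| * Real.exp (C ^ 2 / (2 * δ) + δ / 2 * |(D : ℝ)|) * Real.exp (-δ * |(D : ℝ)|) := by
        gcongr
        refine (h D).trans ?_
        gcongr
        exact le_abs_self A
    _ = _ := by
        rw [mul_assoc, ← Real.exp_add, mul_assoc, ← Real.exp_add]
        congr 2; ring

theorem Subexp.of_norm_le {b b' : ℤ → ℂ} (hb : Subexp b) {K : ℝ}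
    (h : ∀ D, ‖b' D‖ ≤ K * ‖b D‖) : Subexp b' := fun δ hδ =>
  Summable.of_nonneg_of_le (fun D => by positivity)
    (fun D => (mul_le_mul_of_nonneg_right (h D) (Real.exp_pos _).le).trans_eq (mul_assoc _ _ _))
    ((hb δ hδ).mul_left K)

theorem Subexp.of_norm_le_mul_abs {b b' : ℤ → ℂ} (hb : Subexp b) {K : ℝ}
    (h : ∀ D, ‖b' D‖ ≤ K * |(D : ℝ)| * ‖b D‖) : Subexp b' := fun δ hδ => by
  refine Summable.of_nonneg_of_le (fun D => by positivity) (fun D => ?_)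
    ((hb (δ / 2) (half_pos hδ)).mul_left (|K| * (2 / δ)))
  have habs : |(D : ℝ)| ≤ 2 / δ * Real.exp (δ / 2 * |(D : ℝ)|) := by
    have := Real.add_one_le_exp (δ / 2 * |(D : ℝ)|)
    rw [div_mul_eq_mul_div, le_div_iff₀ hδ]
    nlinarith
  calc ‖b' D‖ * Real.exp (-δ * |(D : ℝ)|)
      ≤ |K| * |(D : ℝ)| * ‖b D‖ * Real.exp (-δ * |(D : ℝ)|) := by
        gcongr
        refine (h D).trans ?_
        gcongr
        exact le_abs_self K
    _ ≤ |K| * (2 / δ * Real.exp (δ / 2 * |(D : ℝ)|)) * ‖b D‖ * Real.exp (-δ * |(D : ℝ)|) := by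
        gcongr
    _ = |K| * (2 / δ) * (‖b D‖ * (Real.exp (δ / 2 * |(D : ℝ)|) * Real.exp (-δ * |(D : ℝ)|))) := by
        ring
    _ = _ := by rw [← Real.exp_add]; congr 3; ring

theorem Subexp.comp_neg {b : ℤ → ℂ} (hb : Subexp b) : Subexp fun D => b (-D) := fun δ hδ => by
  refine ((Equiv.neg ℤ).summable_iff.2 (hb δ hδ)).congr fun D => ?_
  simp

/-! ### The component series -/

/-- `e^{2πi D τ / 4m}`. -/
def qExp (m : ℕ) (D : ℤ) (τ : ℂ) : ℂ := exp (2 * Real.pi * I * (D / (4 * m)) * τ)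

/-- The holomorphic part `∑ b(D) e^{2πi D τ / 4m}` of a component of the theta decomposition. -/
def holSeries (m : ℕ) (b : ℤ → ℂ) (τ : ℂ) : ℂ := ∑' D : ℤ, b D * qExp m D τ

/-- The non-holomorphic part `∑ b(D) Γ(a, -Dπv/m) e^{2πi D τ / 4m}` of a component. It is only used
for `b` supported on `D < 0`, where the arguments of `Γ` are positive. -/
def nonSeries (a : ℝ) (m : ℕ) (b : ℤ → ℂ) (τ : ℂ) : ℂ :=
  ∑' D : ℤ, b D * (incGamma a (-(D : ℝ) * Real.pi * τ.im / m) : ℂ) * qExp m D τ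

/-- The coefficients of the derivative in `u = Re τ` of a series with coefficients `b`. -/
def derivCoeff (m : ℕ) (b : ℤ → ℂ) (D : ℤ) : ℂ := 2 * Real.pi * I * (D / (4 * m)) * b D

/-- The coefficients of the shadow of `nonSeries a m b`: the series with these coefficients is the
holomorphic function `g` with `∂/∂τ̄ (nonSeries a m b) = v^{a-1} ḡ`. -/
def shadowCoeff (a : ℝ) (m : ℕ) (b : ℤ → ℂ) (D : ℤ) : ℂ :=
  (starRingEnd ℂ) (b (-D)) * (I / 2) * ((Real.pi * D / m : ℝ) ^ a : ℝ)

theorem norm_qExp (m : ℕ) (D : ℤ) (τ : ℂ) :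
    ‖qExp m D τ‖ = Real.exp (-(Real.pi / (2 * m)) * D * τ.im) := by
  rw [qExp, Complex.norm_exp]
  congr 1
  have hlin : (2 * Real.pi * I * (D / (4 * m)) * τ : ℂ) =
      ((2 * Real.pi * (D / (4 * m)) : ℝ) : ℂ) * (I * τ) := by
    push_cast; ring
  rw [hlin, re_ofReal_mul, I_mul_re]
  ring

theorem hasDerivAt_qExp (m : ℕ) (D : ℤ) (τ : ℂ) :
    HasDerivAt (qExp m D) (2 * Real.pi * I * (D / (4 * m)) * qExp m D τ) τ := by
  refine ((hasDerivAt_id τ).const_mul (2 * Real.pi * I * (D / (4 * m)) : ℂ)).cexp.congr_deriv ?_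
  rw [mul_one, id_eq, mul_comm]
  rfl

theorem norm_derivCoeff_le (m : ℕ) (b : ℤ → ℂ) (D : ℤ) :
    ‖derivCoeff m b D‖ ≤ 2 * Real.pi / (4 * m) * |(D : ℝ)| * ‖b D‖ := by
  rw [derivCoeff]
  simp only [norm_mul, norm_div, Complex.norm_ofNat, Complex.norm_real, Complex.norm_I,
    Complex.norm_intCast, Complex.norm_natCast, Real.norm_eq_abs, abs_of_pos Real.pi_pos]
  exact le_of_eq (by ring)

theorem Subexp.derivCoeff {b : ℤ → ℂ} (hb : Subexp b) (m : ℕ) : Subexp (derivCoeff m b) :=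
  hb.of_norm_le_mul_abs (norm_derivCoeff_le m b)

section Hol

variable {m : ℕ} {b : ℤ → ℂ} {N : ℕ}

theorem norm_holSeries_term_le (hN : ∀ D < -(N : ℤ), b D = 0) {τ : ℂ} {δ M : ℝ}
    (hδ : 0 < δ) (hδτ : δ ≤ τ.im) (hτM : τ.im ≤ M) (D : ℤ) :
    ‖b D * qExp m D τ‖ ≤ Real.exp (Real.pi / (2 * m) * (M + δ) * N) *
      (‖b D‖ * Real.exp (-(Real.pi / (2 * m) * δ) * |(D : ℝ)|)) := by
  by_cases hD : D < -N
  · simp [hN D hD]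
  have hD' : -(N : ℝ) ≤ D := by exact_mod_cast not_lt.1 hD
  rw [norm_mul, norm_qExp, mul_left_comm, ← Real.exp_add]
  gcongr
  set α := Real.pi / (2 * m)
  have hα : 0 ≤ α := by positivity
  have hN0 : (0 : ℝ) ≤ N := by positivity
  have hexponent : -(D : ℝ) * τ.im ≤ (M + δ) * N - δ * |(D : ℝ)| := by
    rcases le_total 0 (D : ℝ) with h | h
    · rw [abs_of_nonneg h]
      nlinarith [mul_nonneg (show 0 ≤ M + δ by linarith) hN0]
    · rw [abs_of_nonpos h]
      nlinarith [mul_nonneg (show 0 ≤ -(D : ℝ) by linarith) (show 0 ≤ M - τ.im by linarith),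
        mul_nonneg (show 0 ≤ N + (D : ℝ) by linarith) (show 0 ≤ M + δ by linarith)]
  nlinarith [mul_le_mul_of_nonneg_left hexponent hα]

theorem summable_holSeries (hm : 0 < m) (hb : Subexp b) (hN : ∀ D < -(N : ℤ), b D = 0) {τ : ℂ}
    (hτ : τ ∈ upperHalfPlaneSet) : Summable fun D => ‖b D * qExp m D τ‖ := by
  have hv : 0 < τ.im := hτ
  have hα : 0 < Real.pi / (2 * m) * τ.im := by positivity
  exact Summable.of_nonneg_of_le (fun _ => norm_nonneg _)
    (norm_holSeries_term_le hN hv le_rfl le_rfl) ((hb _ hα).mul_left _)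

theorem isOpen_strip (δ M : ℝ) : IsOpen {x : ℂ | δ < x.im ∧ x.im < M} :=
  (isOpen_lt continuous_const continuous_im).inter (isOpen_lt continuous_im continuous_const)

theorem isPreconnected_strip (δ M : ℝ) : IsPreconnected {x : ℂ | δ < x.im ∧ x.im < M} :=
  ((convex_halfSpace_im_gt δ).inter (convex_halfSpace_im_lt M)).isPreconnected

theorem derivCoeff_eq_zero (hN : ∀ D < -(N : ℤ), b D = 0) (D : ℤ) (hD : D < -(N : ℤ)) :
    derivCoeff m b D = 0 := by simp [derivCoeff, hN D hD]

theorem hasDerivAt_holSeries (hm : 0 < m) (hb : Subexp b) (hN : ∀ D < -(N : ℤ), b D = 0) {τ : ℂ}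
    (hτ : τ ∈ upperHalfPlaneSet) :
    HasDerivAt (holSeries m b) (holSeries m (derivCoeff m b) τ) τ := by
  have hv : 0 < τ.im := hτ
  have hα : 0 < Real.pi / (2 * m) * (τ.im / 2) := by positivity
  have hmem : τ ∈ {x : ℂ | τ.im / 2 < x.im ∧ x.im < τ.im + 1} := ⟨by linarith, by linarith⟩
  exact hasDerivAt_tsum_of_isPreconnected (t := {x : ℂ | τ.im / 2 < x.im ∧ x.im < τ.im + 1})
    (g := fun D x => b D * qExp m D x) (g' := fun D x => derivCoeff m b D * qExp m D x)
    (((hb.derivCoeff m) _ hα).mul_left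
      (Real.exp (Real.pi / (2 * m) * (τ.im + 1 + τ.im / 2) * N)))
    (isOpen_strip _ _) (isPreconnected_strip _ _)
    (fun D x _ => ((hasDerivAt_qExp m D x).const_mul (b D)).congr_deriv (by
      simp only [derivCoeff]; ring))
    (fun D x hx => norm_holSeries_term_le (derivCoeff_eq_zero hN) (half_pos hv) hx.1.le hx.2.le D)
    hmem (summable_holSeries hm hb hN hτ).of_norm hmem

theorem differentiableOn_holSeries (hm : 0 < m) (hb : Subexp b)
    (hN : ∀ D < -(N : ℤ), b D = 0) : DifferentiableOn ℂ (holSeries m b) upperHalfPlaneSet :=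
  fun _ hτ => (hasDerivAt_holSeries hm hb hN hτ).differentiableAt.differentiableWithinAt

theorem analyticAt_holSeries (hm : 0 < m) (hb : Subexp b)
    (hN : ∀ D < -(N : ℤ), b D = 0) {τ : ℂ} (hτ : τ ∈ upperHalfPlaneSet) :
    AnalyticAt ℝ (holSeries m b) τ :=
  ((differentiableOn_holSeries hm hb hN).analyticOnNhd
    isOpen_upperHalfPlaneSet τ hτ).restrictScalars

end Hol

section NonSeries

variable {a : ℝ} {m : ℕ} {b : ℤ → ℂ}

theorem rpow_mul_exp_mul_norm_qExp_le (ha : a ≤ 1) (hm : 0 < m) {D : ℤ} (hD : D < 0) {τ : ℂ}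
    {δ : ℝ} (hδ : 0 < δ) (hδτ : δ ≤ τ.im) :
    (-(D : ℝ) * Real.pi * τ.im / m) ^ (a - 1) * Real.exp (-(-(D : ℝ) * Real.pi * τ.im / m)) *
      ‖qExp m D τ‖ ≤
      (Real.pi * δ / m) ^ (a - 1) * Real.exp (-(Real.pi / (2 * m) * δ) * |(D : ℝ)|) := by
  have hD1 : (D : ℝ) ≤ -1 := by exact_mod_cast (show D ≤ -1 by omega)
  have hv : 0 < τ.im := hδ.trans_le hδτ
  rw [mul_assoc, norm_qExp, ← Real.exp_add]
  gcongr ?_ * Real.exp ?_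
  · refine Real.rpow_le_rpow_of_nonpos (by positivity) ?_ (by linarith)
    gcongr
    all_goals nlinarith [Real.pi_pos]
  · rw [abs_of_neg (by linarith)]
    have hexponent : -(-(D : ℝ) * Real.pi * τ.im / m) + -(Real.pi / (2 * m)) * D * τ.im =
        Real.pi / (2 * m) * (D * τ.im) := by field_simp; ring
    rw [hexponent]
    have hmono : (D : ℝ) * τ.im ≤ D * δ := mul_le_mul_of_nonpos_left hδτ (by linarith)
    nlinarith [mul_le_mul_of_nonneg_left hmono (show 0 ≤ Real.pi / (2 * m) by positivity)]

theorem neg_mul_pi_mul_div_pos (hm : 0 < m) {D : ℤ} (hD : D < 0) {v : ℝ} (hv : 0 < v) :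
    0 < -(D : ℝ) * Real.pi * v / m := by
  have hD1 : 0 < -(D : ℝ) := by exact_mod_cast (show 0 < -D by omega)
  positivity

theorem norm_nonSeries_term_le (ha : a ≤ 1) (hm : 0 < m) (hN : ∀ D : ℤ, 0 ≤ D → b D = 0) {τ : ℂ}
    {δ : ℝ} (hδ : 0 < δ) (hδτ : δ ≤ τ.im) (D : ℤ) :
    ‖b D * (incGamma a (-(D : ℝ) * Real.pi * τ.im / m) : ℂ) * qExp m D τ‖ ≤
      (Real.pi * δ / m) ^ (a - 1) * (‖b D‖ * Real.exp (-(Real.pi / (2 * m) * δ) * |(D : ℝ)|)) := by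
  rcases le_or_gt 0 D with hD | hD
  · simp [hN D hD]
  have hw := neg_mul_pi_mul_div_pos hm hD (hδ.trans_le hδτ)
  rw [norm_mul, norm_mul, norm_real, Real.norm_eq_abs, abs_of_nonneg (incGamma_nonneg hw)]
  calc _ ≤ ‖b D‖ * ((-(D : ℝ) * Real.pi * τ.im / m) ^ (a - 1) *
        Real.exp (-(-(D : ℝ) * Real.pi * τ.im / m))) * ‖qExp m D τ‖ := by
        gcongr; exact incGamma_le ha hw
    _ = ‖b D‖ * ((-(D : ℝ) * Real.pi * τ.im / m) ^ (a - 1) *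
        Real.exp (-(-(D : ℝ) * Real.pi * τ.im / m)) * ‖qExp m D τ‖) := by ring
    _ ≤ ‖b D‖ * _ := mul_le_mul_of_nonneg_left
        (rpow_mul_exp_mul_norm_qExp_le ha hm hD hδ hδτ) (norm_nonneg _)
    _ = _ := by ring

theorem summable_nonSeries (ha : a ≤ 1) (hm : 0 < m) (hb : Subexp b)
    (hN : ∀ D : ℤ, 0 ≤ D → b D = 0) {τ : ℂ} (hτ : τ ∈ upperHalfPlaneSet) :
    Summable fun D => ‖b D * (incGamma a (-(D : ℝ) * Real.pi * τ.im / m) : ℂ) * qExp m D τ‖ := by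
  have hv : 0 < τ.im := hτ
  exact Summable.of_nonneg_of_le (fun _ => norm_nonneg _)
    (norm_nonSeries_term_le ha hm hN hv le_rfl) ((hb _ (by positivity)).mul_left _)

theorem exp_mul_qExp (hm : 0 < m) (D : ℤ) (τ : ℂ) :
    (Real.exp (-(-(D : ℝ) * Real.pi * τ.im / m)) : ℂ) * qExp m D τ =
      (starRingEnd ℂ) (qExp m (-D) τ) := by
  rw [qExp, qExp, ← exp_conj, ofReal_exp, ← exp_add]
  congr 1
  have hm' : (m : ℂ) ≠ 0 := by exact_mod_cast hm.ne'
  simp only [map_mul, map_div₀, conj_ofReal, conj_I, map_ofNat, map_natCast, map_intCast]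
  push_cast
  rw [im_eq_sub_conj τ]
  field_simp
  linear_combination 4 * D * (τ - starRingEnd ℂ τ) * I_sq

theorem norm_shadowCoeff_le (ha : a ≤ 1) (hN : ∀ D : ℤ, 0 ≤ D → b D = 0) (D : ℤ) :
    ‖shadowCoeff a m b D‖ ≤ (Real.pi / m) ^ a * |(D : ℝ)| * ‖b (-D)‖ := by
  rcases le_or_gt D 0 with hD | hD
  · simp [shadowCoeff, hN (-D) (by lia)]
  have hD1 : (1 : ℝ) ≤ D := by exact_mod_cast hD
  have hpow : (D : ℝ) ^ a ≤ D := Real.rpow_le_self_of_one_le hD1 ha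
  calc ‖shadowCoeff a m b D‖
      = 1 / 2 * ((Real.pi / m) ^ a * (D : ℝ) ^ a * ‖b (-D)‖) := by
        simp only [shadowCoeff, norm_mul, norm_div, RCLike.norm_conj, Complex.norm_I, norm_real,
          Complex.norm_ofNat, Real.norm_eq_abs]
        rw [abs_of_nonneg (by positivity), mul_div_right_comm,
          Real.mul_rpow (by positivity) (by positivity)]
        ring
    _ ≤ 1 * ((Real.pi / m) ^ a * |(D : ℝ)| * ‖b (-D)‖) := by
        gcongr
        · norm_num
        · exact hpow.trans (le_abs_self _)
    _ = _ := one_mul _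

theorem Subexp.shadowCoeff (ha : a ≤ 1) (hb : Subexp b) (hN : ∀ D : ℤ, 0 ≤ D → b D = 0) :
    Subexp (shadowCoeff a m b) :=
  hb.comp_neg.of_norm_le_mul_abs (norm_shadowCoeff_le ha hN)

theorem shadowCoeff_eq_zero (hN : ∀ D : ℤ, 0 ≤ D → b D = 0) (D : ℤ) (hD : D < -((0 : ℕ) : ℤ)) :
    shadowCoeff a m b D = 0 := by
  rw [Nat.cast_zero, neg_zero] at hD
  simp [shadowCoeff, hN (-D) (by lia)]

theorem hasDerivAt_incGamma_const_mul (ha : a ≤ 1) {c v : ℝ} (hc : 0 < c) (hv : 0 < v) :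
    HasDerivAt (fun v => incGamma a (c * v))
      (-(v ^ (a - 1) * c ^ a * Real.exp (-(c * v)))) v := by
  refine ((hasDerivAt_incGamma ha (mul_pos hc hv)).comp v
    ((hasDerivAt_id v).const_mul c)).congr_deriv ?_
  rw [Real.mul_rpow hc.le hv.le, Real.rpow_sub_one hc.ne']
  field_simp

/-- The `τ̄`-derivative of the term of index `D` of `nonSeries a m b`. -/
def nonSeriesBarTerm (a : ℝ) (m : ℕ) (b : ℤ → ℂ) (D : ℤ) (τ : ℂ) : ℂ :=
  (τ.im ^ (a - 1) : ℝ) * (starRingEnd ℂ) (shadowCoeff a m b (-D) * qExp m (-D) τ)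

theorem tsum_nonSeriesBarTerm (τ : ℂ) :
    ∑' D, nonSeriesBarTerm a m b D τ =
      (τ.im ^ (a - 1) : ℝ) * (starRingEnd ℂ) (holSeries m (shadowCoeff a m b) τ) := by
  rw [holSeries, conj_tsum, ← tsum_mul_left, ← (Equiv.neg ℤ).tsum_eq]
  exact tsum_congr fun D => by simp only [nonSeriesBarTerm, Equiv.neg_apply, neg_neg]

theorem hasWirtinger_nonSeries_term (ha : a ≤ 1) (hm : 0 < m) (hN : ∀ D : ℤ, 0 ≤ D → b D = 0)
    (D : ℤ) {τ : ℂ} (hτ : τ ∈ upperHalfPlaneSet) :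
    HasWirtinger
      (fun y => b D * (incGamma a (-(D : ℝ) * Real.pi * y.im / m) : ℂ) * qExp m D y)
      (derivCoeff m b D * (incGamma a (-(D : ℝ) * Real.pi * τ.im / m) : ℂ) * qExp m D τ -
        nonSeriesBarTerm a m b D τ) (nonSeriesBarTerm a m b D τ) τ := by
  rcases le_or_gt 0 D with hD | hD
  · have hzero : nonSeriesBarTerm a m b D τ = 0 := by simp [nonSeriesBarTerm, shadowCoeff, hN D hD]
    simpa [hzero, derivCoeff, hN D hD] using
      HasWirtinger.of_hasDerivAt (hasDerivAt_const τ (0 : ℂ))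
  have hD' : 0 < -(D : ℝ) := by exact_mod_cast (show 0 < -D by lia)
  have harg (v : ℝ) : -(D : ℝ) * Real.pi * v / m = Real.pi * -D / m * v := by ring
  have hbar : nonSeriesBarTerm a m b D τ = b D * (-(I / 2) * ((τ.im ^ (a - 1) : ℝ) *
      ((Real.pi * -(D : ℝ) / m) ^ a : ℝ) * Real.exp (-(Real.pi * -(D : ℝ) / m * τ.im)))) *
        qExp m D τ := by
    rw [nonSeriesBarTerm, map_mul, ← exp_mul_qExp hm, harg]
    simp only [shadowCoeff, neg_neg, map_mul, conj_conj, map_div₀, conj_I, map_ofNat, conj_ofReal,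
      Int.cast_neg]
    ring
  simp only [harg]
  have hgamma := HasWirtinger.comp_im (τ := τ)
    (hasDerivAt_incGamma_const_mul ha (show 0 < Real.pi * -(D : ℝ) / m by positivity)
      hτ).ofReal_comp
  have hI : (1 : ℂ) / (2 * I) = -(I / 2) := by field_simp; simp
  refine ((hgamma.const_mul (b D)).mul
    (HasWirtinger.of_hasDerivAt (hasDerivAt_qExp m D τ))).congr_coeff ?_ ?_
  · rw [hbar, derivCoeff, ← hI]
    push_cast
    ring
  · rw [hbar, ← hI]
    push_cast
    ring

theorem norm_nonSeriesBarTerm_le (ha : a ≤ 1) (hN : ∀ D : ℤ, 0 ≤ D → b D = 0) (D : ℤ)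
    {τ : ℂ} {δ : ℝ} (hδ : 0 < δ) (hτ : δ ≤ τ.im) :
    ‖nonSeriesBarTerm a m b D τ‖ ≤ δ ^ (a - 1) *
      (‖shadowCoeff a m b (-D)‖ * Real.exp (-(Real.pi / (2 * m) * δ) * |(D : ℝ)|)) := by
  have hv : 0 < τ.im := hδ.trans_le hτ
  have hq := norm_holSeries_term_le (m := m) (shadowCoeff_eq_zero (a := a) (m := m) hN) hδ hτ
    le_rfl (-D)
  rw [Nat.cast_zero, mul_zero, Real.exp_zero, one_mul, Int.cast_neg, abs_neg] at hq
  rw [nonSeriesBarTerm, norm_mul, RCLike.norm_conj, norm_real, Real.norm_eq_abs,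
    abs_of_nonneg (by positivity)]
  have hpow : τ.im ^ (a - 1) ≤ δ ^ (a - 1) := Real.rpow_le_rpow_of_nonpos hδ hτ (by linarith)
  gcongr

theorem hasWirtinger_nonSeries (ha : a ≤ 1) (hm : 0 < m) (hb : Subexp b)
    (hN : ∀ D : ℤ, 0 ≤ D → b D = 0) {τ : ℂ} (hτ : τ ∈ upperHalfPlaneSet) :
    HasWirtinger (nonSeries a m b)
      (nonSeries a m (derivCoeff m b) τ -
        (τ.im ^ (a - 1) : ℝ) * (starRingEnd ℂ) (holSeries m (shadowCoeff a m b) τ))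
      ((τ.im ^ (a - 1) : ℝ) * (starRingEnd ℂ) (holSeries m (shadowCoeff a m b) τ)) τ := by
  have hv : 0 < τ.im := hτ
  have hNd : ∀ D : ℤ, 0 ≤ D → derivCoeff m b D = 0 := fun D hD => by simp [derivCoeff, hN D hD]
  let δ := τ.im / 2
  have hδ : 0 < δ := half_pos hv
  have hα : 0 < Real.pi / (2 * m) * δ := by positivity
  let uA (D : ℤ) : ℝ := (Real.pi * δ / m) ^ (a - 1) *
    (‖derivCoeff m b D‖ * Real.exp (-(Real.pi / (2 * m) * δ) * |(D : ℝ)|))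
  let uB (D : ℤ) : ℝ := δ ^ (a - 1) *
    (‖shadowCoeff a m b (-D)‖ * Real.exp (-(Real.pi / (2 * m) * δ) * |(D : ℝ)|))
  have huA : Summable uA := ((hb.derivCoeff m) _ hα).mul_left _
  have huB : Summable uB := ((hb.shadowCoeff ha hN).comp_neg _ hα).mul_left _
  have hmem : τ ∈ {x : ℂ | δ < x.im} := half_lt_self hv
  have hA (D : ℤ) (x : ℂ) (hx : δ < x.im) := norm_nonSeries_term_le ha hm hNd hδ hx.le D
  have hB (D : ℤ) (x : ℂ) (hx : δ < x.im) :=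
    norm_nonSeriesBarTerm_le (m := m) (b := b) ha hN D hδ hx.le
  have hderiv := HasWirtinger.tsum (huA.add huB) (isOpen_lt continuous_const continuous_im)
    (convex_halfSpace_im_gt δ).isPreconnected
    (fun D x hx => hasWirtinger_nonSeries_term ha hm hN D (hδ.trans hx))
    (fun D x hx => (norm_sub_le _ _).trans (add_le_add (hA D x hx) (hB D x hx)))
    (fun D x hx => (hB D x hx).trans (le_add_of_nonneg_left (by positivity))) hmem
    (summable_nonSeries ha hm hb hN hτ).of_norm
  rw [Summable.tsum_sub (Summable.of_norm_bounded huA fun D => hA D τ hmem)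
    (Summable.of_norm_bounded huB fun D => hB D τ hmem), tsum_nonSeriesBarTerm] at hderiv
  exact hderiv

end NonSeries

section NonSeriesAnalytic

variable {a : ℝ} {m : ℕ} {b : ℤ → ℂ}

/-- The real linear form `τ ↦ Dπv/m (1 + s) + 2πi D τ / 4m` for `x = (D, s)`: the exponent in the
representation of `nonSeries` as an integral of exponentials. -/
def expForm (m : ℕ) (x : ℤ × ℝ) : ℂ →L[ℝ] ℂ :=
  (-(-(x.1 : ℝ) * Real.pi / m * (1 + x.2))) • (ofRealCLM.comp imCLM) +
    (2 * Real.pi * I * (x.1 / (4 * m)) : ℂ) • ContinuousLinearMap.id ℝ ℂ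

/-- The weight of `exp (expForm m x)` in the representation of `v^{-a} nonSeries a m b` as an
integral over `expMeasure`. -/
def expDensity (a : ℝ) (m : ℕ) (b : ℤ → ℂ) (x : ℤ × ℝ) : ℂ :=
  b x.1 * ((-(x.1 : ℝ) * Real.pi / m : ℝ) ^ a : ℝ) * ((1 + x.2) ^ (a - 1) : ℝ)

theorem exp_expForm (m : ℕ) (x : ℤ × ℝ) (τ : ℂ) :
    exp (expForm m x τ) =
      (Real.exp (-(-(x.1 : ℝ) * Real.pi * τ.im / m) * (1 + x.2)) : ℂ) * qExp m x.1 τ := by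
  rw [qExp, ofReal_exp, ← exp_add]
  congr 1
  simp only [expForm, neg_mul, ofRealCLM_apply, imCLM_apply, ContinuousLinearMap.comp_apply,
    ContinuousLinearMap.id_apply, add_apply, smul_apply, real_smul, smul_eq_mul]
  push_cast
  ring

theorem expForm_re (hm : 0 < m) (x : ℤ × ℝ) (τ : ℂ) :
    (expForm m x τ).re = (x.1 : ℝ) * Real.pi / m * τ.im * (1 / 2 + x.2) := by
  have hexp : Real.exp (expForm m x τ).re =
      Real.exp ((x.1 : ℝ) * Real.pi / m * τ.im * (1 / 2 + x.2)) := by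
    rw [← Complex.norm_exp, exp_expForm, norm_mul, norm_qExp, norm_real, Real.norm_eq_abs,
      Real.abs_exp, ← Real.exp_add]
    congr 1
    field_simp
    ring
  exact Real.exp_injective hexp

theorem norm_expForm_le (x : ℤ × ℝ) (hx : 0 ≤ x.2) :
    ‖expForm m x‖ ≤ |(x.1 : ℝ)| * Real.pi / m * (3 / 2 + x.2) := by
  have hre : ‖ofRealCLM.comp imCLM‖ ≤ 1 := by
    refine ContinuousLinearMap.opNorm_le_bound _ zero_le_one fun w => ?_
    simpa using abs_im_le_norm w
  calc ‖expForm m x‖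
      ≤ ‖-(-(x.1 : ℝ) * Real.pi / m * (1 + x.2))‖ * ‖ofRealCLM.comp imCLM‖ +
          ‖(2 * Real.pi * I * (x.1 / (4 * m)) : ℂ)‖ * ‖ContinuousLinearMap.id ℝ ℂ‖ := by
        rw [← norm_smul, ← norm_smul]
        exact norm_add_le _ _
    _ ≤ |(x.1 : ℝ)| * Real.pi / m * (1 + x.2) * 1 + |(x.1 : ℝ)| * Real.pi / m * (1 / 2) * 1 := by
        gcongr
        · rw [Real.norm_eq_abs, abs_neg, abs_mul, abs_div, abs_mul, abs_neg,
            abs_of_pos Real.pi_pos, Nat.abs_cast, abs_of_nonneg (by linarith : 0 ≤ 1 + x.2)]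
        · simp only [norm_mul, norm_div, Complex.norm_ofNat, Complex.norm_real, Complex.norm_I,
            Complex.norm_intCast, Complex.norm_natCast, Real.norm_eq_abs, abs_of_pos Real.pi_pos]
          exact le_of_eq (by ring)
        · exact ContinuousLinearMap.norm_id_le
    _ = |(x.1 : ℝ)| * Real.pi / m * (3 / 2 + x.2) := by ring

theorem measurable_expDensity : Measurable (expDensity a m b) := by
  have hdisc (f : ℤ → ℂ) : Measurable fun x : ℤ × ℝ => f x.1 :=
    (Measurable.of_discrete (f := f)).comp measurable_fst
  refine ((hdisc b).mul (hdisc fun D => ((-(D : ℝ) * Real.pi / m : ℝ) ^ a : ℝ))).mul ?_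
  fun_prop

theorem continuous_expForm : Continuous (expForm m) := by
  unfold expForm
  fun_prop

/-- The measure on pairs `(D, s)` for the integral representation of `nonSeries`: counting measure
times Lebesgue measure on `(0, ∞)`. -/
def expMeasure : Measure (ℤ × ℝ) := Measure.count.prod (volume.restrict (Set.Ioi 0))

theorem ae_expMeasure : ∀ᵐ x ∂expMeasure, 0 < x.2 :=
  Measure.quasiMeasurePreserving_snd.ae (ae_restrict_mem measurableSet_Ioi)

theorem norm_expDensity_le (ha : a ≤ 1) (x : ℤ × ℝ) (hx : 0 ≤ x.2) :
    ‖expDensity a m b x‖ ≤ ‖b x.1 * ((-(x.1 : ℝ) * Real.pi / m : ℝ) ^ a : ℝ)‖ := by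
  rw [expDensity, norm_mul _ (((1 + x.2) ^ (a - 1) : ℝ) : ℂ)]
  refine mul_le_of_le_one_right (norm_nonneg _) ?_
  rw [norm_real, Real.norm_eq_abs, abs_of_nonneg (by positivity)]
  exact Real.rpow_le_one_of_one_le_of_nonpos (by linarith) (by linarith)

theorem Subexp.mul_rpow (ha : a ≤ 1) (hb : Subexp b) (hN : ∀ D : ℤ, 0 ≤ D → b D = 0) :
    Subexp fun D => b D * ((-(D : ℝ) * Real.pi / m : ℝ) ^ a : ℝ) := by
  refine (hb.shadowCoeff (m := m) ha hN).comp_neg.of_norm_le (K := 2) fun D => le_of_eq ?_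
  simp only [JacobiConverse.shadowCoeff, norm_mul, norm_div, RCLike.norm_conj, Complex.norm_I,
    neg_neg, Complex.norm_ofNat, Int.cast_neg]
  rw [mul_comm (-(D : ℝ)) Real.pi]
  ring

theorem expForm_re_add_le (hm : 0 < m) {x : ℤ × ℝ} (hD : x.1 < 0) (hx : 0 ≤ x.2) {τ : ℂ}
    (hτ : 0 < τ.im) :
    (expForm m x τ).re + τ.im / 6 * ‖expForm m x‖ ≤
      Real.pi * τ.im / (4 * m) * (x.1 - x.2) := by
  have hD1 : (x.1 : ℝ) ≤ -1 := by exact_mod_cast (show x.1 ≤ -1 by lia)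
  calc (expForm m x τ).re + τ.im / 6 * ‖expForm m x‖
      ≤ (x.1 : ℝ) * Real.pi / m * τ.im * (1 / 2 + x.2) +
          τ.im / 6 * (|(x.1 : ℝ)| * Real.pi / m * (3 / 2 + x.2)) := by
        rw [expForm_re hm]
        gcongr
        exact norm_expForm_le x hx
    _ = Real.pi * τ.im / (4 * m) * (x.1 * (1 + 10 / 3 * x.2)) := by
        rw [abs_of_neg (by linarith)]
        field_simp
        ring
    _ ≤ _ := by
        gcongr
        nlinarith

theorem integrable_expDensity (ha : a ≤ 1) (hm : 0 < m) (hb : Subexp b)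
    (hN : ∀ D : ℤ, 0 ≤ D → b D = 0) {τ : ℂ} (hτ : τ ∈ upperHalfPlaneSet) :
    Integrable (fun x => ‖expDensity a m b x‖ *
      Real.exp ((expForm m x τ).re + τ.im / 6 * ‖expForm m x‖)) expMeasure := by
  have hv : 0 < τ.im := hτ
  let b' (D : ℤ) : ℂ := b D * ((-(D : ℝ) * Real.pi / m : ℝ) ^ a : ℝ)
  let δ := Real.pi * τ.im / (4 * m)
  have hδ : 0 < δ := by positivity
  have hsum : Integrable (fun D : ℤ => ‖b' D‖ * Real.exp (-δ * |(D : ℝ)|)) Measure.count :=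
    integrable_count_iff.2 (hb.mul_rpow ha hN δ hδ).norm
  have hexp : Integrable (fun s : ℝ => Real.exp (-δ * s)) (volume.restrict (Set.Ioi 0)) :=
    exp_neg_integrableOn_Ioi 0 hδ
  refine (hsum.mul_prod hexp).mono' ?_ ?_
  · have hcont : Continuous fun x => Real.exp ((expForm m x τ).re + τ.im / 6 * ‖expForm m x‖) := by
      have := continuous_expForm (m := m)
      fun_prop
    exact (measurable_expDensity.norm.mul hcont.measurable).aestronglyMeasurable
  · filter_upwards [ae_expMeasure] with x hx
    rcases le_or_gt 0 x.1 with hD | hD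
    · simp [expDensity, b', hN _ hD]
    have hexponent := expForm_re_add_le hm hD hx.le hv
    rw [Real.norm_eq_abs, abs_of_nonneg (by positivity), mul_assoc, ← Real.exp_add,
      abs_of_neg (by exact_mod_cast hD)]
    exact mul_le_mul (norm_expDensity_le ha x hx.le)
      (Real.exp_le_exp.2 (hexponent.trans_eq (by ring))) (Real.exp_pos _).le (norm_nonneg _)

theorem nonSeries_eq_integral (hm : 0 < m)
    (hN : ∀ D : ℤ, 0 ≤ D → b D = 0) {τ : ℂ} (hτ : τ ∈ upperHalfPlaneSet)
    (hint : Integrable (fun x => expDensity a m b x * exp (expForm m x τ)) expMeasure) :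
    nonSeries a m b τ = (τ.im ^ a : ℝ) *
      ∫ x, expDensity a m b x * exp (expForm m x τ) ∂expMeasure := by
  have hv : 0 < τ.im := hτ
  unfold expMeasure at hint ⊢
  rw [integral_prod _ hint, integral_countable hint.integral_prod_left, nonSeries, ← tsum_mul_left]
  refine tsum_congr fun D => ?_
  simp only [measureReal_def, Measure.count_singleton, ENNReal.toReal_one, one_smul]
  rcases le_or_gt 0 D with hD | hD
  · simp [expDensity, hN D hD]
  have hD1 : 0 < -(D : ℝ) := by exact_mod_cast (show 0 < -D by omega)
  rw [incGamma_eq_rpow_mul_integral (neg_mul_pi_mul_div_pos hm hD hv)]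
  have harg : -(D : ℝ) * Real.pi * τ.im / m = τ.im * (-(D : ℝ) * Real.pi / m) := by ring
  have hterm : ∀ s : ℝ, expDensity a m b (D, s) * exp (expForm m (D, s) τ) =
      b D * ((-(D : ℝ) * Real.pi / m : ℝ) ^ a : ℝ) * qExp m D τ *
        ((Real.exp (-(-(D : ℝ) * Real.pi * τ.im / m) * (1 + s)) * (1 + s) ^ (a - 1) : ℝ) : ℂ) := by
    intro s
    rw [exp_expForm, expDensity]
    push_cast
    ring
  simp_rw [hterm]
  rw [integral_const_mul, integral_complex_ofReal, harg, Real.mul_rpow hv.le (by positivity)]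
  push_cast
  ring

theorem analyticAt_im_rpow (a : ℝ) {τ : ℂ} (hτ : τ ∈ upperHalfPlaneSet) :
    AnalyticAt ℝ (fun y : ℂ => ((y.im ^ a : ℝ) : ℂ)) τ := by
  have hlog : AnalyticAt ℝ (fun y : ℂ => Real.log y.im) τ :=
    (analyticAt_log hτ).comp (imCLM.analyticAt τ)
  refine (ofRealCLM.analyticAt _).comp (((hlog.mul (analyticAt_const (v := a))).rexp).congr ?_)
  filter_upwards [isOpen_upperHalfPlaneSet.mem_nhds hτ] with y hy
  exact (Real.rpow_def_of_pos hy a).symm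

theorem analyticAt_nonSeries (ha : a ≤ 1) (hm : 0 < m) (hb : Subexp b)
    (hN : ∀ D : ℤ, 0 ≤ D → b D = 0) {τ : ℂ} (hτ : τ ∈ upperHalfPlaneSet) :
    AnalyticAt ℝ (nonSeries a m b) τ := by
  have hR : 0 < τ.im / 6 := div_pos hτ (by norm_num)
  have hdensity : AEStronglyMeasurable (expDensity a m b) expMeasure :=
    measurable_expDensity.aestronglyMeasurable
  have hform : AEStronglyMeasurable (expForm m) expMeasure :=
    continuous_expForm.aestronglyMeasurable
  have hint := integrable_expDensity ha hm hb hN hτ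
  refine ((analyticAt_im_rpow a hτ).mul
    (hasFPowerSeriesOnBall_integral_exp hR hdensity hform hint).analyticAt).congr ?_
  filter_upwards [isOpen_upperHalfPlaneSet.mem_nhds hτ, Metric.ball_mem_nhds τ hR] with y hy hyτ
  exact (nonSeries_eq_integral hm hN hy
    (integrable_mul_exp hdensity hform hint (mem_ball_iff_norm.1 hyτ).le)).symm

end NonSeriesAnalytic

/-! ### Bounded test functions -/

/-- `φ` restricted to the measurable set `s` is measurable and bounded. -/
structure BoundedMeasurableOn (φ : ℝ → ℂ) (s : Set ℝ) : Prop where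
  measurableSet : MeasurableSet s
  measurable : Measurable (s.indicator φ)
  bounded : ∃ M, ∀ x ∈ s, ‖φ x‖ ≤ M

namespace BoundedMeasurableOn

variable {φ g : ℝ → ℂ} {s t : Set ℝ}

theorem union (hs : BoundedMeasurableOn φ s) (ht : BoundedMeasurableOn φ t) :
    BoundedMeasurableOn φ (s ∪ t) := by
  classical
  obtain ⟨M, hM⟩ := hs.bounded
  obtain ⟨M', hM'⟩ := ht.bounded
  refine ⟨hs.measurableSet.union ht.measurableSet, ?_, max M M', ?_⟩
  · have hpiecewise : (s ∪ t).indicator φ = s.piecewise (s.indicator φ) (t.indicator φ) := by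
      ext x
      by_cases hxs : x ∈ s <;> by_cases hxt : x ∈ t <;> simp [hxs, hxt]
    exact hpiecewise ▸ hs.measurable.piecewise hs.measurableSet ht.measurable
  · rintro x (hx | hx)
    exacts [(hM x hx).trans (le_max_left _ _), (hM' x hx).trans (le_max_right _ _)]

theorem of_eqOn_Ioo (hg : Continuous g) {c d : ℝ} (hφg : ∀ x ∈ Set.Ioo c d, φ x = g x) :
    BoundedMeasurableOn φ (Set.Ioo c d) := by
  obtain ⟨M, hM⟩ := (isCompact_Icc (a := c) (b := d)).exists_bound_of_continuousOn hg.continuousOn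
  refine ⟨measurableSet_Ioo, ?_, M, fun x hx => hφg x hx ▸ hM x (Set.Ioo_subset_Icc_self hx)⟩
  rw [Set.indicator_congr hφg]
  exact hg.measurable.indicator measurableSet_Ioo

theorem singleton (φ : ℝ → ℂ) (y : ℝ) : BoundedMeasurableOn φ {y} := by
  refine ⟨measurableSet_singleton y, ?_, ‖φ y‖, by simp⟩
  have hconst : ({y} : Set ℝ).indicator φ = ({y} : Set ℝ).indicator fun _ => φ y :=
    Set.indicator_congr fun x hx => congrArg φ hx
  exact hconst ▸ measurable_const.indicator (measurableSet_singleton y)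

end BoundedMeasurableOn

theorem PiecewiseSmooth.exists_boundedMeasurableOn {φ : ℝ → ℂ} (hφ : PiecewiseSmooth φ) {y : ℝ}
    (hy : 0 < y) : ∃ t ∈ 𝓝 y, BoundedMeasurableOn φ t := by
  obtain ⟨ε, hε, g, h, hg, hh, hφg, hφh, -⟩ := hφ y hy
  have hunion : Set.Ioo (y - ε) y ∪ {y} ∪ Set.Ioo y (y + ε) = Set.Ioo (y - ε) (y + ε) := by
    rw [Set.Ioo_union_right (by linarith), Set.Ioc_union_Ioo_eq_Ioo (by linarith) (by linarith)]
  refine ⟨Set.Ioo (y - ε) (y + ε), Ioo_mem_nhds (by linarith) (by linarith), ?_⟩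
  rw [← hunion]
  exact ((BoundedMeasurableOn.of_eqOn_Ioo hg.continuous hφg).union (.singleton φ y)).union
    (.of_eqOn_Ioo hh.continuous hφh)

theorem PiecewiseSmooth.exists_boundedMeasurableOn_Icc {φ : ℝ → ℂ} (hφ : PiecewiseSmooth φ)
    {a : ℝ} (ha : 0 < a) (b : ℝ) : ∃ t, Set.Icc a b ⊆ t ∧ BoundedMeasurableOn φ t := by
  refine isCompact_Icc.induction_on (p := fun s => ∃ t, s ⊆ t ∧ BoundedMeasurableOn φ t)
    ⟨∅, subset_rfl, MeasurableSet.empty, by simp, 0, by simp⟩ ?_ ?_ ?_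
  · rintro s s' hss ⟨t, hst, ht⟩
    exact ⟨t, hss.trans hst, ht⟩
  · rintro s s' ⟨t, hst, ht⟩ ⟨t', hst', ht'⟩
    exact ⟨t ∪ t', Set.union_subset_union hst hst', ht.union ht'⟩
  · intro y hy
    obtain ⟨t, hty, ht⟩ := hφ.exists_boundedMeasurableOn (ha.trans_le hy.1)
    exact ⟨t, mem_nhdsWithin_of_mem_nhds hty, t, subset_rfl, ht⟩

/-- Bounded measurable functions with support in a compact subset of `(0, ∞)`: all that the
integral formulas for the `L`-series use of a test function. -/
structure BoundedTest (φ : ℝ → ℂ) : Prop where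
  measurable : Measurable φ
  bounded : ∃ M, ∀ x, ‖φ x‖ ≤ M
  support : ∃ a b : ℝ, 0 < a ∧ ∀ x, x ∉ Set.Icc a b → φ x = 0

theorem IsTestFunction.boundedTest {φ : ℝ → ℂ} (hφ : IsTestFunction φ) : BoundedTest φ := by
  obtain ⟨hsmooth, a, b, ha, hsupp⟩ := hφ
  obtain ⟨t, hst, -, hmeas, M, hM⟩ := hsmooth.exists_boundedMeasurableOn_Icc ha b
  have hindicator : t.indicator φ = φ :=
    Set.indicator_eq_self.2 (Function.support_subset_iff'.2 fun x hx =>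
      hsupp x fun hxs => hx (hst hxs))
  refine ⟨hindicator ▸ hmeas, ⟨max M 0, fun x => ?_⟩, a, b, ha, hsupp⟩
  by_cases hx : x ∈ Set.Icc a b
  · exact (hM x (hst hx)).trans (le_max_left _ _)
  · simp [hsupp x hx]

theorem continuousOn_ofReal_cpow (s : ℂ) :
    ContinuousOn (fun x : ℝ => (x : ℂ) ^ s) (Set.Ioi 0) := fun x hx =>
  (continuousAt_ofReal_cpow_const x s (Or.inr (ne_of_gt hx))).continuousWithinAt

theorem measurable_ofReal_cpow (s : ℂ) : Measurable fun x : ℝ => (x : ℂ) ^ s :=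
  measurable_ofReal.pow_const s

namespace BoundedTest

variable {φ : ℝ → ℂ}

theorem mul (hφ : BoundedTest φ) {g : ℝ → ℂ} (hgm : Measurable g)
    (hg : ContinuousOn g (Set.Ioi 0)) : BoundedTest fun x => φ x * g x := by
  obtain ⟨hm, ⟨M, hM⟩, a, b, ha, hs⟩ := hφ
  obtain ⟨K, hK⟩ := (isCompact_Icc (a := a) (b := b)).exists_bound_of_continuousOn
    (hg.mono fun x hx => ha.trans_le hx.1)
  refine ⟨hm.mul hgm, ⟨M * |K|, fun x => ?_⟩, a, b, ha, fun x hx => by simp [hs x hx]⟩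
  have hM0 : 0 ≤ M := (norm_nonneg _).trans (hM x)
  by_cases hx : x ∈ Set.Icc a b
  · rw [norm_mul]
    exact mul_le_mul (hM x) ((hK x hx).trans (le_abs_self K)) (norm_nonneg _) hM0
  · simp only [hs x hx, zero_mul, norm_zero]; positivity

theorem twist (hφ : BoundedTest φ) (s : ℂ) : BoundedTest (twist φ s) :=
  hφ.mul (measurable_ofReal_cpow _) (continuousOn_ofReal_cpow _)

theorem comp_inv (hφ : BoundedTest φ) : BoundedTest fun x => φ (1 / x) := by
  obtain ⟨hm, ⟨M, hM⟩, a, b, ha, hs⟩ := hφ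
  refine ⟨hm.comp (measurable_const.div measurable_id), ⟨M, fun x => hM _⟩, ?_⟩
  rcases lt_or_ge b a with hab | hab
  · exact ⟨a, b, ha, fun x _ => hs _ fun h => absurd (h.1.trans h.2) (not_le.2 hab)⟩
  refine ⟨1 / b, 1 / a, by have := ha.trans_le hab; positivity, fun x hx => hs _ fun h => hx ?_⟩
  have hx0 : 0 < x := one_div_pos.1 (ha.trans_le h.1)
  exact ⟨(one_div_le (ha.trans_le hab) hx0).2 h.2, (le_one_div hx0 ha).2 h.1⟩

theorem slashS (hφ : BoundedTest φ) (k : ℕ) : BoundedTest (slashS k φ) := by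
  have hmul := hφ.comp_inv.mul (measurable_ofReal_cpow ((k : ℂ) - 5 / 2))
    (continuousOn_ofReal_cpow _)
  exact (funext fun x => mul_comm _ _ : JacobiConverse.slashS k φ = _) ▸ hmul

theorem integrable (hφ : BoundedTest φ) : Integrable φ := by
  obtain ⟨hm, ⟨M, hM⟩, a, b, -, hs⟩ := hφ
  have hIcc : IntegrableOn φ (Set.Icc a b) :=
    Measure.integrableOn_of_bounded (M := M) (by simp) hm.aestronglyMeasurable
      (Eventually.of_forall hM)
  exact (integrableOn_iff_integrable_of_support_subset
    (Function.support_subset_iff'.2 hs)).1 hIcc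

theorem integrableOn_mul (hφ : BoundedTest φ) {g : ℝ → ℂ} (hg : ContinuousOn g (Set.Ioi 0)) :
    IntegrableOn (fun t => g t * φ t) (Set.Ioi 0) := by
  obtain ⟨M, hM⟩ := hφ.bounded
  obtain ⟨a, b, ha, hs⟩ := hφ.support
  have hss : Set.Icc a b ⊆ Set.Ioi (0 : ℝ) := fun x hx => ha.trans_le hx.1
  have hIcc : IntegrableOn (fun t => g t * φ t) (Set.Icc a b) :=
    Integrable.mul_bdd (c := M) ((hg.mono hss).integrableOn_compact isCompact_Icc)
      hφ.measurable.aestronglyMeasurable (Eventually.of_forall hM)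
  exact ((integrableOn_iff_integrable_of_support_subset (Function.support_subset_iff'.2
    fun x hx => by rw [hs x hx, mul_zero])).1 hIcc).integrableOn

theorem tsum_integral (hφ : BoundedTest φ) {f : ℤ → ℝ → ℂ}
    (hf : ∀ D, ContinuousOn (f D) (Set.Ioi 0))
    (hu : ∀ a b : ℝ, 0 < a → a ≤ b →
      ∃ u : ℤ → ℝ, Summable u ∧ ∀ D, ∀ t ∈ Set.Icc a b, ‖f D t‖ ≤ u D) :
    ∑' D, ∫ t in Set.Ioi (0 : ℝ), f D t * φ t = ∫ t in Set.Ioi (0 : ℝ), (∑' D, f D t) * φ t := by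
  obtain ⟨a, b, ha, hs⟩ := hφ.support
  rcases lt_or_ge b a with hab | hab
  · have hzero : φ = 0 := funext fun x => hs x fun h => absurd (h.1.trans h.2) (not_le.2 hab)
    simp [hzero]
  obtain ⟨u, hus, hu⟩ := hu a b ha hab
  have hsum := hasSum_integral_of_summable_integral_norm
    (μ := volume.restrict (Set.Ioi (0 : ℝ)))
    (F := fun D t => f D t * φ t)
    (fun D => hφ.integrableOn_mul (hf D)) ?_
  · rw [hsum.tsum_eq]
    refine integral_congr_ae (Eventually.of_forall fun t => ?_)
    simp only [tsum_mul_right]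
  · have hφn := hφ.integrable.norm.integrableOn (s := Set.Ioi (0 : ℝ))
    refine Summable.of_nonneg_of_le (fun D => integral_nonneg fun t => norm_nonneg _) (fun D => ?_)
      (hus.mul_right (∫ t in Set.Ioi (0 : ℝ), ‖φ t‖))
    rw [← integral_const_mul]
    refine integral_mono (hφ.integrableOn_mul (hf D)).norm (hφn.const_mul _) fun t => ?_
    simp only [norm_mul]
    by_cases ht : t ∈ Set.Icc a b
    · gcongr; exact hu D t ht
    · simp [hs t ht]

end BoundedTest

theorem integral_mul_slashS (k : ℕ) (H φ : ℝ → ℂ) :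
    ∫ t in Set.Ioi (0 : ℝ), H t * slashS k φ t =
      ∫ t in Set.Ioi (0 : ℝ), (t : ℂ) ^ ((1 / 2 : ℂ) - k) * H (1 / t) * φ t := by
  rw [← integral_comp_rpow_Ioi _ (show (-1 : ℝ) ≠ 0 by norm_num)]
  refine setIntegral_congr_fun measurableSet_Ioi fun t ht => ?_
  have ht0 : (0 : ℝ) < t := ht
  have htc : (t : ℂ) ≠ 0 := by exact_mod_cast ht0.ne'
  simp only [slashS, Real.rpow_neg_one, one_div, inv_inv, real_smul, abs_neg, abs_one, one_mul]
  have hjacobian : ((t ^ (-1 - 1 : ℝ) : ℝ) : ℂ) = (t : ℂ) ^ (-2 : ℂ) := by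
    rw [ofReal_cpow ht0.le]; norm_num
  have hinv : ((t⁻¹ : ℝ) : ℂ) ^ ((k : ℂ) - 5 / 2) = (t : ℂ) ^ (-((k : ℂ) - 5 / 2)) := by
    rw [cpow_neg, ofReal_inv, inv_cpow]
    rw [arg_ofReal_of_nonneg ht0.le]; exact Real.pi_pos.ne
  rw [hjacobian, hinv]
  have hsplit : (t : ℂ) ^ ((2 : ℂ)⁻¹ - k) =
      (t : ℂ) ^ (-2 : ℂ) * (t : ℂ) ^ (-((k : ℂ) - 5 / 2)) := by
    rw [← cpow_add _ _ htc]
    congr 1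
    ring
  rw [hsplit]
  ring

theorem integrable_mul_of_support_subset_Icc {f : ℝ → ℂ} (hf : Integrable f) {a b : ℝ}
    (hs : ∀ x, x ∉ Set.Icc a b → f x = 0) {g : ℝ → ℂ} (hg : Continuous g) :
    Integrable fun x => g x * f x := by
  obtain ⟨M, hM⟩ := (isCompact_Icc (a := a) (b := b)).exists_bound_of_continuousOn hg.continuousOn
  refine (integrableOn_iff_integrable_of_support_subset (Function.support_subset_iff'.2
    fun x hx => by rw [hs x hx, mul_zero])).1
    ((hf.integrableOn (s := Set.Icc a b)).bdd_mul (c := M) hg.aestronglyMeasurable ?_)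
  filter_upwards [ae_restrict_mem measurableSet_Icc] with x hx using hM x hx

theorem integral_polynomial_mul_eq_zero {f : ℝ → ℂ} (hf : Integrable f) {a b : ℝ}
    (hs : ∀ x, x ∉ Set.Icc a b → f x = 0) (hmom : ∀ n : ℕ, ∫ x, f x * (x : ℂ) ^ n = 0)
    (p : Polynomial ℝ) : ∫ x, ((p.eval x : ℝ) : ℂ) * f x = 0 := by
  have hint (p : Polynomial ℝ) : Integrable fun x => ((p.eval x : ℝ) : ℂ) * f x :=
    integrable_mul_of_support_subset_Icc hf hs (continuous_ofReal.comp p.continuous)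
  induction p using Polynomial.induction_on' with
  | add p q hp hq =>
    simp only [Polynomial.eval_add, ofReal_add, add_mul]
    rw [integral_add (hint p) (hint q), hp, hq, add_zero]
  | monomial n c =>
    calc ∫ x, (((Polynomial.monomial n c).eval x : ℝ) : ℂ) * f x
        = ∫ x, (c : ℂ) * (f x * (x : ℂ) ^ n) := by
          refine integral_congr_ae (Eventually.of_forall fun x => ?_)
          simp only [Polynomial.eval_monomial]
          push_cast
          ring
      _ = 0 := by rw [integral_const_mul, hmom, mul_zero]

theorem integral_continuous_mul_eq_zero {f : ℝ → ℂ} (hf : Integrable f) {a b : ℝ}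
    (hs : ∀ x, x ∉ Set.Icc a b → f x = 0) (hmom : ∀ n : ℕ, ∫ x, f x * (x : ℂ) ^ n = 0)
    {g : ℝ → ℝ} (hg : Continuous g) : ∫ x, (g x : ℂ) * f x = 0 := by
  have hint (g : ℝ → ℝ) (hg : Continuous g) : Integrable fun x => (g x : ℂ) * f x :=
    integrable_mul_of_support_subset_Icc hf hs (continuous_ofReal.comp hg)
  refine norm_le_zero_iff.1 (le_of_forall_pos_le_add fun ε hε => ?_)
  obtain ⟨p, hp⟩ := exists_polynomial_near_of_continuousOn a b g hg.continuousOn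
    (ε / ((∫ x, ‖f x‖) + 1)) (by positivity)
  calc ‖∫ x, (g x : ℂ) * f x‖
      = ‖∫ x, ((g x : ℂ) * f x - ((p.eval x : ℝ) : ℂ) * f x)‖ := by
        rw [integral_sub (hint g hg) (hint _ p.continuous),
          integral_polynomial_mul_eq_zero hf hs hmom, sub_zero]
    _ ≤ ∫ x, ε / ((∫ x, ‖f x‖) + 1) * ‖f x‖ := by
        refine norm_integral_le_of_norm_le (hf.norm.const_mul _) (Eventually.of_forall fun x => ?_)
        by_cases hx : x ∈ Set.Icc a b
        · rw [← sub_mul, norm_mul, ← ofReal_sub, norm_real, Real.norm_eq_abs, abs_sub_comm]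
          gcongr
          exact (hp x hx).le
        · simp [hs x hx]
    _ = ε / ((∫ x, ‖f x‖) + 1) * ∫ x, ‖f x‖ := integral_const_mul _ _
    _ ≤ 0 + ε := by
        rw [zero_add, div_mul_eq_mul_div, div_le_iff₀ (by positivity)]
        exact mul_le_mul_of_nonneg_left (by linarith) hε.le

theorem ae_eq_zero_of_moments {f : ℝ → ℂ} (hf : Integrable f) {a b : ℝ}
    (hs : ∀ x, x ∉ Set.Icc a b → f x = 0) (hmom : ∀ n : ℕ, ∫ x, f x * (x : ℂ) ^ n = 0) :
    f =ᵐ[volume] 0 :=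
  ae_eq_zero_of_integral_contDiff_smul_eq_zero hf.locallyIntegrable fun _ hg _ => by
    simpa only [real_smul] using integral_continuous_mul_eq_zero hf hs hmom hg.continuous

/-- The twists `φ_{n+1}`, `n ∈ ℕ`, turn orthogonality into the vanishing of all moments. -/
theorem ae_mul_eq_zero_of_integral_twist {φ H : ℝ → ℂ} (hφ : BoundedTest φ)
    (hH : ContinuousOn H (Set.Ioi 0))
    (horth : ∀ n : ℕ, ∫ t in Set.Ioi (0 : ℝ), H t * twist φ (n + 1) t = 0) :
    (fun t => H t * φ t) =ᵐ[volume.restrict (Set.Ioi 0)] 0 := by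
  obtain ⟨a, b, -, hs⟩ := hφ.support
  let f : ℝ → ℂ := (Set.Ioi 0).indicator fun t => H t * φ t
  have hf : Integrable f := (hφ.integrableOn_mul hH).integrable_indicator measurableSet_Ioi
  have hfs (x : ℝ) (hx : x ∉ Set.Icc a b) : f x = 0 := by
    simp only [f, Set.indicator_apply_eq_zero, hs x hx, mul_zero, implies_true]
  have hmom (n : ℕ) : ∫ x, f x * (x : ℂ) ^ n = 0 := by
    rw [← horth n, ← integral_indicator measurableSet_Ioi]
    refine integral_congr_ae (Eventually.of_forall fun x => ?_)
    by_cases hx : x ∈ Set.Ioi (0 : ℝ)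
    · simp only [f, Set.indicator_of_mem hx, twist, add_sub_cancel_right, cpow_natCast]
      ring
    · simp only [f, Set.indicator_of_notMem hx, zero_mul]
  filter_upwards [ae_restrict_of_ae (ae_eq_zero_of_moments hf hfs hmom),
    ae_restrict_mem measurableSet_Ioi] with x hfx hx
  simpa only [f, Set.indicator_of_mem hx] using hfx

theorem eq_zero_of_ae_eq_zero {F : ℝ → ℂ} {U : Set ℝ} (hU : IsOpen U) {y : ℝ}
    (hy : y ∈ closure U) (hF : ContinuousOn F U) (hFy : ContinuousAt F y)
    (hzero : F =ᵐ[volume.restrict U] 0) : F y = 0 := by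
  have hEqOn : Set.EqOn F 0 U := Measure.eqOn_open_of_ae_eq hzero hU hF continuousOn_const
  have : (𝓝[U] y).NeBot := mem_closure_iff_nhdsWithin_neBot.1 hy
  exact tendsto_nhds_unique (hFy.mono_left nhdsWithin_le_nhds)
    (tendsto_const_nhds.congr' (eventually_nhdsWithin_of_forall fun x hx => (hEqOn hx).symm))

theorem eq_zero_of_integral_twist {φ H : ℝ → ℂ} (hφ : IsTestFunction φ)
    (hH : ContinuousOn H (Set.Ioi 0))
    (horth : ∀ n : ℕ, ∫ t in Set.Ioi (0 : ℝ), H t * twist φ (n + 1) t = 0) {y : ℝ} (hy : 0 < y)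
    (hφy : φ y ≠ 0) : H y = 0 := by
  have hzero := ae_mul_eq_zero_of_integral_twist hφ.boundedTest hH horth
  have hvanish {G : ℝ → ℂ} (hG : ContDiff ℝ (⊤ : ℕ∞) G) (hGy : φ y = G y) {U : Set ℝ}
      (hUo : IsOpen U) (hUy : y ∈ closure U) (hU : U ⊆ Set.Ioi 0)
      (hφG : ∀ x ∈ U, φ x = G x) : H y = 0 := by
    refine (mul_eq_zero.1 (eq_zero_of_ae_eq_zero (F := fun x => H x * G x) hUo hUy
      ((hH.mono hU).mul hG.continuous.continuousOn)
      ((hH.continuousAt (Ioi_mem_nhds hy)).mul hG.continuous.continuousAt) ?_)).resolve_right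
      (hGy ▸ hφy)
    filter_upwards [ae_restrict_of_ae_restrict_of_subset hU hzero,
      ae_restrict_mem hUo.measurableSet] with x hx hxU
    rw [← hφG x hxU, hx]
  obtain ⟨ε, hε, g, h, hg, hh, hφg, hφh, hφg' | hφh'⟩ := hφ.1 y hy
  · have hlt : max (y - ε) 0 < y := max_lt (by linarith) hy
    exact hvanish hg hφg' isOpen_Ioo (closure_Ioo hlt.ne ▸ Set.right_mem_Icc.2 hlt.le)
      (fun x hx => (le_max_right _ _).trans_lt hx.1)
      fun x hx => hφg x ⟨(le_max_left _ _).trans_lt hx.1, hx.2⟩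
  · have hlt : y < y + ε := by linarith
    exact hvanish hh hφh' isOpen_Ioo (closure_Ioo hlt.ne ▸ Set.left_mem_Icc.2 hlt.le)
      (fun x hx => hy.trans hx.1) hφh

theorem functional_equation_of_integrals {ι : Type*} [Fintype ι] (k : ℕ) {Sc : Set (ℝ → ℂ)}
    (hSc : ∀ φ ∈ Sc, IsTestFunction φ) (hSc_twist : ∀ φ ∈ Sc, ∀ s : ℂ, twist φ s ∈ Sc)
    (hSc_ne : ∀ y : ℝ, 0 < y → ∃ φ ∈ Sc, φ y ≠ 0) {H : ι → ℝ → ℂ}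
    (hH : ∀ j, ContinuousOn (H j) (Set.Ioi 0)) (w : ι → ι → ℂ)
    (heq : ∀ φ ∈ Sc, ∀ j, ∫ t in Set.Ioi (0 : ℝ), H j t * φ t =
      ∑ l, w j l * ∫ t in Set.Ioi (0 : ℝ), H l t * slashS k φ t) (j : ι) {t : ℝ} (ht : 0 < t) :
    H j t = ∑ l, w j l * ((t : ℂ) ^ ((1 / 2 : ℂ) - k) * H l (1 / t)) := by
  have hcont (l : ι) : ContinuousOn (fun t : ℝ => (t : ℂ) ^ ((1 / 2 : ℂ) - k) * H l (1 / t))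
      (Set.Ioi 0) := by
    refine (continuousOn_ofReal_cpow _).mul ((hH l).comp ?_ ?_)
    · exact continuousOn_const.div continuousOn_id fun x hx => ne_of_gt hx
    · intro x hx
      exact one_div_pos.2 (show 0 < x from hx)
  obtain ⟨φ, hφ, hφt⟩ := hSc_ne t ht
  have hdiff := eq_zero_of_integral_twist (hSc φ hφ)
    (H := fun t => H j t - ∑ l, w j l * ((t : ℂ) ^ ((1 / 2 : ℂ) - k) * H l (1 / t)))
    ((hH j).sub (continuousOn_finsetSum _ fun l _ => continuousOn_const.mul (hcont l)))
    (fun n => ?_) ht hφt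
  · exact sub_eq_zero.1 hdiff
  · have hψ := hSc_twist φ hφ (n + 1)
    have hb := (hSc _ hψ).boundedTest
    simp only [sub_mul, Finset.sum_mul]
    rw [integral_sub (hb.integrableOn_mul (hH j)), integral_finsetSum, heq _ hψ j, sub_eq_zero]
    · refine Finset.sum_congr rfl fun l _ => ?_
      rw [integral_mul_slashS, ← integral_const_mul]
      simp only [mul_assoc]
    · intro l _
      simpa only [mul_assoc] using (hb.integrableOn_mul (hcont l)).const_mul (w j l)
    · refine integrable_finsetSum _ fun l _ => ?_
      simpa only [mul_assoc] using (hb.integrableOn_mul (hcont l)).const_mul (w j l)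

section Integrals

variable {m : ℕ} {b : ℤ → ℂ} {φ : ℝ → ℂ}

theorem qExp_axis (m : ℕ) (D : ℤ) (t : ℝ) :
    qExp m D (t * I) = exp (-(((Real.pi * D / (2 * m) : ℝ) : ℂ) * t)) := by
  rw [qExp]
  congr 1
  push_cast
  linear_combination (2 * Real.pi * (D / (4 * m)) * t : ℂ) * I_mul_I

theorem tsum_laplace {N : ℕ} (hm : 0 < m) (hb : Subexp b) (hN : ∀ D < -(N : ℤ), b D = 0)
    (hφ : BoundedTest φ) :
    ∑' D : ℤ, b D * laplace φ ((Real.pi * D / (2 * m) : ℝ) : ℂ) =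
      ∫ t in Set.Ioi (0 : ℝ), holSeries m b (t * I) * φ t := by
  rw [show (∫ t in Set.Ioi (0 : ℝ), holSeries m b (t * I) * φ t) = _ from
    (hφ.tsum_integral (f := fun D t => b D * qExp m D (t * I)) (fun D => ?_)
      fun α β hα _ => ?_).symm]
  · refine tsum_congr fun D => ?_
    rw [laplace, ← integral_const_mul]
    refine integral_congr_ae (Eventually.of_forall fun t => ?_)
    simp only [qExp_axis]
    ring
  · unfold qExp
    fun_prop
  · refine ⟨_, (hb (Real.pi / (2 * m) * α) (by positivity)).mul_left
      (Real.exp (Real.pi / (2 * m) * (β + α) * N)), fun D t ht => ?_⟩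
    exact norm_holSeries_term_le hN hα (by simpa using ht.1) (by simpa using ht.2) D

theorem nonholTerm_eq_integral_integral (k : ℕ) (hm : 0 < m) {D : ℤ} (hD : D < 0) (ψ : ℝ → ℂ)
    {β : ℝ} (hβ : β = -(D : ℝ) * Real.pi / m) :
    nonholTerm k m D ψ = ((β ^ (3 / 2 - k : ℝ) : ℝ) : ℂ) *
      ∫ s in Set.Ioi (0 : ℝ), ∫ t in Set.Ioi (0 : ℝ),
        ((Real.exp (-(β * (2 * s + 1) / 2 * t)) * (1 + s) ^ ((3 / 2 - k : ℝ) - 1) : ℝ) : ℂ) *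
          ψ t := by
  have hβ0 : 0 < β := by simpa only [mul_one, ← hβ] using neg_mul_pi_mul_div_pos hm hD one_pos
  have hprefactor :
      ((-(Real.pi * D / m) : ℝ) : ℂ) ^ ((3 / 2 : ℂ) - k) = ((β ^ (3 / 2 - k : ℝ) : ℝ) : ℂ) := by
    rw [show -(Real.pi * D / m) = β by rw [hβ]; ring, ofReal_cpow hβ0.le]
    push_cast
    rfl
  rw [nonholTerm, hprefactor]
  congr 1
  refine setIntegral_congr_fun measurableSet_Ioi fun s hs => ?_
  have hs0 : 0 < 1 + s := by linarith [Set.mem_Ioi.1 hs]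
  have hdenom : ((1 + s : ℝ) : ℂ) ^ ((k : ℂ) - 1 / 2) =
      (((1 + s) ^ ((3 / 2 - k : ℝ) - 1) : ℝ) : ℂ)⁻¹ := by
    rw [← ofReal_inv, ← Real.rpow_neg hs0.le, ofReal_cpow hs0.le]
    congr 1
    push_cast
    ring
  simp only [hdenom, laplace, div_inv_eq_mul]
  rw [← integral_mul_const]
  refine integral_congr_ae (Eventually.of_forall fun t => ?_)
  have hexp : exp (-(((-(Real.pi * D * (2 * s + 1) / (2 * m)) : ℝ) : ℂ) * t)) =
      ((Real.exp (-(β * (2 * s + 1) / 2 * t)) : ℝ) : ℂ) := by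
    rw [← ofReal_mul, ← ofReal_neg, ← ofReal_exp, hβ]
    congr 3
    field_simp
  simp only [hexp, ofReal_mul]
  ring

/-- The kernel is dominated by `e^{-βas}` for `t ≥ a`, and `ψ` vanishes for `t < a`. -/
theorem BoundedTest.integrable_exp_mul_rpow_mul {ψ : ℝ → ℂ} (hψ : BoundedTest ψ) {α β : ℝ}
    (hα : α ≤ 1) (hβ : 0 < β) :
    Integrable (Function.uncurry fun s t =>
        ((Real.exp (-(β * (2 * s + 1) / 2 * t)) * (1 + s) ^ (α - 1) : ℝ) : ℂ) * ψ t)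
      ((volume.restrict (Set.Ioi 0)).prod (volume.restrict (Set.Ioi 0))) := by
  obtain ⟨a, c, ha, hs⟩ := hψ.support
  have hdom : Integrable (fun x : ℝ × ℝ => Real.exp (-(β * a) * x.1) * ‖ψ x.2‖)
      ((volume.restrict (Set.Ioi 0)).prod (volume.restrict (Set.Ioi 0))) :=
    (exp_neg_integrableOn_Ioi 0 (mul_pos hβ ha)).mul_prod hψ.integrable.norm.integrableOn
  have hpos : ∀ᵐ x : ℝ × ℝ ∂((volume.restrict (Set.Ioi (0 : ℝ))).prod
      (volume.restrict (Set.Ioi (0 : ℝ)))), 0 < x.1 :=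
    Measure.quasiMeasurePreserving_fst.ae (ae_restrict_mem measurableSet_Ioi)
  refine hdom.mono' (Measurable.aestronglyMeasurable ?_) ?_
  · have hmeas := hψ.measurable
    fun_prop
  filter_upwards [hpos] with x hx
  simp only [Function.uncurry, norm_mul, norm_real, Real.norm_eq_abs]
  by_cases hxs : x.2 ∈ Set.Icc a c
  · have hrpow_nonneg : 0 ≤ (1 + x.1) ^ (α - 1) := Real.rpow_nonneg (by linarith) _
    have hrpow : (1 + x.1) ^ (α - 1) ≤ 1 :=
      Real.rpow_le_one_of_one_le_of_nonpos (by linarith) (by linarith)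
    have hax : a * x.1 ≤ x.2 * ((2 * x.1 + 1) / 2) :=
      mul_le_mul hxs.1 (by linarith) hx.le (ha.le.trans hxs.1)
    have hexp : -(β * (2 * x.1 + 1) / 2 * x.2) ≤ -(β * a) * x.1 := by
      linarith [mul_le_mul_of_nonneg_left hax hβ.le]
    rw [Real.abs_exp, abs_of_nonneg hrpow_nonneg]
    gcongr
    exact (mul_le_mul (Real.exp_le_exp.2 hexp) hrpow hrpow_nonneg (Real.exp_nonneg _)).trans_eq
      (mul_one _)
  · simp [hs _ hxs]

theorem mul_integral_exp_mul_rpow {α β t : ℝ} (hβ : 0 < β) (ht : 0 < t) :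
    β ^ α * t ^ α *
        ∫ s in Set.Ioi (0 : ℝ), Real.exp (-(β * (2 * s + 1) / 2 * t)) * (1 + s) ^ (α - 1) =
      incGamma α (β * t) * Real.exp (β * t / 2) := by
  rw [incGamma_eq_rpow_mul_integral (mul_pos hβ ht), Real.mul_rpow hβ.le ht.le,
    mul_assoc _ _ (Real.exp _), ← integral_mul_const]
  congr 1
  refine integral_congr_ae (Eventually.of_forall fun s => ?_)
  simp only
  rw [mul_right_comm, ← Real.exp_add]
  congr 2
  ring

theorem nonholTerm_eq (k : ℕ) (hm : 0 < m) (hk : 0 < k) {D : ℤ} (hD : D < 0)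
    (hφ : BoundedTest φ) :
    nonholTerm k m D (twist φ (5 / 2 - k)) = ∫ t in Set.Ioi (0 : ℝ),
      (incGamma (3 / 2 - k) (-(D : ℝ) * Real.pi * t / m) : ℂ) * qExp m D (t * I) * φ t := by
  obtain ⟨β, hβ⟩ : ∃ β, β = -(D : ℝ) * Real.pi / m := ⟨_, rfl⟩
  have hβ0 : 0 < β := by simpa only [mul_one, ← hβ] using neg_mul_pi_mul_div_pos hm hD one_pos
  have hα : (3 / 2 - k : ℝ) ≤ 1 := by linarith [Nat.one_le_cast (α := ℝ).2 hk]
  rw [nonholTerm_eq_integral_integral k hm hD _ hβ,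
    integral_integral_swap ((hφ.twist _).integrable_exp_mul_rpow_mul hα hβ0), ← integral_const_mul]
  refine setIntegral_congr_fun measurableSet_Ioi fun t ht => ?_
  have ht0 : (0 : ℝ) < t := ht
  have hq : qExp m D (t * I) = ((Real.exp (β * t / 2) : ℝ) : ℂ) := by
    rw [qExp_axis, ofReal_exp, hβ]
    congr 1
    push_cast
    field_simp
  have htwist : twist φ (5 / 2 - k) t = φ t * ((t ^ (3 / 2 - k : ℝ) : ℝ) : ℂ) := by
    rw [twist, ofReal_cpow ht0.le]
    congr 2
    push_cast
    ring
  have hkernel := congrArg ofReal (mul_integral_exp_mul_rpow (α := 3 / 2 - k) hβ0 ht0)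
  simp only [ofReal_mul] at hkernel
  rw [integral_mul_const, integral_complex_ofReal, htwist, hq,
    show -(D : ℝ) * Real.pi * t / m = β * t by rw [hβ]; ring, ← hkernel]
  ring

theorem tsum_nonholTerm (k : ℕ) (hm : 0 < m) (hk : 0 < k) (hb : Subexp b)
    (hN : ∀ D : ℤ, 0 ≤ D → b D = 0) (hφ : BoundedTest φ) :
    ∑' D : ℤ, b D * nonholTerm k m D (twist φ (5 / 2 - k)) =
      ∫ t in Set.Ioi (0 : ℝ), nonSeries (3 / 2 - k) m b (t * I) * φ t := by
  have ha : (3 / 2 - k : ℝ) ≤ 1 := by linarith [Nat.one_le_cast (α := ℝ).2 hk]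
  rw [show (∫ t in Set.Ioi (0 : ℝ), nonSeries (3 / 2 - k) m b (t * I) * φ t) = _ from
    (hφ.tsum_integral (f := fun D t => b D * (incGamma (3 / 2 - k)
      (-(D : ℝ) * Real.pi * ((t : ℂ) * I).im / m) : ℂ) * qExp m D (t * I)) (fun D => ?_)
      fun α β hα _ => ?_).symm]
  · refine tsum_congr fun D => ?_
    rcases le_or_gt 0 D with hD | hD
    · simp [hN D hD]
    rw [nonholTerm_eq k hm hk hD hφ, ← integral_const_mul]
    refine integral_congr_ae (Eventually.of_forall fun t => ?_)
    simp only [mul_im, ofReal_re, I_im, mul_one, ofReal_im, I_re, mul_zero, add_zero]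
    ring
  · rcases le_or_gt 0 D with hD | hD
    · simp only [hN D hD, zero_mul]; exact continuousOn_const
    simp only [mul_im, ofReal_re, I_im, mul_one, ofReal_im, I_re, mul_zero, add_zero]
    refine (continuousOn_const.mul fun t ht => ?_).mul (by unfold qExp; fun_prop)
    exact (continuous_ofReal.continuousAt.comp
      (ContinuousAt.comp (f := fun t : ℝ => -(D : ℝ) * Real.pi * t / m)
        (hasDerivAt_incGamma ha (neg_mul_pi_mul_div_pos hm hD ht)).continuousAt
        (by fun_prop))).continuousWithinAt
  · refine ⟨_, (hb (Real.pi / (2 * m) * α) (by positivity)).mul_left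
      ((Real.pi * α / m) ^ ((3 / 2 - k : ℝ) - 1)), fun D t ht => ?_⟩
    exact norm_nonSeries_term_le ha hm hN hα (by simpa using ht.1) D

end Integrals

/-! ### The coefficients of a component -/

open Classical in
/-- The coefficient `c(l, r)` with `4ml - r² = D` and `r ≡ s mod 2m`, and `0` if there is none. -/
def coeff (m : ℕ) (c : ℤ → ℤ → ℂ) (s : ZMod (2 * m)) (D : ℤ) : ℂ :=
  if h : ∃ a : ℤ × ℤ, disc m a.1 a.2 = D ∧ (a.2 : ZMod (2 * m)) = s then
    c h.choose.1 h.choose.2 else 0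

/-- The hypothesis of the theorem that `c(l, r)` depends only on `4ml - r²` and `r mod 2m`. -/
def DiscInvariant (m : ℕ) (c : ℤ → ℤ → ℂ) : Prop :=
  ∀ l r l' r' : ℤ, disc m l r = disc m l' r' → r ≡ r' [ZMOD (2 * m)] → c l r = c l' r'

section Coeff

variable {m : ℕ} {c : ℤ → ℤ → ℂ}

theorem coeff_disc (hc : DiscInvariant m c) (l r : ℤ) :
    coeff m c (r : ZMod (2 * m)) (disc m l r) = c l r := by
  have h : ∃ a : ℤ × ℤ, disc m a.1 a.2 = disc m l r ∧ (a.2 : ZMod (2 * m)) = (r : ZMod (2 * m)) :=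
    ⟨(l, r), rfl, rfl⟩
  rw [coeff, dif_pos h]
  exact hc _ _ _ _ h.choose_spec.1
    (mod_cast (ZMod.intCast_eq_intCast_iff _ _ _).1 h.choose_spec.2)

theorem exists_of_coeff_ne_zero {s : ZMod (2 * m)} {D : ℤ} (h : coeff m c s D ≠ 0) :
    ∃ l r : ℤ, disc m l r = D ∧ (r : ZMod (2 * m)) = s ∧ coeff m c s D = c l r := by
  by_cases h' : ∃ a : ℤ × ℤ, disc m a.1 a.2 = D ∧ (a.2 : ZMod (2 * m)) = s
  · exact ⟨_, _, h'.choose_spec.1, h'.choose_spec.2, by rw [coeff, dif_pos h']⟩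
  · exact absurd (by rw [coeff, dif_neg h']) h

theorem exists_disc_of_coeff_ne_zero {r D : ℤ} (h : coeff m c (r : ZMod (2 * m)) D ≠ 0) :
    ∃ l : ℤ, disc m l r = D := by
  obtain ⟨l, r', hdisc, hr, -⟩ := exists_of_coeff_ne_zero h
  obtain ⟨n, hn⟩ := (ZMod.intCast_eq_intCast_iff_dvd_sub _ _ _).1 hr
  push_cast at hn
  refine ⟨l + n * r' + m * n ^ 2, ?_⟩
  rw [← hdisc, show r = r' + 2 * m * n by linarith, disc, disc]
  ring

theorem disc_injective (hm : 0 < m) (r : ℤ) : Function.Injective fun l => disc m l r := by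
  intro l l' h
  have hm' : (4 * m : ℤ) ≠ 0 := by positivity
  exact mul_left_cancel₀ hm' (sub_left_injective h)

theorem tsum_disc (hm : 0 < m) (hc : DiscInvariant m c) (r : ℤ) (G : ℤ → ℂ) :
    ∑' l : ℤ, c l r * G (disc m l r) = ∑' D : ℤ, coeff m c (r : ZMod (2 * m)) D * G D := by
  rw [← (disc_injective hm r).tsum_eq (f := fun D => coeff m c (r : ZMod (2 * m)) D * G D)]
  · exact tsum_congr fun l => by rw [coeff_disc hc]
  · intro D hD
    exact exists_disc_of_coeff_ne_zero (left_ne_zero_of_mul hD)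

theorem tsum_disc_prod (hm : 0 < m) (hc : DiscInvariant m c) (G : ℤ → ℤ → ℂ) :
    ∑' a : ℤ × ℤ, c a.1 a.2 * G (disc m a.1 a.2) a.2 =
      ∑' x : ℤ × ℤ, coeff m c (x.2 : ZMod (2 * m)) x.1 * G x.1 x.2 := by
  have hinj : Function.Injective fun a : ℤ × ℤ => (disc m a.1 a.2, a.2) := by
    rintro ⟨l, r⟩ ⟨l', r'⟩ h
    simp only [Prod.mk.injEq] at h
    obtain ⟨hdisc, rfl⟩ := h
    rw [disc_injective hm r hdisc]
  rw [← hinj.tsum_eq (f := fun x : ℤ × ℤ => coeff m c (x.2 : ZMod (2 * m)) x.1 * G x.1 x.2)]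
  · exact tsum_congr fun a => by rw [coeff_disc hc]
  · rintro ⟨D, r⟩ hx
    obtain ⟨l, hl⟩ := exists_disc_of_coeff_ne_zero (left_ne_zero_of_mul hx)
    exact ⟨(l, r), by simp [hl]⟩

theorem subexp_coeff {A C N : ℝ}
    (h : ∀ l r : ℤ, N ≤ |(disc m l r : ℝ)| →
      ‖c l r‖ ≤ A * Real.exp (C * √|(disc m l r : ℝ)|)) (s : ZMod (2 * m)) :
    Subexp (coeff m c s) := by
  let S : Finset ℤ := Finset.Icc (-⌈N⌉) ⌈N⌉
  let K := ∑ D ∈ S, ‖coeff m c s D‖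
  have hK : 0 ≤ K := Finset.sum_nonneg fun _ _ => norm_nonneg _
  refine Subexp.of_bound (A := |A| + K) (C := |C|) fun D => ?_
  have hexp : 1 ≤ Real.exp (|C| * √|(D : ℝ)|) := Real.one_le_exp (by positivity)
  by_cases hzero : coeff m c s D = 0
  · rw [hzero, norm_zero]
    positivity
  rcases le_or_gt N |(D : ℝ)| with hN | hN
  · obtain ⟨l, r, rfl, -, hcoeff⟩ := exists_of_coeff_ne_zero hzero
    rw [hcoeff]
    calc ‖c l r‖ ≤ A * Real.exp (C * √|(disc m l r : ℝ)|) := h l r hN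
      _ ≤ (|A| + K) * Real.exp (|C| * √|(disc m l r : ℝ)|) := by
        gcongr
        · exact (le_abs_self A).trans (le_add_of_nonneg_right hK)
        · exact le_abs_self C
  · have hD := abs_le.1 (hN.le.trans (Int.le_ceil N))
    have hDS : D ∈ S := Finset.mem_Icc.2 ⟨mod_cast hD.1, mod_cast hD.2⟩
    calc ‖coeff m c s D‖ ≤ K :=
          Finset.single_le_sum (f := fun D => ‖coeff m c s D‖) (fun _ _ => norm_nonneg _) hDS
      _ ≤ |A| + K := le_add_of_nonneg_left (abs_nonneg A)
      _ ≤ (|A| + K) * Real.exp (|C| * √|(D : ℝ)|) := le_mul_of_one_le_right (by positivity) hexp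

end Coeff

/-- The Fourier expansion of a harmonic Maass form of weight `k - 1/2`: a holomorphic part with
coefficients `bp` and a non-holomorphic part with coefficients `bn`. -/
def maassSeries (k m : ℕ) (bp bn : ℤ → ℂ) (τ : ℂ) : ℂ :=
  holSeries m bp τ + nonSeries (3 / 2 - k) m bn τ

/-- The conditions on the coefficients under which `maassSeries` converges and its holomorphic part
has a pole of finite order at the cusp. -/
structure Admissible (bp bn : ℤ → ℂ) : Prop where
  hol : Subexp bp
  non : Subexp bn
  hol_support : ∃ N : ℕ, ∀ D < -(N : ℤ), bp D = 0
  non_support : ∀ D : ℤ, 0 ≤ D → bn D = 0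

theorem three_halves_sub_le_one {k : ℕ} (hk : 0 < k) : (3 / 2 - k : ℝ) ≤ 1 := by
  linarith [Nat.one_le_cast (α := ℝ).2 hk]

theorem continuousOn_axis {f : ℂ → ℂ} (hf : ∀ τ ∈ upperHalfPlaneSet, ContinuousAt f τ) :
    ContinuousOn (fun t : ℝ => f (t * I)) (Set.Ioi 0) := fun t ht =>
  (ContinuousAt.comp (f := fun t : ℝ => (t : ℂ) * I)
    (hf _ (by simpa [upperHalfPlaneSet] using ht)) (by fun_prop)).continuousWithinAt

namespace Admissible

variable {k m : ℕ} {bp bn : ℤ → ℂ}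

theorem derivCoeff (h : Admissible bp bn) (m : ℕ) :
    Admissible (derivCoeff m bp) (derivCoeff m bn) where
  hol := h.hol.derivCoeff m
  non := h.non.derivCoeff m
  hol_support := by
    obtain ⟨N, hN⟩ := h.hol_support
    exact ⟨N, fun D hD => derivCoeff_eq_zero hN D hD⟩
  non_support D hD := by simp [JacobiConverse.derivCoeff, h.non_support D hD]

theorem hasWirtinger (h : Admissible bp bn) (hk : 0 < k) (hm : 0 < m) {τ : ℂ}
    (hτ : τ ∈ upperHalfPlaneSet) :
    HasWirtinger (maassSeries k m bp bn)
      (maassSeries k m (JacobiConverse.derivCoeff m bp) (JacobiConverse.derivCoeff m bn) τ -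
        (τ.im ^ (1 / 2 - k : ℝ) : ℝ) *
          (starRingEnd ℂ) (holSeries m (shadowCoeff (3 / 2 - k) m bn) τ))
      ((τ.im ^ (1 / 2 - k : ℝ) : ℝ) *
        (starRingEnd ℂ) (holSeries m (shadowCoeff (3 / 2 - k) m bn) τ)) τ := by
  obtain ⟨N, hN⟩ := h.hol_support
  have hhol := HasWirtinger.of_hasDerivAt (hasDerivAt_holSeries hm h.hol hN hτ)
  have hnon := hasWirtinger_nonSeries (three_halves_sub_le_one hk) hm h.non h.non_support hτ
  rw [show (3 / 2 - k : ℝ) - 1 = 1 / 2 - k by ring] at hnon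
  exact (hhol.add hnon).congr_coeff (by rw [maassSeries, add_sub_assoc]) (zero_add _)

theorem differentiableOn_shadow (h : Admissible bp bn) (hk : 0 < k) (hm : 0 < m) :
    DifferentiableOn ℂ (holSeries m (shadowCoeff (3 / 2 - k) m bn)) upperHalfPlaneSet :=
  differentiableOn_holSeries hm
    (Subexp.shadowCoeff (three_halves_sub_le_one hk) h.non h.non_support)
    (shadowCoeff_eq_zero h.non_support)

theorem analyticAt (h : Admissible bp bn) (hk : 0 < k) (hm : 0 < m) {τ : ℂ}
    (hτ : τ ∈ upperHalfPlaneSet) :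
    AnalyticAt ℝ (maassSeries k m bp bn) τ := by
  obtain ⟨N, hN⟩ := h.hol_support
  exact (analyticAt_holSeries hm h.hol hN hτ).add
    (analyticAt_nonSeries (three_halves_sub_le_one hk) hm h.non h.non_support hτ)

theorem holSeries_continuousOn_axis (h : Admissible bp bn) (hm : 0 < m) :
    ContinuousOn (fun t : ℝ => holSeries m bp (t * I)) (Set.Ioi 0) := by
  obtain ⟨N, hN⟩ := h.hol_support
  exact continuousOn_axis fun _ hτ => (analyticAt_holSeries hm h.hol hN hτ).continuousAt

theorem nonSeries_continuousOn_axis (h : Admissible bp bn) (hk : 0 < k) (hm : 0 < m) :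
    ContinuousOn (fun t : ℝ => nonSeries (3 / 2 - k) m bn (t * I)) (Set.Ioi 0) :=
  continuousOn_axis fun _ hτ =>
    (analyticAt_nonSeries (three_halves_sub_le_one hk) hm h.non h.non_support hτ).continuousAt

theorem maassSeries_continuousOn_axis (h : Admissible bp bn) (hk : 0 < k) (hm : 0 < m) :
    ContinuousOn (fun t : ℝ => maassSeries k m bp bn (t * I)) (Set.Ioi 0) :=
  (h.holSeries_continuousOn_axis hm).add (h.nonSeries_continuousOn_axis hk hm)

theorem integral_maassSeries (h : Admissible bp bn) (hk : 0 < k) (hm : 0 < m) {φ : ℝ → ℂ}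
    (hφ : BoundedTest φ) :
    (∑' D : ℤ, bp D * laplace φ ((Real.pi * D / (2 * m) : ℝ) : ℂ)) +
      ∑' D : ℤ, bn D * nonholTerm k m D (JacobiConverse.twist φ (5 / 2 - k)) =
      ∫ t in Set.Ioi (0 : ℝ), maassSeries k m bp bn (t * I) * φ t := by
  obtain ⟨N, hN⟩ := h.hol_support
  rw [tsum_laplace hm h.hol hN hφ, tsum_nonholTerm k hm hk h.non h.non_support hφ,
    ← integral_add (hφ.integrableOn_mul (h.holSeries_continuousOn_axis hm))
      (hφ.integrableOn_mul (h.nonSeries_continuousOn_axis hk hm))]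
  simp only [maassSeries, add_mul]

end Admissible

/-- The coefficients `c(l, r)` restricted to `4ml - r² < 0`. -/
def negPart (m : ℕ) (c : ℤ → ℤ → ℂ) (l r : ℤ) : ℂ := if disc m l r < 0 then c l r else 0

/-- The function `(2k - 1)/4 h(it) + i t ∂h/∂u(it)` whose integrals against test functions are the
`L`-series attached to `α_k F`, for `h = maassSeries k m bp bn`. -/
def alphaAxis (k m : ℕ) (bp bn : ℤ → ℂ) (t : ℝ) : ℂ :=
  (2 * k - 1) / 4 * maassSeries k m bp bn (t * I) +
    t * I * maassSeries k m (derivCoeff m bp) (derivCoeff m bn) (t * I)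

theorem Admissible.alphaAxis_continuousOn {k m : ℕ} {bp bn : ℤ → ℂ} (h : Admissible bp bn)
    (hk : 0 < k) (hm : 0 < m) : ContinuousOn (alphaAxis k m bp bn) (Set.Ioi 0) :=
  (continuousOn_const.mul (h.maassSeries_continuousOn_axis hk hm)).add
    (ContinuousOn.mul (by fun_prop) ((h.derivCoeff m).maassSeries_continuousOn_axis hk hm))

theorem Admissible.integral_alphaAxis {k m : ℕ} {bp bn : ℤ → ℂ} (h : Admissible bp bn)
    (hk : 0 < k) (hm : 0 < m) {φ : ℝ → ℂ} (hφ : BoundedTest φ) :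
    ∫ t in Set.Ioi (0 : ℝ), alphaAxis k m bp bn t * φ t =
      (2 * k - 1) / 4 * (∫ t in Set.Ioi (0 : ℝ), maassSeries k m bp bn (t * I) * φ t) +
        I * ∫ t in Set.Ioi (0 : ℝ),
          maassSeries k m (JacobiConverse.derivCoeff m bp) (JacobiConverse.derivCoeff m bn)
            (t * I) * twist φ 2 t := by
  rw [← integral_const_mul, ← integral_const_mul, ← integral_add]
  · refine integral_congr_ae (Eventually.of_forall fun t => ?_)
    simp only [alphaAxis, twist, show (2 : ℂ) - 1 = 1 by norm_num, cpow_one]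
    ring
  · exact (hφ.integrableOn_mul (h.maassSeries_continuousOn_axis hk hm)).const_mul _
  · exact ((hφ.twist 2).integrableOn_mul
      ((h.derivCoeff m).maassSeries_continuousOn_axis hk hm)).const_mul _

theorem BoundedTest.twist_twist {φ : ℝ → ℂ} (hφ : BoundedTest φ) (s s' : ℂ) :
    JacobiConverse.twist (JacobiConverse.twist φ s) s' = JacobiConverse.twist φ (s + s' - 1) := by
  obtain ⟨a, b, ha, hs⟩ := hφ.support
  ext x
  rcases le_or_gt x 0 with hx | hx
  · have hφx : φ x = 0 := hs x fun h => absurd (ha.trans_le h.1) (not_lt.2 hx)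
    simp only [JacobiConverse.twist, hφx, zero_mul]
  · simp only [JacobiConverse.twist]
    rw [mul_assoc, ← cpow_add _ _ (ofReal_ne_zero.2 hx.ne')]
    ring_nf

theorem I_mul_tsum_derivCoeff_mul (m : ℕ) (b G : ℤ → ℂ) :
    I * ∑' D : ℤ, derivCoeff m b D * G D =
      -(2 * Real.pi * ∑' D : ℤ, b D * ((D / (4 * m) : ℂ) * G D)) := by
  rw [← tsum_mul_left, ← tsum_mul_left, ← tsum_neg]
  refine tsum_congr fun D => ?_
  rw [derivCoeff]
  linear_combination (2 * Real.pi * (D / (4 * m)) * b D * G D : ℂ) * I_mul_I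

theorem tsum_negPart_disc {m : ℕ} {c : ℤ → ℤ → ℂ} (hm : 0 < m)
    (hc : DiscInvariant m (negPart m c)) (r : ℤ) (G : ℤ → ℂ) :
    ∑' l : ℤ, (if disc m l r < 0 then c l r * G (disc m l r) else 0) =
      ∑' D : ℤ, coeff m (negPart m c) (r : ZMod (2 * m)) D * G D := by
  rw [← tsum_disc hm hc]
  simp only [negPart, ite_mul, zero_mul]

section LSeries

variable {k m : ℕ} {cp cm : ℤ → ℤ → ℂ} {φ : ℝ → ℂ}

theorem LSer_eq (hk : 0 < k) (hm : 0 < m) (hcp : DiscInvariant m cp)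
    (hcm : DiscInvariant m (negPart m cm)) (j : Fin (2 * m))
    (h : Admissible (coeff m cp (label j : ZMod (2 * m)))
      (coeff m (negPart m cm) (label j : ZMod (2 * m)))) (hφ : BoundedTest φ) :
    LSer k m cp cm φ j = ∫ t in Set.Ioi (0 : ℝ),
      maassSeries k m (coeff m cp (label j : ZMod (2 * m)))
        (coeff m (negPart m cm) (label j : ZMod (2 * m))) (t * I) * φ t := by
  rw [← h.integral_maassSeries hk hm hφ, LSer,
    tsum_disc hm hcp (label j) fun D => laplace φ ((Real.pi * D / (2 * m) : ℝ) : ℂ),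
    tsum_negPart_disc hm hcm (label j) fun D => nonholTerm k m D (twist φ (5 / 2 - k))]

theorem LSerAlpha_eq (hk : 0 < k) (hm : 0 < m) (hcp : DiscInvariant m cp)
    (hcm : DiscInvariant m (negPart m cm)) (j : Fin (2 * m))
    (h : Admissible (coeff m cp (label j : ZMod (2 * m)))
      (coeff m (negPart m cm) (label j : ZMod (2 * m)))) (hφ : BoundedTest φ) :
    LSerAlpha k m cp cm φ j = ∫ t in Set.Ioi (0 : ℝ),
      alphaAxis k m (coeff m cp (label j : ZMod (2 * m)))
        (coeff m (negPart m cm) (label j : ZMod (2 * m))) t * φ t := by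
  have hderiv := (h.derivCoeff m).integral_maassSeries hk hm (hφ.twist 2)
  rw [hφ.twist_twist, show (2 + (5 / 2 - k) - 1 : ℂ) = 7 / 2 - k by ring] at hderiv
  rw [h.integral_alphaAxis hk hm hφ, ← LSer_eq hk hm hcp hcm j h hφ, ← hderiv, mul_add,
    I_mul_tsum_derivCoeff_mul, I_mul_tsum_derivCoeff_mul, LSerAlpha, ← tsum_disc hm hcp (label j)
      fun D => (D / (4 * m) : ℂ) * laplace (twist φ 2) ((Real.pi * D / (2 * m) : ℝ) : ℂ),
    ← tsum_negPart_disc hm hcm (label j)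
      fun D => (D / (4 * m) : ℂ) * nonholTerm k m D (twist φ (7 / 2 - k))]
  simp only [mul_assoc]
  ring

end LSeries

/-! ### From the imaginary axis to the upper half plane -/

theorem neg_one_div_im (τ : ℂ) : (-1 / τ).im = τ.im / ‖τ‖ ^ 2 := by
  rw [neg_div, one_div, neg_im, inv_im, normSq_eq_norm_sq]
  ring

theorem ne_zero_of_mem_upperHalfPlaneSet {τ : ℂ} (hτ : τ ∈ upperHalfPlaneSet) : τ ≠ 0 := by
  rintro rfl
  exact lt_irrefl (0 : ℝ) hτ

theorem neg_one_div_mem_upperHalfPlaneSet {τ : ℂ} (hτ : τ ∈ upperHalfPlaneSet) :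
    -1 / τ ∈ upperHalfPlaneSet := by
  have hτ0 := ne_zero_of_mem_upperHalfPlaneSet hτ
  have hv : 0 < τ.im := hτ
  change 0 < (-1 / τ).im
  rw [neg_one_div_im]
  positivity

theorem neg_I_mul_mem_slitPlane {τ : ℂ} (hτ : τ ∈ upperHalfPlaneSet) : -I * τ ∈ slitPlane :=
  Or.inl (by simpa [upperHalfPlaneSet] using hτ)

theorem hasDerivAt_neg_one_div {τ : ℂ} (h : τ ≠ 0) :
    HasDerivAt (fun x : ℂ => -1 / x) (1 / τ ^ 2) τ := by
  simpa [div_eq_mul_inv] using (hasDerivAt_inv h).const_mul (-1)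

theorem hasDerivAt_neg_I_mul_cpow {τ : ℂ} (hτ : τ ∈ upperHalfPlaneSet) (q : ℂ) :
    HasDerivAt (fun x : ℂ => (-I * x) ^ q) (q * (-I * τ) ^ (q - 1) * -I) τ := by
  have hlin : HasDerivAt (fun x : ℂ => -I * x) (-I) τ := by
    simpa using (hasDerivAt_id τ).const_mul (-I)
  exact hlin.cpow_const (neg_I_mul_mem_slitPlane hτ)

theorem neg_I_mul_cpow_mul_im_rpow {τ : ℂ} (hτ : τ ∈ upperHalfPlaneSet) (q : ℝ) :
    (-I * τ) ^ (q : ℂ) * (((-1 / τ).im ^ q : ℝ) : ℂ) =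
      ((τ.im ^ q : ℝ) : ℂ) * (starRingEnd ℂ) ((-I * τ) ^ (-q : ℂ)) := by
  have hv : 0 < τ.im := hτ
  have hn : 0 < ‖τ‖ := norm_pos_iff.2 (ne_zero_of_mem_upperHalfPlaneSet hτ)
  set w := -I * τ with hw
  have hwn : ‖w‖ = ‖τ‖ := by simp [hw]
  have hwq : w ^ (q : ℂ) ≠ 0 := by
    simp [cpow_eq_zero_iff, norm_pos_iff.1 (hwn ▸ hn)]
  have hnormSq : w ^ (q : ℂ) * (starRingEnd ℂ) (w ^ (q : ℂ)) = (((‖τ‖ ^ q) ^ 2 : ℝ) : ℂ) := by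
    rw [mul_conj, normSq_eq_norm_sq, norm_cpow_real, hwn]
  have him : (-1 / τ).im ^ q = τ.im ^ q / (‖τ‖ ^ q) ^ 2 := by
    rw [neg_one_div_im, Real.div_rpow hv.le (by positivity), ← Real.rpow_natCast,
      ← Real.rpow_natCast, ← Real.rpow_mul hn.le, ← Real.rpow_mul hn.le, mul_comm q]
  have hwq' : (starRingEnd ℂ) (w ^ (q : ℂ)) ≠ 0 := by simpa using hwq
  rw [him, ofReal_div, cpow_neg, map_inv₀, ← hnormSq]
  field_simp

/-- `h` has Wirtinger derivatives `a = ∂h/∂τ` and `b = ∂h/∂τ̄` on the upper half plane and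
`v ^ (-q) b` is antiholomorphic there, i.e. `h` is harmonic of weight `-q`. -/
structure WeightedHarmonic (q : ℝ) (h a b : ℂ → ℂ) : Prop where
  hasWirtinger : ∀ τ ∈ upperHalfPlaneSet, HasWirtinger h (a τ) (b τ) τ
  exists_shadow : ∃ g : ℂ → ℂ, DifferentiableOn ℂ g upperHalfPlaneSet ∧
    ∀ τ ∈ upperHalfPlaneSet, b τ = (τ.im ^ q : ℝ) * (starRingEnd ℂ) (g τ)

namespace WeightedHarmonic

variable {q : ℝ} {h a b : ℂ → ℂ}

theorem const_mul (hh : WeightedHarmonic q h a b) (c : ℂ) :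
    WeightedHarmonic q (fun τ => c * h τ) (fun τ => c * a τ) fun τ => c * b τ where
  hasWirtinger τ hτ := (hh.hasWirtinger τ hτ).const_mul c
  exists_shadow := by
    obtain ⟨g, hg, hbg⟩ := hh.exists_shadow
    refine ⟨fun τ => (starRingEnd ℂ) c * g τ, hg.const_mul _, fun τ hτ => ?_⟩
    rw [hbg τ hτ, map_mul, conj_conj]
    ring

theorem sub {h' a' b' : ℂ → ℂ} (hh : WeightedHarmonic q h a b)
    (hh' : WeightedHarmonic q h' a' b') :
    WeightedHarmonic q (fun τ => h τ - h' τ) (fun τ => a τ - a' τ) fun τ => b τ - b' τ where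
  hasWirtinger τ hτ := (hh.hasWirtinger τ hτ).sub (hh'.hasWirtinger τ hτ)
  exists_shadow := by
    obtain ⟨g, hg, hbg⟩ := hh.exists_shadow
    obtain ⟨g', hg', hbg'⟩ := hh'.exists_shadow
    exact ⟨fun τ => g τ - g' τ, hg.sub hg', fun τ hτ => by
      rw [hbg τ hτ, hbg' τ hτ, map_sub, mul_sub]⟩

theorem sum {ι : Type*} {s : Finset ι} {h a b : ι → ℂ → ℂ}
    (hh : ∀ i ∈ s, WeightedHarmonic q (h i) (a i) (b i)) :
    WeightedHarmonic q (fun τ => ∑ i ∈ s, h i τ) (fun τ => ∑ i ∈ s, a i τ)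
      fun τ => ∑ i ∈ s, b i τ where
  hasWirtinger τ hτ := HasWirtinger.sum fun i hi => (hh i hi).hasWirtinger τ hτ
  exists_shadow := by
    choose! g hg hbg using fun i hi => (hh i hi).exists_shadow
    refine ⟨fun τ => ∑ i ∈ s, g i τ, DifferentiableOn.fun_sum hg, fun τ hτ => ?_⟩
    rw [map_sum, Finset.mul_sum]
    exact Finset.sum_congr rfl fun i hi => hbg i hi τ hτ

theorem eq_zero (hh : WeightedHarmonic q h a b) (haxis : ∀ t : ℝ, 0 < t → h (t * I) = 0)
    (hnormal : ∀ t : ℝ, 0 < t → a (t * I) + b (t * I) = 0) {τ : ℂ} (hτ : τ ∈ upperHalfPlaneSet) :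
    h τ = 0 := by
  obtain ⟨g, hg, hbg⟩ := hh.exists_shadow
  exact eq_zero_of_cauchy_data hh.hasWirtinger hbg hg haxis hnormal hτ

end WeightedHarmonic

/-- The action `h ↦ (-iτ) ^ q h(-1/τ)` of the inversion in weight `-q`. -/
def invSlash (q : ℂ) (h : ℂ → ℂ) (τ : ℂ) : ℂ := (-I * τ) ^ q * h (-1 / τ)

/-- The derivative `∂/∂τ` of `invSlash q h` in terms of `a = ∂h/∂τ`. -/
def invSlashDeriv (q : ℂ) (h a : ℂ → ℂ) (τ : ℂ) : ℂ :=
  q * (-I * τ) ^ (q - 1) * -I * h (-1 / τ) + (-I * τ) ^ q * (a (-1 / τ) * (1 / τ ^ 2))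

/-- The derivative `∂/∂τ̄` of `invSlash q h` in terms of `b = ∂h/∂τ̄`. -/
def invSlashConjDeriv (q : ℂ) (b : ℂ → ℂ) (τ : ℂ) : ℂ :=
  (-I * τ) ^ q * (b (-1 / τ) * (starRingEnd ℂ) (1 / τ ^ 2))

theorem WeightedHarmonic.invSlash {q : ℝ} {h a b : ℂ → ℂ} (hh : WeightedHarmonic q h a b) :
    WeightedHarmonic q (invSlash q h) (invSlashDeriv q h a) (invSlashConjDeriv q b) where
  hasWirtinger τ hτ :=
    ((HasWirtinger.of_hasDerivAt (hasDerivAt_neg_I_mul_cpow hτ q)).mul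
      ((hh.hasWirtinger _ (neg_one_div_mem_upperHalfPlaneSet hτ)).comp_hasDerivAt
        (hasDerivAt_neg_one_div (ne_zero_of_mem_upperHalfPlaneSet hτ)))).congr_coeff rfl
      (by rw [zero_mul, zero_add, invSlashConjDeriv])
  exists_shadow := by
    obtain ⟨g, hg, hbg⟩ := hh.exists_shadow
    refine ⟨fun τ => (-I * τ) ^ (-q : ℂ) * (1 / τ ^ 2) * g (-1 / τ), ?_, fun τ hτ => ?_⟩
    · refine (DifferentiableOn.mul (fun τ hτ =>
        (hasDerivAt_neg_I_mul_cpow hτ _).differentiableAt.differentiableWithinAt) ?_).mul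
        (hg.comp (fun τ hτ => (hasDerivAt_neg_one_div
          (ne_zero_of_mem_upperHalfPlaneSet hτ)).differentiableAt.differentiableWithinAt)
          fun τ hτ => neg_one_div_mem_upperHalfPlaneSet hτ)
      exact DifferentiableOn.div (differentiableOn_const _) (by fun_prop)
        fun τ hτ => pow_ne_zero _ (ne_zero_of_mem_upperHalfPlaneSet hτ)
    · rw [invSlashConjDeriv, hbg _ (neg_one_div_mem_upperHalfPlaneSet hτ), map_mul, map_mul]
      linear_combination ((starRingEnd ℂ) (g (-1 / τ)) * (starRingEnd ℂ) (1 / τ ^ 2)) *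
        neg_I_mul_cpow_mul_im_rpow hτ q

theorem neg_I_mul_ofReal_mul_I (t : ℝ) : -I * ((t : ℂ) * I) = t := by
  linear_combination (-(t : ℂ)) * I_mul_I

theorem neg_one_div_ofReal_mul_I (t : ℝ) : -1 / ((t : ℂ) * I) = ((1 / t : ℝ) : ℂ) * I := by
  rw [neg_div, one_div, mul_inv, inv_I, ofReal_div, ofReal_one, one_div]
  ring

theorem invSlash_ofReal_mul_I (q : ℂ) (h : ℂ → ℂ) (t : ℝ) :
    invSlash q h (t * I) = (t : ℂ) ^ q * h ((1 / t : ℝ) * I) := by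
  rw [invSlash, neg_I_mul_ofReal_mul_I, neg_one_div_ofReal_mul_I]

-- `-q/2 h + it ∂h/∂u` is the combination of Cauchy data for which the inversion acts without
-- mixing in `h` itself.
theorem invSlash_alpha_ofReal_mul_I (q : ℂ) (h a b : ℂ → ℂ) {t : ℝ} (ht : 0 < t) :
    -q / 2 * invSlash q h (t * I) + t * I * (invSlashDeriv q h a (t * I) +
        invSlashConjDeriv q b (t * I)) =
      -((t : ℂ) ^ q * (-q / 2 * h ((1 / t : ℝ) * I) +
        (1 / t : ℝ) * I * (a ((1 / t : ℝ) * I) + b ((1 / t : ℝ) * I)))) := by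
  have ht0 : (t : ℂ) ≠ 0 := ofReal_ne_zero.2 ht.ne'
  have hsq : (1 : ℂ) / ((t : ℂ) * I) ^ 2 = ((-(1 / t ^ 2) : ℝ) : ℂ) := by
    push_cast
    rw [mul_pow, I_sq]
    field_simp
  rw [invSlashDeriv, invSlashConjDeriv, invSlash_ofReal_mul_I, neg_I_mul_ofReal_mul_I,
    neg_one_div_ofReal_mul_I, hsq, conj_ofReal, cpow_sub _ _ ht0, cpow_one]
  push_cast
  field_simp
  ring_nf
  simp only [I_sq]
  ring

theorem eq_sum_invSlash_of_axis {ι : Type*} [Fintype ι] {q : ℝ} {h a b : ι → ℂ → ℂ}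
    (hh : ∀ s, WeightedHarmonic q (h s) (a s) (b s)) (w : ι → ι → ℂ)
    (hval : ∀ s, ∀ t : ℝ, 0 < t →
      h s (t * I) = ∑ r, w s r * ((t : ℂ) ^ (q : ℂ) * h r ((1 / t : ℝ) * I)))
    (hder : ∀ s, ∀ t : ℝ, 0 < t →
      -q / 2 * h s (t * I) + t * I * (a s (t * I) + b s (t * I)) =
        -∑ r, w s r * ((t : ℂ) ^ (q : ℂ) * (-q / 2 * h r ((1 / t : ℝ) * I) +
          (1 / t : ℝ) * I * (a r ((1 / t : ℝ) * I) + b r ((1 / t : ℝ) * I)))))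
    (s : ι) {τ : ℂ} (hτ : τ ∈ upperHalfPlaneSet) :
    h s τ = ∑ r, w s r * invSlash q (h r) τ := by
  have hdiff := (hh s).sub
    (WeightedHarmonic.sum (s := Finset.univ) fun r _ => (hh r).invSlash.const_mul (w s r))
  have hzero : ∀ t : ℝ, 0 < t →
      h s (t * I) - ∑ r, w s r * invSlash q (h r) (t * I) = 0 := fun t ht => by
    simp only [invSlash_ofReal_mul_I]
    exact sub_eq_zero.2 (hval s t ht)
  refine sub_eq_zero.1 (hdiff.eq_zero hzero (fun t ht => ?_) hτ)
  have hα : -q / 2 * h s (t * I) + t * I * (a s (t * I) + b s (t * I)) =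
      ∑ r, w s r * (-q / 2 * invSlash q (h r) (t * I) + t * I *
        (invSlashDeriv q (h r) (a r) (t * I) + invSlashConjDeriv q (b r) (t * I))) := by
    rw [hder s t ht, ← Finset.sum_neg_distrib]
    exact Finset.sum_congr rfl fun r _ => by rw [invSlash_alpha_ofReal_mul_I _ _ _ _ ht, mul_neg]
  simp only [mul_add, mul_left_comm (w s _), Finset.sum_add_distrib, ← Finset.mul_sum] at hα
  refine (mul_eq_zero.1 ?_).resolve_left
    (mul_ne_zero (ofReal_ne_zero.2 ht.ne') I_ne_zero)
  linear_combination hα + q / 2 * hzero t ht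

theorem Admissible.weightedHarmonic {k m : ℕ} {bp bn : ℤ → ℂ} (h : Admissible bp bn)
    (hk : 0 < k) (hm : 0 < m) :
    WeightedHarmonic (1 / 2 - k) (maassSeries k m bp bn)
      (fun τ =>
        maassSeries k m (JacobiConverse.derivCoeff m bp) (JacobiConverse.derivCoeff m bn) τ -
        (τ.im ^ (1 / 2 - k : ℝ) : ℝ) *
          (starRingEnd ℂ) (holSeries m (shadowCoeff (3 / 2 - k) m bn) τ))
      (fun τ => (τ.im ^ (1 / 2 - k : ℝ) : ℝ) *
        (starRingEnd ℂ) (holSeries m (shadowCoeff (3 / 2 - k) m bn) τ)) where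
  hasWirtinger _ hτ := h.hasWirtinger hk hm hτ
  exists_shadow := ⟨_, h.differentiableOn_shadow hk hm, fun _ _ => rfl⟩

theorem maassSeries_eq_sum_invSlash_of_axis {ι : Type*} [Fintype ι] {k m : ℕ} (hk : 0 < k)
    (hm : 0 < m) {bp bn : ι → ℤ → ℂ} (hb : ∀ s, Admissible (bp s) (bn s)) (w : ι → ι → ℂ)
    (hval : ∀ s, ∀ t : ℝ, 0 < t → maassSeries k m (bp s) (bn s) (t * I) =
      ∑ r, w s r * ((t : ℂ) ^ ((1 / 2 : ℂ) - k) * maassSeries k m (bp r) (bn r) ((1 / t : ℝ) * I)))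
    (hder : ∀ s, ∀ t : ℝ, 0 < t → alphaAxis k m (bp s) (bn s) t =
      -∑ r, w s r * ((t : ℂ) ^ ((1 / 2 : ℂ) - k) * alphaAxis k m (bp r) (bn r) (1 / t)))
    (s : ι) {τ : ℂ} (hτ : τ ∈ upperHalfPlaneSet) :
    maassSeries k m (bp s) (bn s) τ =
      ∑ r, w s r * invSlash ((1 / 2 : ℂ) - k) (maassSeries k m (bp r) (bn r)) τ := by
  have hq : ((1 / 2 : ℂ) - k) = ((1 / 2 - k : ℝ) : ℂ) := by push_cast; rfl
  have hα : ((2 * k - 1) / 4 : ℂ) = -((1 / 2 - k : ℝ) : ℂ) / 2 := by push_cast; ring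
  simp only [alphaAxis, hα] at hder
  rw [hq] at hval hder ⊢
  refine eq_sum_invSlash_of_axis (fun s => (hb s).weightedHarmonic hk hm) w hval
    (fun s t ht => ?_) s hτ
  simpa only [sub_add_cancel] using hder s t ht

/-! ### Theta functions -/

/-- `e^{2πi (r² τ / 4m + r z)}`. -/
def thetaTerm (m : ℕ) (r : ℤ) (p : ℂ × ℂ) : ℂ :=
  exp (2 * Real.pi * I * (r ^ 2 / (4 * m)) * p.1 + 2 * Real.pi * I * r * p.2)

/-- The series `∑ c(r) e^{2πi (r² τ / 4m + r z)}`. -/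
def thetaSeries (m : ℕ) (c : ℤ → ℂ) (p : ℂ × ℂ) : ℂ := ∑' r : ℤ, c r * thetaTerm m r p

/-- Coefficients for which `thetaSeries` converges. -/
def GaussSummable (c : ℤ → ℂ) : Prop :=
  ∀ ε : ℝ, 0 < ε → Summable fun r : ℤ => ‖c r‖ * Real.exp (-ε * (r : ℝ) ^ 2)

theorem abs_int_le_sq (r : ℤ) : |(r : ℝ)| ≤ (r : ℝ) ^ 2 := by
  have hint : |r| ≤ r ^ 2 := sq_abs r ▸ Int.le_self_sq |r|
  exact_mod_cast hint

theorem summable_exp_neg_sq_int {ε : ℝ} (hε : 0 < ε) :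
    Summable fun r : ℤ => Real.exp (-ε * (r : ℝ) ^ 2) := by
  refine Summable.of_nonneg_of_le (fun _ => (Real.exp_pos _).le) (fun r => ?_)
    (summable_exp_neg_abs_int hε)
  exact Real.exp_le_exp.2 (by nlinarith [abs_int_le_sq r])

theorem GaussSummable.of_norm_le_one {c : ℤ → ℂ} (h : ∀ r, ‖c r‖ ≤ 1) : GaussSummable c :=
  fun ε hε => Summable.of_nonneg_of_le (fun _ => by positivity)
    (fun r => (mul_le_mul_of_nonneg_right (h r) (Real.exp_pos _).le).trans_eq (one_mul _))
    (summable_exp_neg_sq_int hε)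

theorem GaussSummable.of_norm_le {c c' : ℤ → ℂ} (hc : GaussSummable c) {K : ℝ}
    (h : ∀ r : ℤ, ‖c' r‖ ≤ K * (r : ℝ) ^ 2 * ‖c r‖) : GaussSummable c' := fun ε hε => by
  refine Summable.of_nonneg_of_le (fun _ => by positivity) (fun r => ?_)
    ((hc (ε / 2) (half_pos hε)).mul_left (|K| * (2 / ε)))
  have hsq : (r : ℝ) ^ 2 ≤ 2 / ε * Real.exp (ε / 2 * (r : ℝ) ^ 2) := by
    rw [div_mul_eq_mul_div, le_div_iff₀ hε]
    linarith [Real.add_one_le_exp (ε / 2 * (r : ℝ) ^ 2)]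
  calc ‖c' r‖ * Real.exp (-ε * (r : ℝ) ^ 2)
      ≤ |K| * (r : ℝ) ^ 2 * ‖c r‖ * Real.exp (-ε * (r : ℝ) ^ 2) := by
        gcongr
        refine (h r).trans ?_
        gcongr
        exact le_abs_self K
    _ ≤ |K| * (2 / ε * Real.exp (ε / 2 * (r : ℝ) ^ 2)) * ‖c r‖ * Real.exp (-ε * (r : ℝ) ^ 2) := by
        gcongr
    _ = |K| * (2 / ε) *
          (‖c r‖ * (Real.exp (ε / 2 * (r : ℝ) ^ 2) * Real.exp (-ε * (r : ℝ) ^ 2))) := by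
        ring
    _ = |K| * (2 / ε) * (‖c r‖ * Real.exp (-(ε / 2) * (r : ℝ) ^ 2)) := by
        rw [← Real.exp_add]
        ring_nf

/-- The coefficients of `∂/∂τ` of a theta series. -/
def thetaCoeffTau (m : ℕ) (c : ℤ → ℂ) (r : ℤ) : ℂ := 2 * Real.pi * I * (r ^ 2 / (4 * m)) * c r

/-- The coefficients of `∂/∂z` of a theta series. -/
def thetaCoeffZ (c : ℤ → ℂ) (r : ℤ) : ℂ := 2 * Real.pi * I * r * c r

theorem norm_thetaCoeffTau (m : ℕ) (c : ℤ → ℂ) (r : ℤ) :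
    ‖thetaCoeffTau m c r‖ = 2 * Real.pi / (4 * m) * (r : ℝ) ^ 2 * ‖c r‖ := by
  simp only [thetaCoeffTau, norm_mul, norm_div, norm_pow, Complex.norm_ofNat, Complex.norm_real,
    Complex.norm_I, Complex.norm_intCast, Complex.norm_natCast, Real.norm_eq_abs,
    abs_of_pos Real.pi_pos, sq_abs]
  ring

theorem norm_thetaCoeffZ (c : ℤ → ℂ) (r : ℤ) :
    ‖thetaCoeffZ c r‖ = 2 * Real.pi * |(r : ℝ)| * ‖c r‖ := by
  simp only [thetaCoeffZ, norm_mul, Complex.norm_ofNat, Complex.norm_real,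
    Complex.norm_I, Complex.norm_intCast, Real.norm_eq_abs, abs_of_pos Real.pi_pos]
  ring

theorem GaussSummable.tau {c : ℤ → ℂ} (hc : GaussSummable c) (m : ℕ) :
    GaussSummable (thetaCoeffTau m c) :=
  hc.of_norm_le fun r => (norm_thetaCoeffTau m c r).le

theorem GaussSummable.z {c : ℤ → ℂ} (hc : GaussSummable c) : GaussSummable (thetaCoeffZ c) :=
  hc.of_norm_le (K := 2 * Real.pi) fun r => by
    rw [norm_thetaCoeffZ]
    have := abs_int_le_sq r
    gcongr

/-- The linear form in the exponent of `thetaTerm`. -/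
def thetaForm (m : ℕ) (r : ℤ) : ℂ × ℂ →L[ℂ] ℂ :=
  (2 * Real.pi * I * (r ^ 2 / (4 * m)) : ℂ) • ContinuousLinearMap.fst ℂ ℂ ℂ +
    (2 * Real.pi * I * r : ℂ) • ContinuousLinearMap.snd ℂ ℂ ℂ

theorem exp_thetaForm (m : ℕ) (r : ℤ) (p : ℂ × ℂ) : exp (thetaForm m r p) = thetaTerm m r p := by
  simp [thetaTerm, thetaForm]

theorem re_thetaForm (m : ℕ) (r : ℤ) (p : ℂ × ℂ) :
    (thetaForm m r p).re =
      -(Real.pi / (2 * m)) * (r : ℝ) ^ 2 * p.1.im - 2 * Real.pi * r * p.2.im := by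
  have hreal : thetaForm m r p = ((2 * Real.pi * (r ^ 2 / (4 * m)) : ℝ) : ℂ) * (I * p.1) +
      ((2 * Real.pi * r : ℝ) : ℂ) * (I * p.2) := by
    simp only [thetaForm, add_apply, smul_apply, ContinuousLinearMap.coe_fst',
      ContinuousLinearMap.coe_snd', smul_eq_mul]
    push_cast
    ring
  rw [hreal, add_re, re_ofReal_mul, re_ofReal_mul, I_mul_re, I_mul_re]
  ring

theorem norm_thetaTerm (m : ℕ) (r : ℤ) (p : ℂ × ℂ) :
    ‖thetaTerm m r p‖ =
      Real.exp (-(Real.pi / (2 * m)) * (r : ℝ) ^ 2 * p.1.im - 2 * Real.pi * r * p.2.im) := by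
  rw [← exp_thetaForm, Complex.norm_exp, re_thetaForm]

theorem norm_thetaForm_le (m : ℕ) (r : ℤ) :
    ‖thetaForm m r‖ ≤ Real.pi / (2 * m) * (r : ℝ) ^ 2 + 2 * Real.pi * |(r : ℝ)| := by
  have hτ : ‖(2 * Real.pi * I * (r ^ 2 / (4 * m)) : ℂ)‖ = Real.pi / (2 * m) * (r : ℝ) ^ 2 := by
    have := norm_thetaCoeffTau m 1 r
    simp only [thetaCoeffTau, Pi.one_apply, mul_one, norm_one] at this
    rw [this]
    ring
  have hz : ‖(2 * Real.pi * I * r : ℂ)‖ = 2 * Real.pi * |(r : ℝ)| := by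
    have := norm_thetaCoeffZ 1 r
    simpa only [thetaCoeffZ, Pi.one_apply, mul_one, norm_one] using this
  refine (norm_add_le _ _).trans ?_
  rw [norm_smul, norm_smul, hτ, hz]
  exact add_le_add
    (mul_le_of_le_one_right (by positivity) (ContinuousLinearMap.norm_fst_le ℂ ℂ ℂ))
    (mul_le_of_le_one_right (by positivity) (ContinuousLinearMap.norm_snd_le ℂ ℂ ℂ))

theorem exp_neg_sq_add_le {ε : ℝ} (hε : 0 < ε) (B x : ℝ) :
    Real.exp (-(2 * ε) * x ^ 2 + B * |x|) ≤ Real.exp (B ^ 2 / (4 * ε)) * Real.exp (-ε * x ^ 2) := by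
  rw [← Real.exp_add]
  refine Real.exp_le_exp.2 ?_
  have h : B ^ 2 / (4 * ε) + -ε * x ^ 2 - (-(2 * ε) * x ^ 2 + B * |x|) =
      (B - 2 * ε * |x|) ^ 2 / (4 * ε) := by
    rw [← sq_abs x]
    field_simp
    ring
  have : 0 ≤ (B - 2 * ε * |x|) ^ 2 / (4 * ε) := by positivity
  linarith

section ThetaSeries

variable {m : ℕ} {c : ℤ → ℂ} {p : ℂ × ℂ}

theorem re_thetaForm_add_mul_norm_le (hm : 0 < m) (r : ℤ) (hp : p ∈ domain) :
    (thetaForm m r p).re + p.1.im / 2 * ‖thetaForm m r‖ ≤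
      -(2 * (Real.pi / (8 * m) * p.1.im)) * (r : ℝ) ^ 2 +
        2 * Real.pi * (|p.2.im| + p.1.im / 2) * |(r : ℝ)| := by
  have hv : 0 < p.1.im := hp
  have hnorm := mul_le_mul_of_nonneg_left (norm_thetaForm_le m r) (half_pos hv).le
  have hlin : -(r * p.2.im) ≤ |p.2.im| * |(r : ℝ)| := by
    rw [← abs_mul, mul_comm]
    exact neg_le_abs _
  calc (thetaForm m r p).re + p.1.im / 2 * ‖thetaForm m r‖
      ≤ (-(Real.pi / (2 * m)) * (r : ℝ) ^ 2 * p.1.im + 2 * Real.pi * -(r * p.2.im)) +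
          p.1.im / 2 * (Real.pi / (2 * m) * (r : ℝ) ^ 2 + 2 * Real.pi * |(r : ℝ)|) := by
        rw [re_thetaForm]
        linarith
    _ ≤ (-(Real.pi / (2 * m)) * (r : ℝ) ^ 2 * p.1.im + 2 * Real.pi * (|p.2.im| * |(r : ℝ)|)) +
          p.1.im / 2 * (Real.pi / (2 * m) * (r : ℝ) ^ 2 + 2 * Real.pi * |(r : ℝ)|) := by
        gcongr
    _ = _ := by
        field_simp
        ring

theorem summable_norm_mul_exp_thetaForm (hm : 0 < m) (hc : GaussSummable c) (hp : p ∈ domain) :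
    Summable fun r : ℤ =>
      ‖c r‖ * Real.exp ((thetaForm m r p).re + p.1.im / 2 * ‖thetaForm m r‖) := by
  have hε : 0 < Real.pi / (8 * m) * p.1.im := mul_pos (by positivity) hp
  refine Summable.of_nonneg_of_le (fun _ => by positivity) (fun r => ?_)
    ((hc _ hε).mul_left (Real.exp ((2 * Real.pi * (|p.2.im| + p.1.im / 2)) ^ 2 /
      (4 * (Real.pi / (8 * m) * p.1.im)))))
  rw [mul_left_comm]
  gcongr
  exact (Real.exp_le_exp.2 (re_thetaForm_add_mul_norm_le hm r hp)).trans
    (exp_neg_sq_add_le hε _ _)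

theorem summable_thetaSeries (hm : 0 < m) (hc : GaussSummable c) (hp : p ∈ domain) :
    Summable fun r => ‖c r * thetaTerm m r p‖ := by
  have h := summable_norm_mul_exp (summable_norm_mul_exp_thetaForm hm hc hp) (y := p)
    (by simpa using (half_pos hp).le)
  simpa only [exp_thetaForm] using h

theorem thetaSeries_eq_tsum_exp (m : ℕ) (c : ℤ → ℂ) :
    thetaSeries m c = fun p => ∑' r, c r * exp (thetaForm m r p) := by
  simp only [exp_thetaForm]
  rfl

theorem analyticAt_thetaSeries (hm : 0 < m) (hc : GaussSummable c) (hp : p ∈ domain) :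
    AnalyticAt ℝ (thetaSeries m c) p := by
  rw [thetaSeries_eq_tsum_exp]
  exact (analyticAt_tsum_exp (𝕜 := ℂ) (half_pos hp)
    (summable_norm_mul_exp_thetaForm hm hc hp)).restrictScalars

theorem hasFDerivAt_thetaSeries (hm : 0 < m) (hc : GaussSummable c) (hp : p ∈ domain) :
    HasFDerivAt (𝕜 := ℂ) (thetaSeries m c)
      (thetaSeries m (thetaCoeffTau m c) p • ContinuousLinearMap.fst ℂ ℂ ℂ +
        thetaSeries m (thetaCoeffZ c) p • ContinuousLinearMap.snd ℂ ℂ ℂ) p := by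
  have hτ : Summable fun r => thetaCoeffTau m c r * thetaTerm m r p :=
    (summable_thetaSeries hm (hc.tau m) hp).of_norm
  have hz : Summable fun r => thetaCoeffZ c r * thetaTerm m r p :=
    (summable_thetaSeries hm hc.z hp).of_norm
  have hderiv := hasFDerivAt_tsum_exp (𝕜 := ℂ) (half_pos hp)
    (summable_norm_mul_exp_thetaForm hm hc hp)
  rw [← thetaSeries_eq_tsum_exp] at hderiv
  refine hderiv.congr_fderiv ?_
  have hterm (r : ℤ) : (c r * exp (thetaForm m r p)) • thetaForm m r =
      (thetaCoeffTau m c r * thetaTerm m r p) • ContinuousLinearMap.fst ℂ ℂ ℂ +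
        (thetaCoeffZ c r * thetaTerm m r p) • ContinuousLinearMap.snd ℂ ℂ ℂ := by
    rw [exp_thetaForm, thetaForm, smul_add, smul_smul, smul_smul, thetaCoeffTau, thetaCoeffZ]
    congr 2 <;> ring
  rw [tsum_congr hterm, (hτ.smul_const _).tsum_add (hz.smul_const _), hτ.tsum_smul_const,
    hz.tsum_smul_const]
  rfl

theorem heat_equation (hm : 0 < m) (p : ℂ × ℂ) :
    thetaSeries m (thetaCoeffZ (thetaCoeffZ c)) p =
      8 * Real.pi * I * m * thetaSeries m (thetaCoeffTau m c) p := by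
  have hm' : (m : ℂ) ≠ 0 := by exact_mod_cast hm.ne'
  rw [thetaSeries, thetaSeries, ← tsum_mul_left]
  refine tsum_congr fun r => ?_
  simp only [thetaCoeffZ, thetaCoeffTau]
  field_simp
  ring

end ThetaSeries

/-! ### The theta functions of a residue class -/

/-- The indicator function of the residue class `s mod 2m`. -/
def residueCoeff (m : ℕ) (s : ZMod (2 * m)) (r : ℤ) : ℂ := if (r : ZMod (2 * m)) = s then 1 else 0

/-- `θ_{m,s}(τ, z) = ∑_{r ≡ s mod 2m} e^{2πi (r² τ / 4m + r z)}`. -/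
def theta (m : ℕ) (s : ZMod (2 * m)) : ℂ × ℂ → ℂ := thetaSeries m (residueCoeff m s)

theorem norm_residueCoeff_le (m : ℕ) (s : ZMod (2 * m)) (r : ℤ) : ‖residueCoeff m s r‖ ≤ 1 := by
  unfold residueCoeff
  split_ifs <;> simp

theorem gaussSummable_residueCoeff (m : ℕ) (s : ZMod (2 * m)) : GaussSummable (residueCoeff m s) :=
  GaussSummable.of_norm_le_one (norm_residueCoeff_le m s)

section Theta

variable {m : ℕ}

theorem residueCoeff_add (s : ZMod (2 * m)) (r a : ℤ) :
    residueCoeff m s (r + 2 * m * a) = residueCoeff m s r := by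
  have hcast : ((r + 2 * m * a : ℤ) : ZMod (2 * m)) = (r : ZMod (2 * m)) := by
    have hself := ZMod.natCast_self (2 * m)
    push_cast at hself ⊢
    rw [hself, zero_mul, add_zero]
  rw [residueCoeff, hcast, residueCoeff]

theorem theta_heisenberg (hm : 0 < m) (s : ZMod (2 * m)) (a b : ℤ) (p : ℂ × ℂ) :
    exp (2 * Real.pi * I * m * ((a : ℂ) ^ 2 * p.1 + 2 * a * p.2)) *
      theta m s (p.1, p.2 + a * p.1 + b) = theta m s p := by
  have hm' : (m : ℂ) ≠ 0 := by exact_mod_cast hm.ne'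
  rw [theta, thetaSeries, thetaSeries, ← tsum_mul_left,
    ← (Equiv.addRight (2 * m * a : ℤ)).tsum_eq fun r => residueCoeff m s r * thetaTerm m r p]
  refine tsum_congr fun r => ?_
  simp only [Equiv.coe_addRight, residueCoeff_add]
  rw [mul_left_comm, thetaTerm, thetaTerm, ← exp_add]
  congr 1
  rw [exp_eq_exp_iff_exists_int]
  refine ⟨r * b, ?_⟩
  push_cast
  field_simp
  ring

theorem theta_eq_jacobiTheta₂ (hm : 0 < m) (j : ℤ) (p : ℂ × ℂ) :
    theta m (j : ZMod (2 * m)) p =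
      exp (2 * Real.pi * I * (j ^ 2 / (4 * m)) * p.1 + 2 * Real.pi * I * j * p.2) *
        jacobiTheta₂ (j * p.1 + 2 * m * p.2) (2 * m * p.1) := by
  have hm' : (m : ℂ) ≠ 0 := by exact_mod_cast hm.ne'
  have hinj : Function.Injective fun n : ℤ => j + 2 * m * n := by
    intro n n' h
    have h' : (2 * m : ℤ) * n = 2 * m * n' := by simpa using h
    exact mul_left_cancel₀ (by positivity) h'
  rw [theta, thetaSeries, ← hinj.tsum_eq (f := fun r => residueCoeff m _ r * thetaTerm m r p),
    jacobiTheta₂, ← tsum_mul_left]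
  · refine tsum_congr fun n => ?_
    rw [residueCoeff_add, residueCoeff, if_pos rfl, one_mul, thetaTerm, jacobiTheta₂_term,
      ← exp_add]
    congr 1
    push_cast
    field_simp
    ring
  · intro r hr
    have hmod : (j : ZMod (2 * m)) = r := by
      by_contra h
      exact left_ne_zero_of_mul hr (if_neg (Ne.symm h))
    rw [ZMod.intCast_eq_intCast_iff_dvd_sub] at hmod
    obtain ⟨n, hn⟩ := hmod
    push_cast at hn
    exact ⟨n, by simp only; linarith⟩

theorem summable_exp_neg_sq_add {ε : ℝ} (hε : 0 < ε) : ∃ K : ℝ, ∀ x : ℝ,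
    (Summable fun r : ℤ => Real.exp (-ε * (r + x) ^ 2)) ∧
    ∑' r : ℤ, Real.exp (-ε * (r + x) ^ 2) ≤ K := by
  have hs := (summable_exp_neg_sq_int (half_pos hε)).mul_left (Real.exp ε)
  refine ⟨∑' r : ℤ, Real.exp ε * Real.exp (-(ε / 2) * (r : ℝ) ^ 2), fun x => ?_⟩
  have hle (r : ℤ) : Real.exp (-ε * (r + Int.fract x) ^ 2) ≤
      Real.exp ε * Real.exp (-(ε / 2) * (r : ℝ) ^ 2) := by
    rw [← Real.exp_add]
    refine Real.exp_le_exp.2 ?_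
    have hfract := (Int.fract_lt_one x).le
    have hsq : (r : ℝ) ^ 2 / 2 - 1 ≤ (r + Int.fract x) ^ 2 := by
      nlinarith [sq_nonneg ((r : ℝ) + 2 * Int.fract x), Int.fract_nonneg x]
    nlinarith [mul_le_mul_of_nonneg_left hsq hε.le]
  have hs' : Summable fun r : ℤ => Real.exp (-ε * (r + Int.fract x) ^ 2) :=
    Summable.of_nonneg_of_le (fun _ => (Real.exp_pos _).le) hle hs
  have hfun : (fun r : ℤ => Real.exp (-ε * (r + x) ^ 2)) =
      (fun r : ℤ => Real.exp (-ε * (r + Int.fract x) ^ 2)) ∘ Equiv.addRight ⌊x⌋ := by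
    ext r
    simp only [Function.comp_apply, Equiv.coe_addRight]
    push_cast
    rw [add_assoc, Int.floor_add_fract]
  rw [hfun]
  refine ⟨(Equiv.addRight ⌊x⌋).summable_iff.2 hs', ?_⟩
  exact ((Equiv.addRight ⌊x⌋).tsum_eq fun r : ℤ => Real.exp (-ε * (r + Int.fract x) ^ 2)).le.trans
    (hs'.tsum_le_tsum hle hs)

theorem exists_norm_theta_le (hm : 0 < m) : ∃ K : ℝ, 0 ≤ K ∧ ∀ s : ZMod (2 * m), ∀ p : ℂ × ℂ,
    1 ≤ p.1.im → ‖theta m s p‖ ≤ K * Real.exp (2 * Real.pi * m * p.2.im ^ 2 / p.1.im) := by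
  have hε : 0 < Real.pi / (2 * m) := by positivity
  obtain ⟨K, hK⟩ := summable_exp_neg_sq_add hε
  have hK0 : 0 ≤ K := (tsum_nonneg fun r : ℤ => (Real.exp_pos _).le).trans (hK 0).2
  refine ⟨K, hK0, fun s p hp => ?_⟩
  have : 0 < p.1.im := one_pos.trans_le hp
  set E := Real.exp (2 * Real.pi * m * p.2.im ^ 2 / p.1.im)
  set x := 2 * m * p.2.im / p.1.im with hx
  have hterm (r : ℤ) : ‖residueCoeff m s r * thetaTerm m r p‖ ≤
      E * Real.exp (-(Real.pi / (2 * m)) * (r + x) ^ 2) := by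
    rw [norm_mul]
    refine (mul_le_of_le_one_left (norm_nonneg _) (norm_residueCoeff_le m s r)).trans ?_
    rw [norm_thetaTerm, ← Real.exp_add]
    refine Real.exp_le_exp.2 ?_
    have hsquare : -(Real.pi / (2 * m)) * (r : ℝ) ^ 2 * p.1.im - 2 * Real.pi * r * p.2.im =
        2 * Real.pi * m * p.2.im ^ 2 / p.1.im - Real.pi / (2 * m) * (p.1.im * (r + x) ^ 2) := by
      rw [hx]
      field_simp
      ring
    rw [hsquare]
    have hv1 : (r + x) ^ 2 ≤ p.1.im * (r + x) ^ 2 := le_mul_of_one_le_left (sq_nonneg _) hp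
    linarith [mul_le_mul_of_nonneg_left hv1 hε.le]
  have hs := (hK x).1.mul_left E
  calc ‖theta m s p‖ ≤ ∑' r : ℤ, E * Real.exp (-(Real.pi / (2 * m)) * (r + x) ^ 2) :=
        tsum_of_norm_bounded hs.hasSum hterm
    _ = E * ∑' r : ℤ, Real.exp (-(Real.pi / (2 * m)) * (r + x) ^ 2) := tsum_mul_left
    _ ≤ E * K := by gcongr; exact (hK x).2
    _ = K * E := mul_comm _ _

theorem theta_neg_one_div_eq_jacobiTheta₂ (hm : 0 < m) (j : ℤ) {p : ℂ × ℂ} (hp : p ∈ domain) :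
    theta m (j : ZMod (2 * m)) (-1 / p.1, p.2 / p.1) =
      (-I * (p.1 / (2 * m))) ^ (1 / 2 : ℂ) * exp (2 * Real.pi * I * m * (p.2 ^ 2 / p.1)) *
        jacobiTheta₂ (p.2 - j / (2 * m)) (p.1 / (2 * m)) := by
  have hτ0 := ne_zero_of_mem_upperHalfPlaneSet hp
  have hm' : (m : ℂ) ≠ 0 := by exact_mod_cast hm.ne'
  have hz : (p.2 - j / (2 * m)) / (p.1 / (2 * m)) = j * (-1 / p.1) + 2 * m * (p.2 / p.1) := by
    field_simp
    ring
  have hτ : -1 / (p.1 / (2 * m)) = 2 * m * (-1 / p.1) := by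
    field_simp
  have : (-I * (p.1 / (2 * m))) ^ (1 / 2 : ℂ) ≠ 0 := by
    rw [Ne, cpow_eq_zero_iff, not_and_or]
    exact Or.inl (by simp [hτ0, hm'])
  have hexp : exp (2 * Real.pi * I * (j ^ 2 / (4 * m)) * (-1 / p.1) +
        2 * Real.pi * I * j * (p.2 / p.1)) =
      exp (2 * Real.pi * I * m * (p.2 ^ 2 / p.1)) *
        exp (-Real.pi * I * (p.2 - j / (2 * m)) ^ 2 / (p.1 / (2 * m))) := by
    rw [← exp_add]
    congr 1
    field_simp
    ring
  rw [theta_eq_jacobiTheta₂ hm, jacobiTheta₂_functional_equation (p.2 - j / (2 * m)), hz, hτ,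
    hexp]
  field_simp

variable [NeZero (2 * m)]

theorem tsum_eq_sum_theta (hm : 0 < m) (g : ZMod (2 * m) → ℂ) {p : ℂ × ℂ} (hp : p ∈ domain) :
    ∑' r : ℤ, g r * thetaTerm m r p = ∑ s, g s * theta m s p := by
  simp only [theta, thetaSeries, ← tsum_mul_left]
  rw [← Summable.tsum_finsetSum fun s _ =>
    (summable_thetaSeries hm (gaussSummable_residueCoeff m s) hp).of_norm.mul_left (g s)]
  refine tsum_congr fun r => ?_
  simp [residueCoeff]

theorem neg_I_mul_div_cpow {τ : ℂ} (hτ : τ ∈ upperHalfPlaneSet) {x : ℝ} (hx : 0 < x) (q : ℂ) :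
    (-I * (τ / x)) ^ q = (-I * τ) ^ q * (x : ℂ) ^ (-q) := by
  have hτ0 : -I * τ ≠ 0 := slitPlane_ne_zero (neg_I_mul_mem_slitPlane hτ)
  have hx' : (x : ℂ) ≠ 0 := by exact_mod_cast hx.ne'
  have hxi : (0 : ℝ) < x⁻¹ := inv_pos.2 hx
  have hfactor : -I * (τ / x) = ((x⁻¹ : ℝ) : ℂ) * (-I * τ) := by
    push_cast
    field_simp
  rw [hfactor, cpow_def_of_ne_zero (mul_ne_zero (by exact_mod_cast hxi.ne') hτ0),
    cpow_def_of_ne_zero hτ0, cpow_def_of_ne_zero hx', log_ofReal_mul hxi hτ0, Real.log_inv,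
    ← exp_add, ← ofReal_log hx.le]
  congr 1
  push_cast
  ring

theorem jacobiTheta₂_eq_sum_theta (hm : 0 < m) (j : ℤ) {p : ℂ × ℂ} (hp : p ∈ domain) :
    jacobiTheta₂ (p.2 - j / (2 * m)) (p.1 / (2 * m)) =
      ∑ r, ZMod.stdAddChar (-((j : ZMod (2 * m)) * r)) * theta m r p := by
  have : (m : ℂ) ≠ 0 := by exact_mod_cast hm.ne'
  rw [← tsum_eq_sum_theta hm (fun r => ZMod.stdAddChar (-((j : ZMod (2 * m)) * r))) hp,
    jacobiTheta₂]
  refine tsum_congr fun n => ?_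
  have hcast : -((j : ZMod (2 * m)) * (n : ZMod (2 * m))) = ((-(j * n) : ℤ) : ZMod (2 * m)) := by
    push_cast
    ring
  rw [hcast, ZMod.stdAddChar_coe, thetaTerm, ← exp_add, jacobiTheta₂_term]
  congr 1
  push_cast
  field_simp
  ring

theorem theta_S (hm : 0 < m) (s : ZMod (2 * m)) {p : ℂ × ℂ} (hp : p ∈ domain) :
    theta m s (-1 / p.1, p.2 / p.1) = (-I * p.1) ^ (1 / 2 : ℂ) *
      ((2 * m : ℝ) : ℂ) ^ (-(1 / 2) : ℂ) *
      exp (2 * Real.pi * I * m * (p.2 ^ 2 / p.1)) *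
      ∑ r, ZMod.stdAddChar (-(s * r)) * theta m r p := by
  have hm' : (0 : ℝ) < 2 * m := by positivity
  have hscale := neg_I_mul_div_cpow (τ := p.1) hp hm' (1 / 2)
  push_cast at hscale ⊢
  obtain ⟨j, rfl⟩ := ZMod.intCast_surjective s
  rw [theta_neg_one_div_eq_jacobiTheta₂ hm j hp, jacobiTheta₂_eq_sum_theta hm j hp, hscale]

end Theta

/-! ### The theta decomposition -/

/-- The component `h_s` of the theta decomposition `F = ∑ h_s θ_s` of `fourierSeries k m cp cm`. -/
def thetaComponent (k m : ℕ) (cp cm : ℤ → ℤ → ℂ) (s : ZMod (2 * m)) : ℂ → ℂ :=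
  maassSeries k m (coeff m cp s) (coeff m (negPart m cm) s)

section Decomposition

variable {m : ℕ}

theorem monomial_eq_qExp_mul_thetaTerm (hm : 0 < m) (l r : ℤ) (p : ℂ × ℂ) :
    monomial l r p = qExp m (disc m l r) p.1 * thetaTerm m r p := by
  have hm' : (m : ℂ) ≠ 0 := by exact_mod_cast hm.ne'
  rw [monomial, qExp, thetaTerm, ← exp_add, ← exp_add, disc]
  congr 1
  push_cast
  field_simp
  ring

variable [NeZero (2 * m)]

theorem tsum_mul_thetaTerm_eq_sum_theta (hm : 0 < m) {p : ℂ × ℂ} (hp : p ∈ domain)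
    {f : ZMod (2 * m) → ℤ → ℂ} (hf : ∀ s, Summable fun D => ‖f s D‖) :
    ∑' x : ℤ × ℤ, f (x.2 : ZMod (2 * m)) x.1 * thetaTerm m x.2 p =
      ∑ s, (∑' D, f s D) * theta m s p := by
  have hθ (s : ZMod (2 * m)) : Summable fun r => ‖residueCoeff m s r * thetaTerm m r p‖ :=
    summable_thetaSeries hm (gaussSummable_residueCoeff m s) hp
  have hprod (s : ZMod (2 * m)) : (∑' D, f s D) * theta m s p =
      ∑' x : ℤ × ℤ, f s x.1 * (residueCoeff m s x.2 * thetaTerm m x.2 p) :=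
    tsum_mul_tsum_of_summable_norm (hf s) (hθ s)
  simp only [hprod]
  rw [← Summable.tsum_finsetSum fun s _ => summable_mul_of_summable_norm (hf s) (hθ s)]
  refine tsum_congr fun x => ?_
  simp [residueCoeff]

theorem tsum_monomial_eq_sum_holSeries_mul_theta (hm : 0 < m) {c : ℤ → ℤ → ℂ}
    (hc : DiscInvariant m c) {p : ℂ × ℂ} (hp : p ∈ domain)
    (hsum : ∀ s, Summable fun D => ‖coeff m c s D * qExp m D p.1‖) :
    ∑' a : ℤ × ℤ, c a.1 a.2 * monomial a.1 a.2 p =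
      ∑ s, holSeries m (coeff m c s) p.1 * theta m s p := by
  simp only [monomial_eq_qExp_mul_thetaTerm hm]
  rw [tsum_disc_prod hm hc fun D r => qExp m D p.1 * thetaTerm m r p]
  simp only [← mul_assoc]
  exact tsum_mul_thetaTerm_eq_sum_theta hm hp hsum

theorem tsum_incGamma_mul_monomial_eq_sum_nonSeries_mul_theta {k : ℕ} (hm : 0 < m)
    {c : ℤ → ℤ → ℂ} (hc : DiscInvariant m (negPart m c)) {p : ℂ × ℂ} (hp : p ∈ domain)
    (hsum : ∀ s, Summable fun D : ℤ => ‖coeff m (negPart m c) s D *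
      (incGamma (3 / 2 - k) (-(D : ℝ) * Real.pi * p.1.im / m) : ℂ) * qExp m D p.1‖) :
    (∑' a : ℤ × ℤ, if disc m a.1 a.2 < 0 then
      c a.1 a.2 *
        (incGamma (3 / 2 - k) (-(disc m a.1 a.2 : ℝ) * Real.pi * p.1.im / m) : ℂ) *
        monomial a.1 a.2 p else 0) =
      ∑ s, nonSeries (3 / 2 - k) m (coeff m (negPart m c) s) p.1 * theta m s p := by
  have hterm (a : ℤ × ℤ) : (if disc m a.1 a.2 < 0 then
      c a.1 a.2 *
        (incGamma (3 / 2 - k) (-(disc m a.1 a.2 : ℝ) * Real.pi * p.1.im / m) : ℂ) *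
        monomial a.1 a.2 p else 0) = negPart m c a.1 a.2 *
        ((incGamma (3 / 2 - k) (-(disc m a.1 a.2 : ℝ) * Real.pi * p.1.im / m) : ℂ) *
          qExp m (disc m a.1 a.2) p.1 * thetaTerm m a.2 p) := by
    rw [monomial_eq_qExp_mul_thetaTerm hm, negPart]
    split_ifs
    · ring
    · simp
  simp only [hterm]
  rw [tsum_disc_prod hm hc fun D r => (incGamma (3 / 2 - k)
    (-(D : ℝ) * Real.pi * p.1.im / m) : ℂ) * qExp m D p.1 * thetaTerm m r p]
  simp only [← mul_assoc]
  exact tsum_mul_thetaTerm_eq_sum_theta hm hp (f := fun s D => coeff m (negPart m c) s D *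
    (incGamma (3 / 2 - k) (-(D : ℝ) * Real.pi * p.1.im / m) : ℂ) * qExp m D p.1) hsum

theorem fourierSeries_eq_sum_theta {k : ℕ} (hk : 0 < k) (hm : 0 < m) {cp cm : ℤ → ℤ → ℂ}
    (hcp : DiscInvariant m cp) (hcm : DiscInvariant m (negPart m cm))
    (hadm : ∀ s, Admissible (coeff m cp s) (coeff m (negPart m cm) s)) {p : ℂ × ℂ}
    (hp : p ∈ domain) :
    fourierSeries k m cp cm p = ∑ s, thetaComponent k m cp cm s p.1 * theta m s p := by
  have hhol (s : ZMod (2 * m)) : Summable fun D => ‖coeff m cp s D * qExp m D p.1‖ :=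
    have ⟨_, hN⟩ := (hadm s).hol_support
    summable_holSeries hm (hadm s).hol hN hp
  have hnon (s : ZMod (2 * m)) : Summable fun D : ℤ => ‖coeff m (negPart m cm) s D *
      (incGamma (3 / 2 - k) (-(D : ℝ) * Real.pi * p.1.im / m) : ℂ) * qExp m D p.1‖ :=
    summable_nonSeries (three_halves_sub_le_one hk) hm (hadm s).non (hadm s).non_support hp
  rw [fourierSeries, tsum_monomial_eq_sum_holSeries_mul_theta hm hcp hp hhol,
    tsum_incGamma_mul_monomial_eq_sum_nonSeries_mul_theta hm hcm hp hnon,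
    ← Finset.sum_add_distrib]
  simp only [thetaComponent, maassSeries, add_mul]

end Decomposition

/-! ### The transformation under `S` -/

section Modularity

variable {m : ℕ}

theorem two_I_mul_cpow_half (hm : 0 < m) :
    (2 * I * m : ℂ) ^ (1 / 2 : ℂ) = ((2 * m : ℝ) : ℂ) ^ (1 / 2 : ℂ) * I ^ (1 / 2 : ℂ) := by
  have hmr : (0 : ℝ) < 2 * m := by positivity
  have hmc : ((2 * m : ℝ) : ℂ) ≠ 0 := by exact_mod_cast hmr.ne'
  have hfactor : (2 * I * m : ℂ) = ((2 * m : ℝ) : ℂ) * I := by push_cast; ring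
  rw [hfactor, cpow_def_of_ne_zero (mul_ne_zero hmc I_ne_zero), cpow_def_of_ne_zero hmc,
    cpow_def_of_ne_zero I_ne_zero, log_ofReal_mul hmr I_ne_zero, ← exp_add, ← ofReal_log hmr.le]
  congr 1
  ring

theorem conj_one_div_I_cpow_half : (starRingEnd ℂ) (1 / I ^ (1 / 2 : ℂ)) = I ^ (1 / 2 : ℂ) := by
  rw [cpow_def_of_ne_zero I_ne_zero, log_I, one_div, ← exp_neg, ← exp_conj]
  congr 1
  simp only [map_neg, map_mul, map_div₀, conj_ofReal, conj_I, map_ofNat, map_one]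
  ring

theorem conj_one_div_ofReal_cpow {x : ℝ} (hx : 0 ≤ x) (a : ℝ) :
    (starRingEnd ℂ) (1 / (x : ℂ) ^ (a : ℂ)) = (x : ℂ) ^ (-a : ℂ) := by
  rw [one_div, ← cpow_neg, ← ofReal_neg, ← ofReal_cpow hx, conj_ofReal]

theorem neg_I_mul_cpow_mul_cpow_neg_one_div {τ : ℂ} (hτ : τ ∈ upperHalfPlaneSet) (q : ℂ) :
    (-I * τ) ^ q * (-I * (-1 / τ)) ^ q = 1 := by
  have hτ0 := slitPlane_ne_zero (neg_I_mul_mem_slitPlane hτ)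
  have harg : arg (-I * τ) ≠ Real.pi := slitPlane_arg_ne_pi (neg_I_mul_mem_slitPlane hτ)
  have hinv : -I * (-1 / τ) = (-I * τ)⁻¹ := by
    rw [mul_inv, inv_neg, inv_I]
    field_simp
  rw [hinv, inv_cpow _ _ harg, mul_inv_cancel₀ (cpow_ne_zero_iff.2 (Or.inl hτ0))]

theorem invSlash_invSlash {τ : ℂ} (hτ : τ ∈ upperHalfPlaneSet) (q : ℂ) (h : ℂ → ℂ) :
    invSlash q (invSlash q h) τ = h τ := by
  have hτ0 := ne_zero_of_mem_upperHalfPlaneSet hτ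
  have hinv : -1 / (-1 / τ) = τ := by field_simp
  rw [invSlash, invSlash, hinv, ← mul_assoc, neg_I_mul_cpow_mul_cpow_neg_one_div hτ, one_mul]

theorem two_mul_cpow_neg_half_sq (hm : 0 < m) :
    ((2 * m : ℝ) : ℂ) ^ (-(1 / 2) : ℂ) * ((2 * m : ℝ) : ℂ) ^ (-(1 / 2) : ℂ) * (2 * m) = 1 := by
  have hmr : (0 : ℝ) < 2 * m := by positivity
  have hmc : ((2 * m : ℝ) : ℂ) ≠ 0 := by exact_mod_cast hmr.ne'
  rw [← cpow_add _ _ hmc, show (-(1 / 2) + -(1 / 2) : ℂ) = -1 by norm_num, cpow_neg_one]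
  push_cast at hmc ⊢
  exact inv_mul_cancel₀ hmc

section LSeries

variable {k : ℕ} {cp cm : ℤ → ℤ → ℂ} {Sc : Set (ℝ → ℂ)}

theorem thetaComponent_axis_of_LSer (hk : 0 < k) (hm : 0 < m)
    (hcp : DiscInvariant m cp) (hcm : DiscInvariant m (negPart m cm))
    (hadm : ∀ s, Admissible (coeff m cp s) (coeff m (negPart m cm) s))
    (hSc : ∀ φ ∈ Sc, IsTestFunction φ) (hSc_twist : ∀ φ ∈ Sc, ∀ s : ℂ, twist φ s ∈ Sc)
    (hSc_ne : ∀ y : ℝ, 0 < y → ∃ φ ∈ Sc, φ y ≠ 0)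
    (hL : ∀ φ ∈ Sc, LSer k m cp cm φ =
      I ^ ((k : ℂ) - 1 / 2) • (weilSBar m).mulVec (LSer k m cp cm (slashS k φ)))
    (j : Fin (2 * m)) {t : ℝ} (ht : 0 < t) :
    thetaComponent k m cp cm (label j) (t * I) =
      ∑ l, I ^ ((k : ℂ) - 1 / 2) * weilSBar m j l * ((t : ℂ) ^ ((1 / 2 : ℂ) - k) *
        thetaComponent k m cp cm (label l) ((1 / t : ℝ) * I)) := by
  refine functional_equation_of_integrals k hSc hSc_twist hSc_ne
    (H := fun j t => thetaComponent k m cp cm (label j : ZMod (2 * m)) (t * I))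
    (fun j => (hadm _).maassSeries_continuousOn_axis hk hm)
    (fun j l => I ^ ((k : ℂ) - 1 / 2) * weilSBar m j l) (fun φ hφ j => ?_) j ht
  have hφb := (hSc φ hφ).boundedTest
  have hLj := congrFun (hL φ hφ) j
  rw [LSer_eq hk hm hcp hcm j (hadm _) hφb] at hLj
  refine hLj.trans ?_
  simp only [Pi.smul_apply, smul_eq_mul, Matrix.mulVec, dotProduct, Finset.mul_sum]
  refine Finset.sum_congr rfl fun l _ => ?_
  rw [LSer_eq hk hm hcp hcm l (hadm _) (hφb.slashS k), mul_assoc]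
  rfl

theorem alphaAxis_of_LSerAlpha (hk : 0 < k) (hm : 0 < m)
    (hcp : DiscInvariant m cp) (hcm : DiscInvariant m (negPart m cm))
    (hadm : ∀ s, Admissible (coeff m cp s) (coeff m (negPart m cm) s))
    (hSc : ∀ φ ∈ Sc, IsTestFunction φ) (hSc_twist : ∀ φ ∈ Sc, ∀ s : ℂ, twist φ s ∈ Sc)
    (hSc_ne : ∀ y : ℝ, 0 < y → ∃ φ ∈ Sc, φ y ≠ 0)
    (hLα : ∀ φ ∈ Sc, LSerAlpha k m cp cm φ =
      -I ^ ((k : ℂ) - 1 / 2) • (weilSBar m).mulVec (LSerAlpha k m cp cm (slashS k φ)))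
    (j : Fin (2 * m)) {t : ℝ} (ht : 0 < t) :
    alphaAxis k m (coeff m cp (label j)) (coeff m (negPart m cm) (label j)) t =
      -∑ l, I ^ ((k : ℂ) - 1 / 2) * weilSBar m j l * ((t : ℂ) ^ ((1 / 2 : ℂ) - k) *
        alphaAxis k m (coeff m cp (label l)) (coeff m (negPart m cm) (label l)) (1 / t)) := by
  simp only [← Finset.sum_neg_distrib, ← neg_mul]
  refine functional_equation_of_integrals k hSc hSc_twist hSc_ne
    (H := fun j => alphaAxis k m (coeff m cp (label j : ZMod (2 * m)))
      (coeff m (negPart m cm) (label j : ZMod (2 * m))))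
    (fun j => (hadm _).alphaAxis_continuousOn hk hm)
    (fun j l => -I ^ ((k : ℂ) - 1 / 2) * weilSBar m j l) (fun φ hφ j => ?_) j ht
  have hφb := (hSc φ hφ).boundedTest
  have hLj := congrFun (hLα φ hφ) j
  rw [LSerAlpha_eq hk hm hcp hcm j (hadm _) hφb] at hLj
  refine hLj.trans ?_
  simp only [Pi.smul_apply, smul_eq_mul, Matrix.mulVec, dotProduct, Finset.mul_sum]
  refine Finset.sum_congr rfl fun l _ => ?_
  rw [LSerAlpha_eq hk hm hcp hcm l (hadm _) (hφb.slashS k), mul_assoc]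

end LSeries

variable [NeZero (2 * m)]

theorem label_bijective :
    Function.Bijective fun j : Fin (2 * m) => ((label j : ℤ) : ZMod (2 * m)) := by
  rw [Fintype.bijective_iff_injective_and_card]
  refine ⟨fun i j h => ?_, by simp [ZMod.card]⟩
  obtain ⟨n, hn⟩ := (ZMod.intCast_eq_intCast_iff_dvd_sub _ _ _).1 h
  simp only [label, Nat.cast_mul, Nat.cast_ofNat] at hn
  have hi := i.2
  have hj := j.2
  have hn0 : n = 0 := by
    by_contra hne
    rcases lt_or_gt_of_ne hne with hlt | hgt
    · nlinarith
    · nlinarith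
  rw [hn0, mul_zero] at hn
  exact Fin.ext (by omega)

theorem weilSBar_apply (hm : 0 < m) (j l : Fin (2 * m)) :
    weilSBar m j l = I ^ (1 / 2 : ℂ) * ((2 * m : ℝ) : ℂ) ^ (-(1 / 2) : ℂ) *
      ZMod.stdAddChar ((label j : ZMod (2 * m)) * (label l : ZMod (2 * m))) := by
  have hmr : (0 : ℝ) ≤ 2 * m := by positivity
  have hroot : (starRingEnd ℂ) (1 / ((2 * m : ℝ) : ℂ) ^ (1 / 2 : ℂ)) =
      ((2 * m : ℝ) : ℂ) ^ (-(1 / 2) : ℂ) := by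
    simpa using conj_one_div_ofReal_cpow hmr (1 / 2)
  have hcast : ((label j : ZMod (2 * m)) * (label l : ZMod (2 * m))) =
      ((label j * label l : ℤ) : ZMod (2 * m)) := by push_cast; ring
  have hexp : (starRingEnd ℂ) (-(2 * Real.pi * I * (label l * label j : ℂ) / (2 * m))) =
      2 * Real.pi * I * ((label j * label l : ℤ) : ℂ) / ((2 * m : ℕ) : ℂ) := by
    simp only [map_neg, map_mul, map_div₀, conj_ofReal, conj_I, map_ofNat, map_natCast, map_intCast]
    push_cast
    ring
  rw [weilSBar, Matrix.map_apply, weilS, Matrix.of_apply, two_I_mul_cpow_half hm, map_mul,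
    ← one_div_mul_one_div, map_mul, conj_one_div_I_cpow_half, hroot, ← exp_conj, hexp, hcast,
    ZMod.stdAddChar_coe]
  ring

/-- The functional equation `h_s(τ) = i^k (2m)^{-1/2} ∑_r e^{2πi sr/2m} (-iτ)^{1/2-k} h_r(-1/τ)` of
the components of a theta decomposition of weight `k` and index `m`. -/
def ComponentsModular (k m : ℕ) [NeZero (2 * m)] (h : ZMod (2 * m) → ℂ → ℂ) : Prop :=
  ∀ s, ∀ τ ∈ upperHalfPlaneSet, h s τ = ∑ r, I ^ k * ((2 * m : ℝ) : ℂ) ^ (-(1 / 2) : ℂ) *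
    ZMod.stdAddChar (s * r) * invSlash ((1 / 2 : ℂ) - k) (h r) τ

theorem I_cpow_mul_weilSBar_apply (k : ℕ) (hm : 0 < m) (j l : Fin (2 * m)) :
    I ^ ((k : ℂ) - 1 / 2) * weilSBar m j l = I ^ k * ((2 * m : ℝ) : ℂ) ^ (-(1 / 2) : ℂ) *
      ZMod.stdAddChar ((label j : ZMod (2 * m)) * (label l : ZMod (2 * m))) := by
  have hI : I ^ ((k : ℂ) - 1 / 2) * I ^ (1 / 2 : ℂ) = I ^ k := by
    rw [← cpow_add _ _ I_ne_zero, sub_add_cancel, cpow_natCast]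
  rw [weilSBar_apply hm, ← hI]
  ring

theorem componentsModular_thetaComponent {k : ℕ} {cp cm : ℤ → ℤ → ℂ} {Sc : Set (ℝ → ℂ)}
    (hk : 0 < k) (hm : 0 < m) (hcp : DiscInvariant m cp) (hcm : DiscInvariant m (negPart m cm))
    (hadm : ∀ s, Admissible (coeff m cp s) (coeff m (negPart m cm) s))
    (hSc : ∀ φ ∈ Sc, IsTestFunction φ) (hSc_twist : ∀ φ ∈ Sc, ∀ s : ℂ, twist φ s ∈ Sc)
    (hSc_ne : ∀ y : ℝ, 0 < y → ∃ φ ∈ Sc, φ y ≠ 0)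
    (hL : ∀ φ ∈ Sc, LSer k m cp cm φ =
      I ^ ((k : ℂ) - 1 / 2) • (weilSBar m).mulVec (LSer k m cp cm (slashS k φ)))
    (hLα : ∀ φ ∈ Sc, LSerAlpha k m cp cm φ =
      -I ^ ((k : ℂ) - 1 / 2) • (weilSBar m).mulVec (LSerAlpha k m cp cm (slashS k φ))) :
    ComponentsModular k m (thetaComponent k m cp cm) := by
  intro s τ hτ
  obtain ⟨j, rfl⟩ := label_bijective.2 s
  have hmodular := maassSeries_eq_sum_invSlash_of_axis hk hm
    (fun j : Fin (2 * m) => hadm (label j : ZMod (2 * m)))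
    (fun j l => I ^ ((k : ℂ) - 1 / 2) * weilSBar m j l)
    (fun _ _ ht => thetaComponent_axis_of_LSer hk hm hcp hcm hadm hSc hSc_twist hSc_ne hL _ ht)
    (fun _ _ ht => alphaAxis_of_LSerAlpha hk hm hcp hcm hadm hSc hSc_twist hSc_ne hLα _ ht) j hτ
  refine hmodular.trans (Fintype.sum_bijective _ label_bijective _ _ fun l => ?_)
  rw [I_cpow_mul_weilSBar_apply k hm]
  rfl

namespace ComponentsModular

variable {k : ℕ} {h : ZMod (2 * m) → ℂ → ℂ}

theorem eq_neg_one_pow_mul_neg (hm : 0 < m) (hh : ComponentsModular k m h) (s : ZMod (2 * m))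
    {τ : ℂ} (hτ : τ ∈ upperHalfPlaneSet) : h s τ = (-1) ^ k * h (-s) τ := by
  set S₀ := ((2 * m : ℝ) : ℂ) ^ (-(1 / 2) : ℂ) with hS₀
  set q : ℂ := (1 / 2 : ℂ) - k with hq
  have hI : (I ^ k : ℂ) * I ^ k = (-1) ^ k := by rw [← mul_pow, I_mul_I]
  have hchar (r u : ZMod (2 * m)) : (ZMod.stdAddChar (s * r) : ℂ) * ZMod.stdAddChar (r * u) =
      ZMod.stdAddChar (r * (s + u)) := by
    rw [← AddChar.map_add_eq_mul]
    congr 1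
    ring
  have hiterate (r : ZMod (2 * m)) : I ^ k * S₀ * ZMod.stdAddChar (s * r) * invSlash q (h r) τ =
      ∑ u, S₀ * S₀ * (-1) ^ k * h u τ * ZMod.stdAddChar (r * (s + u)) := by
    rw [invSlash, hh r _ (neg_one_div_mem_upperHalfPlaneSet hτ), Finset.mul_sum, Finset.mul_sum]
    refine Finset.sum_congr rfl fun u _ => ?_
    have hinv : (-I * τ) ^ q * invSlash q (h u) (-1 / τ) = h u τ := invSlash_invSlash hτ q (h u)
    rw [← hI, ← hchar]
    linear_combination (I ^ k * S₀ * ZMod.stdAddChar (s * r) * (I ^ k * S₀ *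
      ZMod.stdAddChar (r * u))) * hinv
  have horth (u : ZMod (2 * m)) : ∑ r, (ZMod.stdAddChar (r * (s + u)) : ℂ) =
      if u = -s then (2 * m : ℂ) else 0 := by
    rw [AddChar.sum_mulShift _ (ZMod.isPrimitive_stdAddChar (2 * m)), ZMod.card]
    simp only [add_comm s, add_eq_zero_iff_eq_neg]
    split_ifs <;> simp
  rw [hh s τ hτ]
  simp only [← hS₀, ← hq, hiterate]
  rw [Finset.sum_comm]
  simp only [← Finset.mul_sum, horth, mul_ite, mul_zero, Finset.sum_ite_eq', Finset.mem_univ,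
    if_true]
  linear_combination ((-1) ^ k * h (-s) τ) * two_mul_cpow_neg_half_sq hm

theorem eq_sum_neg_one_div (hm : 0 < m) (hh : ComponentsModular k m h) (s : ZMod (2 * m)) {τ : ℂ}
    (hτ : τ ∈ upperHalfPlaneSet) :
    h s τ = (-I * τ) ^ (1 / 2 : ℂ) * τ ^ (-(k : ℤ)) * ((2 * m : ℝ) : ℂ) ^ (-(1 / 2) : ℂ) *
      ∑ r, ZMod.stdAddChar (-(r * s)) * h r (-1 / τ) := by
  have hτ0 := ne_zero_of_mem_upperHalfPlaneSet hτ
  have hw0 : -I * τ ≠ 0 := slitPlane_ne_zero (neg_I_mul_mem_slitPlane hτ)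
  have hweight : (-1) ^ k * (I ^ k * (-I * τ) ^ ((1 / 2 : ℂ) - k)) =
      (-I * τ) ^ (1 / 2 : ℂ) * τ ^ (-(k : ℤ)) := by
    have hIk : (I ^ k : ℂ) ≠ 0 := pow_ne_zero _ I_ne_zero
    have hneg : ((-1) ^ k : ℂ) ≠ 0 := pow_ne_zero _ (by norm_num)
    have hpow : (-I * τ) ^ k = (-1) ^ k * I ^ k * τ ^ k := by rw [mul_pow, neg_pow I]
    rw [cpow_sub _ _ hw0, cpow_natCast, zpow_neg, zpow_natCast, hpow]
    field_simp
  rw [hh.eq_neg_one_pow_mul_neg hm s hτ, hh (-s) _ hτ, Finset.mul_sum, Finset.mul_sum]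
  refine Finset.sum_congr rfl fun r _ => ?_
  rw [invSlash, neg_mul s r, mul_comm s r]
  linear_combination (((2 * m : ℝ) : ℂ) ^ (-(1 / 2) : ℂ) * ZMod.stdAddChar (-(r * s)) *
    h r (-1 / τ)) * hweight

theorem sum_theta_S (hm : 0 < m) (hh : ComponentsModular k m h) {p : ℂ × ℂ} (hp : p ∈ domain) :
    p.1 ^ (-(k : ℤ)) * exp (-(2 * Real.pi * I * m * (p.2 ^ 2 / p.1))) *
      ∑ s, h s (-1 / p.1) * theta m s (-1 / p.1, p.2 / p.1) = ∑ s, h s p.1 * theta m s p := by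
  have hexp : exp (-(2 * Real.pi * I * m * (p.2 ^ 2 / p.1))) *
      exp (2 * Real.pi * I * m * (p.2 ^ 2 / p.1)) = 1 := by
    rw [← exp_add, neg_add_cancel, exp_zero]
  simp only [fun s => hh.eq_sum_neg_one_div hm s hp, theta_S hm _ hp, Finset.mul_sum,
    Finset.sum_mul]
  rw [Finset.sum_comm]
  refine Finset.sum_congr rfl fun s _ => Finset.sum_congr rfl fun r _ => ?_
  linear_combination (p.1 ^ (-(k : ℤ)) * h r (-1 / p.1) * (-I * p.1) ^ (1 / 2 : ℂ) *
    ((2 * m : ℝ) : ℂ) ^ (-(1 / 2) : ℂ) * ZMod.stdAddChar (-(r * s)) * theta m s p) * hexp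

end ComponentsModular

end Modularity

/-! ### The action of `SL₂(ℤ)` -/

section Slash

open UpperHalfPlane (denom denom_ne_zero denom_cocycle_σ coe_specialLinearGroup_apply)
open scoped UpperHalfPlane MatrixGroups

theorem isOpen_domain : IsOpen domain := isOpen_lt continuous_const (by fun_prop)

theorem denom_mul (γ γ' : SL(2, ℤ)) (τ : ℍ) :
    denom (γ * γ' : SL(2, ℤ)) τ = denom γ (γ' • τ : ℍ) * denom γ' τ := by
  simpa [UpperHalfPlane.σ] using denom_cocycle_σ (γ : GL (Fin 2) ℝ) γ' τ

variable {k m : ℕ}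

theorem slash_apply (F : ℂ × ℂ → ℂ) (γ : SL(2, ℤ)) (τ : ℍ) (z : ℂ) :
    slash k m F γ (τ, z) = denom γ τ ^ (-(k : ℤ)) *
      exp (-(2 * Real.pi * I * m * ((γ 1 0 : ℂ) * z ^ 2 / denom γ τ))) *
        F ((γ • τ : ℍ), z / denom γ τ) := by
  simp [slash, coe_specialLinearGroup_apply, ModularGroup.denom_apply, -ModularGroup.sl_moeb]

theorem lowerLeft_mul (γ γ' : SL(2, ℤ)) (τ : ℍ) :
    ((γ * γ') 1 0 : ℂ) * denom γ' τ = γ 1 0 + γ' 1 0 * denom (γ * γ' : SL(2, ℤ)) τ := by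
  have hdet : (γ' 0 0 : ℂ) * γ' 1 1 - γ' 0 1 * γ' 1 0 = 1 := by
    exact_mod_cast (Matrix.det_fin_two γ'.1).symm.trans γ'.2
  simp only [ModularGroup.denom_apply, Matrix.SpecialLinearGroup.coe_mul, Matrix.mul_apply,
    Fin.sum_univ_two]
  push_cast
  linear_combination (γ 1 0 : ℂ) * hdet

theorem slash_mul (F : ℂ × ℂ → ℂ) (γ γ' : SL(2, ℤ)) {p : ℂ × ℂ} (hp : p ∈ domain) :
    slash k m F (γ * γ') p = slash k m (slash k m F γ) γ' p := by
  obtain ⟨τ, z⟩ := p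
  lift τ to ℍ using hp
  have hJ := denom_ne_zero γ (γ' • τ)
  have hj := denom_ne_zero γ' τ
  have hexponent : ((γ * γ') 1 0 : ℂ) * z ^ 2 / (denom γ (γ' • τ : ℍ) * denom γ' τ) =
      γ 1 0 * (z / denom γ' τ) ^ 2 / denom γ (γ' • τ : ℍ) + γ' 1 0 * z ^ 2 / denom γ' τ := by
    have hc := lowerLeft_mul γ γ' τ
    rw [denom_mul] at hc
    field_simp
    linear_combination z ^ 2 * hc
  rw [slash_apply, slash_apply, slash_apply, ← mul_smul, div_div, mul_comm (denom γ' τ), denom_mul,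
    hexponent, mul_zpow, mul_add, neg_add, exp_add]
  ring

theorem slash_one (F : ℂ × ℂ → ℂ) (p : ℂ × ℂ) : slash k m F 1 p = F p := by
  simp [slash]

theorem slash_congr {F G : ℂ × ℂ → ℂ} (h : ∀ p ∈ domain, F p = G p) (γ : SL(2, ℤ)) {p : ℂ × ℂ}
    (hp : p ∈ domain) : slash k m F γ p = slash k m G γ p := by
  obtain ⟨τ, z⟩ := p
  lift τ to ℍ using hp
  rw [slash_apply, slash_apply, h _ (γ • τ).im_pos]

theorem slash_eq_of_generators {F : ℂ × ℂ → ℂ}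
    (hS : ∀ p ∈ domain, slash k m F ModularGroup.S p = F p)
    (hT : ∀ p ∈ domain, slash k m F ModularGroup.T p = F p)
    (γ : SL(2, ℤ)) : ∀ p ∈ domain, slash k m F γ p = F p := by
  have hγ : γ ∈ Subgroup.closure {ModularGroup.S, ModularGroup.T} := by
    rw [_root_.SpecialLinearGroup.SL2Z_generators]
    trivial
  induction hγ using Subgroup.closure_induction with
  | mem x hx =>
    rcases hx with rfl | rfl
    · exact hS
    · exact hT
  | one => exact fun p _ => slash_one F p
  | mul x y _ _ hx hy =>
    intro p hp
    rw [slash_mul F x y hp, slash_congr hx y hp, hy p hp]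
  | inv x _ hx =>
    intro p hp
    rw [← slash_congr hx x⁻¹ hp, ← slash_mul F x x⁻¹ hp, mul_inv_cancel, slash_one]

theorem slash_S (F : ℂ × ℂ → ℂ) (p : ℂ × ℂ) : slash k m F ModularGroup.S p =
    p.1 ^ (-(k : ℤ)) * exp (-(2 * Real.pi * I * m * (p.2 ^ 2 / p.1))) *
      F (-1 / p.1, p.2 / p.1) := by
  simp [slash, ModularGroup.S]

theorem slash_T (F : ℂ × ℂ → ℂ) (p : ℂ × ℂ) :
    slash k m F ModularGroup.T p = F (p.1 + 1, p.2) := by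
  simp [slash, ModularGroup.T]

theorem slash_T_fourierSeries (cp cm : ℤ → ℤ → ℂ) (p : ℂ × ℂ) :
    slash k m (fourierSeries k m cp cm) ModularGroup.T p = fourierSeries k m cp cm p := by
  have hmonomial (l r : ℤ) : monomial l r (p.1 + 1, p.2) = monomial l r p := by
    rw [monomial, monomial]
    congr 1
    rw [exp_eq_exp_iff_exists_int]
    exact ⟨l, by ring⟩
  simp only [slash_T, fourierSeries, hmonomial, add_im, one_im, add_zero]

end Slash

/-! ### The Casimir operator -/

/-- `F` is real differentiable at `p` with `∂F/∂τ = A`, `∂F/∂τ̄ = B`, `∂F/∂z = C` and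
`∂F/∂z̄ = 0`. -/
def HasWirtinger₂ (F : ℂ × ℂ → ℂ) (A B C : ℂ) (p : ℂ × ℂ) : Prop :=
  HasFDerivAt F ((wirtingerCLM A B).comp (ContinuousLinearMap.fst ℝ ℂ ℂ) +
    (wirtingerCLM C 0).comp (ContinuousLinearMap.snd ℝ ℂ ℂ)) p

namespace HasWirtinger₂

variable {F : ℂ × ℂ → ℂ} {A B C : ℂ} {p : ℂ × ℂ}

theorem fderiv_apply (h : HasWirtinger₂ F A B C p) (w w' : ℂ) :
    fderiv ℝ F p (w, w') = A * w + B * (starRingEnd ℂ) w + C * w' := by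
  rw [HasFDerivAt.fderiv h]
  simp

theorem dTau_eq (h : HasWirtinger₂ F A B C p) : dTau F p = A := by
  rw [dTau, h.fderiv_apply, h.fderiv_apply, map_one, conj_I]
  linear_combination (-(A - B) / 2) * I_mul_I

theorem dTauBar_eq (h : HasWirtinger₂ F A B C p) : dTauBar F p = B := by
  rw [dTauBar, h.fderiv_apply, h.fderiv_apply, map_one, conj_I]
  linear_combination ((A - B) / 2) * I_mul_I

theorem dZ_eq (h : HasWirtinger₂ F A B C p) : dZ F p = C := by
  rw [dZ, h.fderiv_apply, h.fderiv_apply, map_zero]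
  linear_combination (-C / 2) * I_mul_I

theorem dZBar_eq (h : HasWirtinger₂ F A B C p) : dZBar F p = 0 := by
  rw [dZBar, h.fderiv_apply, h.fderiv_apply, map_zero]
  linear_combination (C / 2) * I_mul_I

theorem congr_of_eqOn {G : ℂ × ℂ → ℂ} {U : Set (ℂ × ℂ)} (h : HasWirtinger₂ F A B C p)
    (hU : IsOpen U) (hp : p ∈ U) (hG : ∀ x ∈ U, G x = F x) : HasWirtinger₂ G A B C p :=
  HasFDerivAt.congr_of_eventuallyEq h (by filter_upwards [hU.mem_nhds hp] with x hx using hG x hx)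

theorem zero : HasWirtinger₂ (fun _ => 0) 0 0 0 p := by
  refine (hasFDerivAt_const (0 : ℂ) p).congr_fderiv ?_
  ext <;> simp

theorem sum {ι : Type*} {s : Finset ι} {F : ι → ℂ × ℂ → ℂ} {A B C : ι → ℂ}
    (h : ∀ i ∈ s, HasWirtinger₂ (F i) (A i) (B i) (C i) p) :
    HasWirtinger₂ (fun x => ∑ i ∈ s, F i x) (∑ i ∈ s, A i) (∑ i ∈ s, B i) (∑ i ∈ s, C i) p := by
  refine (HasFDerivAt.fun_sum h).congr_fderiv ?_
  ext <;> simp [Finset.sum_add_distrib, Finset.sum_mul]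

theorem mul {f : ℂ → ℂ} {θ : ℂ × ℂ → ℂ} {a b a' c' : ℂ} (hf : HasWirtinger f a b p.1)
    (hθ : HasFDerivAt (𝕜 := ℂ) θ
      (a' • ContinuousLinearMap.fst ℂ ℂ ℂ + c' • ContinuousLinearMap.snd ℂ ℂ ℂ) p) :
    HasWirtinger₂ (fun x => f x.1 * θ x) (a * θ p + f p.1 * a') (b * θ p) (f p.1 * c') p := by
  have hf' : HasFDerivAt (fun x : ℂ × ℂ => f x.1) _ p :=
    HasFDerivAt.comp p hf (ContinuousLinearMap.fst ℝ ℂ ℂ).hasFDerivAt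
  refine (hf'.mul (hθ.restrictScalars ℝ)).congr_fderiv ?_
  ext <;> simp <;> ring

end HasWirtinger₂

theorem casimir_of_dZBar_eq_zero (k m : ℕ) {F : ℂ × ℂ → ℂ} (hF : ∀ p ∈ domain, dZBar F p = 0)
    {p : ℂ × ℂ} (hp : p ∈ domain) :
    casimir k m F p = -2 * (2 * I * p.1.im) ^ 2 * dTau (dTauBar F) p -
      (2 * k - 1) * (2 * I * p.1.im) * dTauBar F p +
        (2 * I * p.1.im) ^ 2 / (4 * Real.pi * I * m) * dTauBar (dZ (dZ F)) p := by
  have hzero {G : ℂ × ℂ → ℂ} (hG : ∀ x ∈ domain, G x = 0) (x : ℂ × ℂ) (hx : x ∈ domain) :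
      HasWirtinger₂ G 0 0 0 x := HasWirtinger₂.zero.congr_of_eqOn isOpen_domain hx hG
  have hZ := hzero fun x hx => (hzero hF x hx).dZ_eq
  have hZBar := hzero fun x hx => (hzero hF x hx).dZBar_eq
  have him : p.1 - (starRingEnd ℂ) p.1 = 2 * I * p.1.im := by
    rw [sub_conj]
    push_cast
    ring
  simp only [casimir, him, hF p hp, (hzero hF p hp).dZ_eq, (hzero hF p hp).dTau_eq,
    (hzero hF p hp).dZBar_eq, (hZ p hp).dZ_eq, (hZBar p hp).dZ_eq, (hZBar p hp).dTau_eq, mul_zero,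
    add_zero, sub_zero]

theorem WeightedHarmonic.exists_hasWirtinger {q : ℝ} {h a b : ℂ → ℂ}
    (hh : WeightedHarmonic q h a b) {τ : ℂ} (hτ : τ ∈ upperHalfPlaneSet) :
    ∃ b', HasWirtinger b (q / (2 * I * τ.im) * b τ) b' τ := by
  obtain ⟨g, hg, hb⟩ := hh.exists_shadow
  have hv : 0 < τ.im := hτ
  have hpow := HasWirtinger.comp_im (τ := τ)
    (Real.hasDerivAt_rpow_const (p := q) (Or.inl hv.ne')).ofReal_comp
  have hconj := (HasWirtinger.of_hasDerivAt
    (hg.differentiableAt (isOpen_upperHalfPlaneSet.mem_nhds hτ)).hasDerivAt).conj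
  have hbg : b =ᶠ[𝓝 τ] fun x => (x.im ^ q : ℝ) * (starRingEnd ℂ) (g x) := by
    filter_upwards [isOpen_upperHalfPlaneSet.mem_nhds hτ] with x hx using hb x hx
  have hmul := (hpow.mul hconj).hasFDerivAt.congr_of_eventuallyEq hbg
  refine ⟨_, HasWirtinger.congr_coeff hmul ?_ rfl⟩
  have hvc : (τ.im : ℂ) ≠ 0 := by exact_mod_cast hv.ne'
  rw [hb τ hτ, Real.rpow_sub_one hv.ne', map_zero, mul_zero, add_zero]
  push_cast
  field_simp

section SumTheta

variable {ι : Type*} [Fintype ι] {m : ℕ} {F : ℂ × ℂ → ℂ} {h : ι → ℂ → ℂ} {c : ι → ℤ → ℂ}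

theorem hasWirtinger₂_sum_theta (hm : 0 < m)
    (hF : ∀ p ∈ domain, F p = ∑ s, h s p.1 * thetaSeries m (c s) p)
    (hc : ∀ s, GaussSummable (c s)) {p : ℂ × ℂ} (hp : p ∈ domain) {a b : ι → ℂ}
    (hh : ∀ s, HasWirtinger (h s) (a s) (b s) p.1) :
    HasWirtinger₂ F
      (∑ s, (a s * thetaSeries m (c s) p + h s p.1 * thetaSeries m (thetaCoeffTau m (c s)) p))
      (∑ s, b s * thetaSeries m (c s) p)
      (∑ s, h s p.1 * thetaSeries m (thetaCoeffZ (c s)) p) p :=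
  (HasWirtinger₂.sum fun s _ => HasWirtinger₂.mul (hh s)
    (hasFDerivAt_thetaSeries hm (hc s) hp)).congr_of_eqOn isOpen_domain hp hF

/-- By the heat equation, `∂τ̄∂z∂z` of `∑ h_s θ_s` cancels the part of `∂τ∂τ̄` in which `∂τ`
differentiates `θ_s`; what remains vanishes because `∂h_s/∂τ̄` is `v ^ (1/2 - k)` times an
antiholomorphic function. -/
theorem casimir_sum_theta (hm : 0 < m) {k : ℕ}
    (hF : ∀ p ∈ domain, F p = ∑ s, h s p.1 * thetaSeries m (c s) p)
    (hc : ∀ s, GaussSummable (c s)) {a b : ι → ℂ → ℂ}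
    (hh : ∀ s, WeightedHarmonic (1 / 2 - k) (h s) (a s) (b s)) {p : ℂ × ℂ} (hp : p ∈ domain) :
    casimir k m F p = 0 := by
  have hhs (x : ℂ × ℂ) (hx : x ∈ domain) (s : ι) := (hh s).hasWirtinger x.1 hx
  have hF₁ (x : ℂ × ℂ) (hx : x ∈ domain) := hasWirtinger₂_sum_theta hm hF hc hx (hhs x hx)
  have hdZ (x : ℂ × ℂ) (hx : x ∈ domain) := hasWirtinger₂_sum_theta hm
    (fun y hy => (hF₁ y hy).dZ_eq) (fun s => (hc s).z) hx (hhs x hx)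
  have hdZdZ := hasWirtinger₂_sum_theta hm (fun y hy => (hdZ y hy).dZ_eq) (fun s => (hc s).z.z) hp
    (hhs p hp)
  choose b' hb' using fun s => (hh s).exists_hasWirtinger (show p.1 ∈ upperHalfPlaneSet from hp)
  have hdTauBar := hasWirtinger₂_sum_theta hm (fun y hy => (hF₁ y hy).dTauBar_eq) hc hp hb'
  have hvc : (p.1.im : ℂ) ≠ 0 := ofReal_ne_zero.2 (ne_of_gt hp)
  have hmc : (m : ℂ) ≠ 0 := by exact_mod_cast hm.ne'
  have hpi : (Real.pi : ℂ) ≠ 0 := by exact_mod_cast Real.pi_ne_zero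
  rw [casimir_of_dZBar_eq_zero k m (fun x hx => (hF₁ x hx).dZBar_eq) hp, hdTauBar.dTau_eq,
    (hF₁ p hp).dTauBar_eq, hdZdZ.dTauBar_eq]
  simp only [heat_equation hm, Finset.mul_sum]
  rw [← Finset.sum_sub_distrib, ← Finset.sum_add_distrib]
  refine Finset.sum_eq_zero fun s _ => ?_
  push_cast
  field_simp
  ring

end SumTheta

/-! ### Growth -/

section Growth

variable {k m : ℕ}

theorem norm_tsum_le_of_exp_tail {f b : ℤ → ℂ} (hb : Subexp b) {α K v : ℝ} (hα : 0 < α)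
    (hv : 1 ≤ v) (hK : 0 ≤ K) (hf0 : f 0 = 0)
    (h : ∀ D : ℤ, ‖f D‖ ≤ K * (‖b D‖ * Real.exp (-(α * v) * |(D : ℝ)|))) :
    ‖∑' D, f D‖ ≤ (K * ∑' D : ℤ, ‖b D‖ * Real.exp (-(α / 2) * |(D : ℝ)|)) *
      Real.exp (-(α / 2) * v) := by
  have hsum := (hb (α / 2) (half_pos hα)).mul_left (K * Real.exp (-(α / 2) * v))
  refine (tsum_of_norm_bounded hsum.hasSum fun D => ?_).trans_eq (by rw [tsum_mul_left]; ring)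
  rcases eq_or_ne D 0 with rfl | hD
  · rw [hf0, norm_zero]
    positivity
  have hexp : Real.exp (-(α * v) * |(D : ℝ)|) ≤
      Real.exp (-(α / 2) * v) * Real.exp (-(α / 2) * |(D : ℝ)|) := by
    rw [← Real.exp_add]
    gcongr
    have hD1 : (1 : ℝ) ≤ |(D : ℝ)| := by exact_mod_cast Int.one_le_abs hD
    have hadd : v + |(D : ℝ)| ≤ 2 * (v * |(D : ℝ)|) := by
      nlinarith [mul_nonneg (sub_nonneg.2 hv) (sub_nonneg.2 hD1)]
    nlinarith
  calc ‖f D‖ ≤ K * (‖b D‖ * Real.exp (-(α * v) * |(D : ℝ)|)) := h D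
    _ ≤ K * (‖b D‖ * (Real.exp (-(α / 2) * v) * Real.exp (-(α / 2) * |(D : ℝ)|))) := by gcongr
    _ = _ := by ring

/-- The part of the series `holSeries m b` with nonpositive exponents. -/
def principalSeries (m : ℕ) (b : ℤ → ℂ) (τ : ℂ) : ℂ :=
  ∑' D : ℤ, if D ≤ 0 then b D * qExp m D τ else 0

theorem summable_principalSeries {b : ℤ → ℂ} (hm : 0 < m) (hb : Subexp b) {N : ℕ}
    (hN : ∀ D < -(N : ℤ), b D = 0) {τ : ℂ} (hτ : τ ∈ upperHalfPlaneSet) :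
    Summable fun D : ℤ => ‖if D ≤ 0 then b D * qExp m D τ else 0‖ := by
  refine (summable_holSeries hm hb hN hτ).of_nonneg_of_le (fun _ => norm_nonneg _) fun D => ?_
  split_ifs
  · exact le_rfl
  · rw [norm_zero]
    exact norm_nonneg _

theorem exists_norm_holSeries_sub_principalSeries_le {b : ℤ → ℂ} (hm : 0 < m) (hb : Subexp b)
    {N : ℕ} (hN : ∀ D < -(N : ℤ), b D = 0) : ∃ A : ℝ, ∀ τ : ℂ, 1 ≤ τ.im →
      ‖holSeries m b τ - principalSeries m b τ‖ ≤
        A * Real.exp (-(Real.pi / (2 * m) / 2) * τ.im) := by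
  have hα : 0 < Real.pi / (2 * m) := by positivity
  refine ⟨1 * ∑' D : ℤ, ‖b D‖ * Real.exp (-(Real.pi / (2 * m) / 2) * |(D : ℝ)|), fun τ hτ => ?_⟩
  have hmem : τ ∈ upperHalfPlaneSet := one_pos.trans_le hτ
  rw [holSeries, principalSeries, ← (summable_holSeries hm hb hN hmem).of_norm.tsum_sub
    (summable_principalSeries hm hb hN hmem).of_norm]
  refine norm_tsum_le_of_exp_tail hb hα hτ zero_le_one (by simp) fun D => ?_
  split_ifs with hD
  · rw [sub_self, norm_zero]
    positivity
  · rw [sub_zero, norm_mul, norm_qExp, one_mul, abs_of_pos (by exact_mod_cast not_le.1 hD)]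
    exact le_of_eq (by ring_nf)

theorem exists_norm_nonSeries_le {a : ℝ} {b : ℤ → ℂ} (ha : a ≤ 1) (hm : 0 < m) (hb : Subexp b)
    (hN : ∀ D : ℤ, 0 ≤ D → b D = 0) : ∃ A : ℝ, ∀ τ : ℂ, 1 ≤ τ.im →
      ‖nonSeries a m b τ‖ ≤ A * Real.exp (-(Real.pi / (2 * m) / 2) * τ.im) := by
  have hα : 0 < Real.pi / (2 * m) := by positivity
  refine ⟨_, fun τ hτ => norm_tsum_le_of_exp_tail hb hα hτ
    (K := (Real.pi / m) ^ (a - 1)) (by positivity) (by simp [hN]) fun D => ?_⟩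
  refine (norm_nonSeries_term_le ha hm hN (one_pos.trans_le hτ) le_rfl D).trans ?_
  gcongr ?_ * _
  refine Real.rpow_le_rpow_of_nonpos (by positivity) ?_ (by linarith)
  gcongr
  exact le_mul_of_one_le_right Real.pi_nonneg hτ

theorem Admissible.exists_norm_sub_principalSeries_le {bp bn : ℤ → ℂ} (h : Admissible bp bn)
    (hk : 0 < k) (hm : 0 < m) : ∃ A : ℝ, ∀ τ : ℂ, 1 ≤ τ.im →
      ‖maassSeries k m bp bn τ - principalSeries m bp τ‖ ≤
        A * Real.exp (-(Real.pi / (2 * m) / 2) * τ.im) := by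
  obtain ⟨N, hN⟩ := h.hol_support
  obtain ⟨A, hA⟩ := exists_norm_holSeries_sub_principalSeries_le hm h.hol hN
  obtain ⟨B, hB⟩ :=
    exists_norm_nonSeries_le (three_halves_sub_le_one hk) hm h.non h.non_support
  refine ⟨A + B, fun τ hτ => ?_⟩
  rw [maassSeries, add_sub_right_comm, add_mul]
  exact (norm_add_le _ _).trans (add_le_add (hA τ hτ) (hB τ hτ))

theorem principalPart_eq_sum_theta [NeZero (2 * m)] (hm : 0 < m) {cp : ℤ → ℤ → ℂ}
    (hcp : DiscInvariant m cp) {p : ℂ × ℂ} (hp : p ∈ domain)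
    (hsum : ∀ s, Summable fun D : ℤ => ‖if D ≤ 0 then coeff m cp s D * qExp m D p.1 else 0‖) :
    principalPart m (fun D s => coeff m cp s D) p =
      ∑ s, principalSeries m (coeff m cp s) p.1 * theta m s p := by
  have hprod := tsum_disc_prod hm hcp fun D r =>
    if D ≤ 0 then qExp m D p.1 * thetaTerm m r p else 0
  refine (tsum_congr fun a => ?_).trans (hprod.trans ((tsum_congr fun x => ?_).trans
    (tsum_mul_thetaTerm_eq_sum_theta hm hp hsum)))
  · beta_reduce
    rw [coeff_disc hcp, monomial_eq_qExp_mul_thetaTerm hm, mul_ite, mul_zero]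
  · split_ifs
    · ring
    · simp

end Growth

section Coefficients

variable {m : ℕ} {cp cm : ℤ → ℤ → ℂ}

theorem discInvariant_negPart
    (h : ∀ l r l' r' : ℤ, disc m l r < 0 → disc m l r = disc m l' r' →
      r ≡ r' [ZMOD (2 * m)] → cm l r = cm l' r') : DiscInvariant m (negPart m cm) := by
  intro l r l' r' hdisc hr
  rw [negPart, negPart, ← hdisc]
  split_ifs with hneg
  · exact h l r l' r' hneg hdisc hr
  · rfl

theorem coeff_eq_zero_of_lt {D₀ D : ℤ} (hD₀ : ∀ l r : ℤ, disc m l r < -D₀ → cp l r = 0)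
    (hD : D < -D₀) (s : ZMod (2 * m)) : coeff m cp s D = 0 := by
  by_contra h
  obtain ⟨l, r, rfl, -, hcoeff⟩ := exists_of_coeff_ne_zero h
  exact h (hcoeff.trans (hD₀ l r hD))

theorem coeff_negPart_eq_zero {D : ℤ} (hD : 0 ≤ D) (s : ZMod (2 * m)) :
    coeff m (negPart m cm) s D = 0 := by
  by_contra h
  obtain ⟨l, r, rfl, -, hcoeff⟩ := exists_of_coeff_ne_zero h
  exact h (hcoeff.trans (if_neg hD.not_gt))

theorem admissible_coeff {D₀ : ℤ} (hD₀ : ∀ l r : ℤ, disc m l r < -D₀ → cp l r = 0) {A C N : ℝ}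
    (hp : ∀ l r : ℤ, N ≤ |(disc m l r : ℝ)| →
      ‖cp l r‖ ≤ A * Real.exp (C * √|(disc m l r : ℝ)|))
    (hn : ∀ l r : ℤ, N ≤ |(disc m l r : ℝ)| → disc m l r < 0 →
      ‖cm l r‖ ≤ A * Real.exp (C * √|(disc m l r : ℝ)|)) (s : ZMod (2 * m)) :
    Admissible (coeff m cp s) (coeff m (negPart m cm) s) where
  hol := subexp_coeff hp s
  non := by
    refine subexp_coeff (A := |A|) (C := C) (N := N) (fun l r hN => ?_) s
    rw [negPart]
    split_ifs with hneg
    · exact (hn l r hN hneg).trans (by gcongr; exact le_abs_self A)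
    · rw [norm_zero]
      positivity
  hol_support := ⟨D₀.toNat, fun D hD => coeff_eq_zero_of_lt hD₀ (by lia) s⟩
  non_support _ hD := coeff_negPart_eq_zero hD s

end Coefficients

/-! ### The Fourier series as a Maass-Jacobi form -/

section FourierSeries

variable {k m : ℕ} [NeZero (2 * m)] {cp cm : ℤ → ℤ → ℂ}

theorem analyticAt_fourierSeries (hk : 0 < k) (hm : 0 < m) (hcp : DiscInvariant m cp)
    (hcm : DiscInvariant m (negPart m cm))
    (hadm : ∀ s, Admissible (coeff m cp s) (coeff m (negPart m cm) s)) {p : ℂ × ℂ}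
    (hp : p ∈ domain) : AnalyticAt ℝ (fourierSeries k m cp cm) p := by
  have hsum : AnalyticAt ℝ (fun p : ℂ × ℂ =>
      ∑ s, thetaComponent k m cp cm s p.1 * theta m s p) p :=
    Finset.analyticAt_fun_sum _ fun s _ =>
      (((hadm s).analyticAt hk hm hp).fun_comp analyticAt_fst).mul
        (analyticAt_thetaSeries hm (gaussSummable_residueCoeff m s) hp)
  refine hsum.congr ?_
  filter_upwards [isOpen_domain.mem_nhds hp] with x hx
  exact (fourierSeries_eq_sum_theta hk hm hcp hcm hadm hx).symm

theorem differentiable_fourierSeries (hk : 0 < k) (hm : 0 < m) (hcp : DiscInvariant m cp)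
    (hcm : DiscInvariant m (negPart m cm))
    (hadm : ∀ s, Admissible (coeff m cp s) (coeff m (negPart m cm) s)) {τ : ℂ}
    (hτ : 0 < τ.im) : Differentiable ℂ fun z => fourierSeries k m cp cm (τ, z) := by
  rw [funext fun z => fourierSeries_eq_sum_theta hk hm hcp hcm hadm (p := (τ, z)) hτ]
  refine Differentiable.fun_sum fun s _ => ?_
  change Differentiable ℂ fun z => thetaComponent k m cp cm s τ * theta m s (τ, z)
  refine Differentiable.const_mul (fun z => ?_) _
  exact (hasFDerivAt_thetaSeries hm (gaussSummable_residueCoeff m s)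
    (p := (τ, z)) hτ).differentiableAt.comp z (by fun_prop)

theorem slash_fourierSeries (hk : 0 < k) (hm : 0 < m) (hcp : DiscInvariant m cp)
    (hcm : DiscInvariant m (negPart m cm))
    (hadm : ∀ s, Admissible (coeff m cp s) (coeff m (negPart m cm) s))
    (hmod : ComponentsModular k m (thetaComponent k m cp cm))
    (γ : Matrix.SpecialLinearGroup (Fin 2) ℤ) {p : ℂ × ℂ} (hp : p ∈ domain) :
    slash k m (fourierSeries k m cp cm) γ p = fourierSeries k m cp cm p := by
  refine slash_eq_of_generators (fun p hp => ?_)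
    (fun p _ => slash_T_fourierSeries cp cm p) γ p hp
  rw [slash_S, fourierSeries_eq_sum_theta hk hm hcp hcm hadm hp,
    fourierSeries_eq_sum_theta hk hm hcp hcm hadm (p := (-1 / p.1, p.2 / p.1))
      (neg_one_div_mem_upperHalfPlaneSet hp),
    hmod.sum_theta_S hm hp]

theorem heisenberg_fourierSeries (hk : 0 < k) (hm : 0 < m) (hcp : DiscInvariant m cp)
    (hcm : DiscInvariant m (negPart m cm))
    (hadm : ∀ s, Admissible (coeff m cp s) (coeff m (negPart m cm) s)) (a b : ℤ) {p : ℂ × ℂ}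
    (hp : p ∈ domain) :
    heisenberg m (fourierSeries k m cp cm) a b p = fourierSeries k m cp cm p := by
  rw [heisenberg, fourierSeries_eq_sum_theta hk hm hcp hcm hadm hp,
    fourierSeries_eq_sum_theta hk hm hcp hcm hadm (p := (p.1, p.2 + a * p.1 + b)) hp,
    Finset.mul_sum]
  refine Finset.sum_congr rfl fun s _ => ?_
  rw [mul_left_comm, theta_heisenberg hm]

theorem exists_norm_fourierSeries_sub_principalPart_le (hk : 0 < k) (hm : 0 < m)
    (hcp : DiscInvariant m cp) (hcm : DiscInvariant m (negPart m cm))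
    (hadm : ∀ s, Admissible (coeff m cp s) (coeff m (negPart m cm) s)) :
    ∃ A : ℝ, ∀ p : ℂ × ℂ, 1 ≤ p.1.im →
      ‖fourierSeries k m cp cm p - principalPart m (fun D s => coeff m cp s D) p‖ ≤
        A * (Real.exp (-(Real.pi / (2 * m) / 2) * p.1.im) *
          Real.exp (2 * Real.pi * m * p.2.im ^ 2 / p.1.im)) := by
  choose A hA using fun s => (hadm s).exists_norm_sub_principalSeries_le hk hm
  choose N hN using fun s => (hadm s).hol_support
  obtain ⟨K, -, hK⟩ := exists_norm_theta_le hm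
  refine ⟨∑ s, A s * K, fun p hv => ?_⟩
  have hp : p ∈ domain := one_pos.trans_le hv
  rw [fourierSeries_eq_sum_theta hk hm hcp hcm hadm hp,
    principalPart_eq_sum_theta hm hcp hp
      fun s => summable_principalSeries hm (hadm s).hol (hN s) hp,
    ← Finset.sum_sub_distrib, Finset.sum_mul]
  refine (norm_sum_le _ _).trans (Finset.sum_le_sum fun s _ => ?_)
  rw [← sub_mul, norm_mul]
  calc _ ≤ _ := mul_le_mul (hA s p.1 hv) (hK s p hv) (norm_nonneg _)
        ((norm_nonneg _).trans (hA s p.1 hv))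
    _ = _ := by ring

theorem isHarmonicMaassJacobiForm_fourierSeries (hk : 0 < k) (hm : 0 < m)
    (hcp : DiscInvariant m cp) (hcm : DiscInvariant m (negPart m cm)) {D₀ : ℤ}
    (hD₀ : ∀ l r : ℤ, disc m l r < -D₀ → cp l r = 0)
    (hadm : ∀ s, Admissible (coeff m cp s) (coeff m (negPart m cm) s))
    (hmod : ComponentsModular k m (thetaComponent k m cp cm)) :
    IsHarmonicMaassJacobiForm k m (fourierSeries k m cp cm) where
  realAnalytic _ hp := analyticAt_fourierSeries hk hm hcp hcm hadm hp
  holomorphic _ hτ := differentiable_fourierSeries hk hm hcp hcm hadm hτ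
  slash_eq γ _ hp := slash_fourierSeries hk hm hcp hcm hadm hmod γ hp
  heisenberg_eq a b _ hp := heisenberg_fourierSeries hk hm hcp hcm hadm a b hp
  casimir_eq _ hp := casimir_sum_theta hm
    (fun _ hp => fourierSeries_eq_sum_theta hk hm hcp hcm hadm hp)
    (fun s => gaussSummable_residueCoeff m s) (fun s => (hadm s).weightedHarmonic hk hm) hp
  growth := by
    obtain ⟨A, hA⟩ := exists_norm_fourierSeries_sub_principalPart_le hk hm hcp hcm hadm
    refine ⟨fun D s => coeff m cp s D, (Set.finite_Icc (-D₀) 0).subset ?_,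
      Real.pi / (2 * m) / 2, by positivity, A, 1, fun p _ hv => hA p hv⟩
    rintro D ⟨hD, s, hs⟩
    exact ⟨not_lt.1 fun hlt => hs (coeff_eq_zero_of_lt hD₀ hlt s), hD⟩

end FourierSeries

end JacobiConverse

end

open JacobiConverse in
theorem mainTheorem3_general (k m : ℕ) (hk : 0 < k) (hm : 0 < m)
    (cp cm : ℤ → ℤ → ℂ)
    (hcp : ∀ l r l' r' : ℤ, disc m l r = disc m l' r' → r ≡ r' [ZMOD (2 * m)] →
      cp l r = cp l' r')
    (hcm : ∀ l r l' r' : ℤ, disc m l r < 0 → disc m l r = disc m l' r' →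
      r ≡ r' [ZMOD (2 * m)] → cm l r = cm l' r')
    (D₀ : ℤ) (hD₀ : ∀ l r : ℤ, disc m l r < -D₀ → cp l r = 0)
    (hgrowth : ∃ C : ℝ, 0 < C ∧ ∃ A N : ℝ, ∀ l r : ℤ, N ≤ |(disc m l r : ℝ)| →
      ‖cp l r‖ ≤ A * Real.exp (C * √|(disc m l r : ℝ)|) ∧
      (disc m l r < 0 → ‖cm l r‖ ≤ A * Real.exp (C * √|(disc m l r : ℝ)|)))
    (Sc : Set (ℝ → ℂ)) (hSc : ∀ φ ∈ Sc, IsTestFunction φ)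
    (hSc_twist : ∀ φ ∈ Sc, ∀ s : ℂ, twist φ s ∈ Sc)
    (hSc_ne : ∀ y : ℝ, 0 < y → ∃ φ ∈ Sc, φ y ≠ 0)
    (hL : ∀ φ ∈ Sc, LSer k m cp cm φ =
      I ^ ((k : ℂ) - 1 / 2) • (weilSBar m).mulVec (LSer k m cp cm (slashS k φ)))
    (hLα : ∀ φ ∈ Sc, LSerAlpha k m cp cm φ =
      -I ^ ((k : ℂ) - 1 / 2) • (weilSBar m).mulVec (LSerAlpha k m cp cm (slashS k φ))) :
    IsHarmonicMaassJacobiForm k m (fourierSeries k m cp cm) := by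
  have : NeZero (2 * m) := ⟨by lia⟩
  obtain ⟨C, -, A, N, hCA⟩ := hgrowth
  have hneg := discInvariant_negPart hcm
  have hadm := admissible_coeff hD₀ (fun l r h => (hCA l r h).1) fun l r h => (hCA l r h).2
  exact isHarmonicMaassJacobiForm_fourierSeries hk hm hcp hneg hD₀ hadm
    (componentsModular_thetaComponent hk hm hcp hneg hadm hSc hSc_twist hSc_ne hL hLα)

open JacobiConverse in
theorem mainTheorem3 (k m : ℕ) (hk : 0 < k) (hk2 : Even k) (hm : 0 < m)
    (cp cm : ℤ → ℤ → ℂ)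
    (hcp : ∀ l r l' r' : ℤ, disc m l r = disc m l' r' → r ≡ r' [ZMOD (2 * m)] →
      cp l r = cp l' r')
    (hcm : ∀ l r l' r' : ℤ, disc m l r < 0 → disc m l r = disc m l' r' →
      r ≡ r' [ZMOD (2 * m)] → cm l r = cm l' r')
    (D₀ : ℤ) (hD₀ : ∀ l r : ℤ, disc m l r < -D₀ → cp l r = 0)
    (hgrowth : ∃ C : ℝ, 0 < C ∧ ∃ A N : ℝ, ∀ l r : ℤ, N ≤ |(disc m l r : ℝ)| →
      ‖cp l r‖ ≤ A * Real.exp (C * √|(disc m l r : ℝ)|) ∧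
      (disc m l r < 0 → ‖cm l r‖ ≤ A * Real.exp (C * √|(disc m l r : ℝ)|)))
    (Sc : Set (ℝ → ℂ)) (hSc : ∀ φ ∈ Sc, IsTestFunction φ)
    (hSc_twist : ∀ φ ∈ Sc, ∀ s : ℂ, twist φ s ∈ Sc)
    (hSc_ne : ∀ y : ℝ, 0 < y → ∃ φ ∈ Sc, φ y ≠ 0)
    (hL : ∀ φ ∈ Sc, LSer k m cp cm φ =
      I ^ ((k : ℂ) - 1 / 2) • (weilSBar m).mulVec (LSer k m cp cm (slashS k φ)))
    (hLα : ∀ φ ∈ Sc, LSerAlpha k m cp cm φ =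
      -I ^ ((k : ℂ) - 1 / 2) • (weilSBar m).mulVec (LSerAlpha k m cp cm (slashS k φ))) :
    IsHarmonicMaassJacobiForm k m (fourierSeries k m cp cm) :=
  mainTheorem3_general k m hk hm cp cm hcp hcm D₀ hD₀ hgrowth Sc hSc hSc_twist hSc_ne hL hLα
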